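/- Let $\alpha:[0,1]\to\mathbb R$ be a strictly increasing, continuous, piecewise differentiable function with $\alpha(0)=0$ and $\alpha'(u)\ge 1$ for all $u\in(0,1)$ outside a finite set. For $\mathfrak q>0$, $\mathfrak q\neq 1$, put $$x(t)=\mathfrak q^{-t\int_0^1\frac{du}{t-\mathfrak q^{\alpha(u)}}},\qquad \mathfrak q^{X(t)}=\frac{t^2x'(t)}{t\,x'(t)+x(t)(1-x(t))},\qquad \mathfrak q^{Y(t)}=\frac{t\,x'(t)+1-x(t)}{t\,x'(t)+x(t)(1-x(t))}.$$ The left part of the arctic curve is the set of points $(X(t),Y(t))$ with $t\in\,]-\infty,1[$ if $\mathfrak q>1$, and $t\in\,]1,\infty[$ if $\mathfrak q<1$; the right part is the set of points $(X(t),Y(t))$ with $t\in\,]\mathfrak q^{\alpha(1)},\infty[$ if $\mathfrak q>1$, and $t\in\,]-\infty,\mathfrak q^{\alpha(1)}[$ if $\mathfrak q<1$ (always $t\ne0$, where the formulas read $0/0$). On these ranges the integral converges, $x$ is differentiable, and for $t\neq 0$ the two quotients are positive, so that $X(t),Y(t)$ are well defined. Convergence of curves below means convergence in the Hausdorff distance.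 We say that $\alpha$ has no fully filled interval if there is no nonempty open subinterval of $[0,1]$ all along which $\alpha'=1$. **Limit $\mathfrak q\to\infty$.** 1. If $\alpha$ has no fully filled interval, then for $t=-\mathfrak q^{\alpha(\tau)}$ with fixed $\tau\in(0,1)$ one has $(X(t),Y(t))\to(\alpha(\tau),\tau)$, and the left part converges to the curve $\{(\alpha(\tau),\tau):0\le\tau\le1\}$. 2. Suppose that the one-sided derivative $\alpha'(1)$ exists. For $t=\mathfrak q^{\alpha(1)}/(1-\mathfrak q^{-\rho})$ with fixed $\rho>0$ one has $(X(t),Y(t))\to\bigl(\alpha(1),\max(1-\rho(1-1/\alpha'(1)),0)\bigr)$. If $\alpha'(1)>1$, the right part converges to the vertical segment from $(\alpha(1),0)$ to $(\alpha(1),1)$. If instead $\alpha'(1)=1$, more precisely if $\alpha(u)=\alpha(1)-(1-u)+O((1-u)^2)$ as $u\to1^-$, the right part converges to the single point $(\alpha(1),1)$. **Limit $\mathfrak q\to0^+$.** 3. If $\alpha$ has no fully filled interval, then for $t=-\mathfrak q^{\alpha(\tau)}$ with fixed $\tau\in(0,1)$ one has $(X(t),Y(t))\to(\alpha(\tau)+1-\tau,1-\tau)$,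 and the right part converges to the curve $\{(\alpha(\tau)+1-\tau,\,1-\tau):0\le\tau\le1\}$. 4. Suppose that the one-sided derivative $\alpha'(0)$ exists. For $t=1/(1-\mathfrak q^{\rho})$ with fixed $\rho>0$ one has $X(t),Y(t)\to\max(1-\rho(1-1/\alpha'(0)),0)$. If $\alpha'(0)>1$, the left part converges to the diagonal segment from $(0,0)$ to $(1,1)$. If instead $\alpha'(0)=1$, more precisely if $\alpha(u)=u+O(u^2)$ as $u\to0^+$, the left part converges to the single point $(1,1)$. -/

import Mathlib

open Set Filter Topology Asymptotics

/-- The limiting distribution of starting points: an increasing, continuous, piecewise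
differentiable function on `[0,1]` with `α 0 = 0` and `α' ≥ 1` wherever it is required to exist
(off a finite set). -/
structure IsStartingProfile (α : ℝ → ℝ) : Prop where
  zero : α 0 = 0
  increasing : StrictMonoOn α (Icc 0 1)
  continuousOn : ContinuousOn α (Icc 0 1)
  piecewise : ∃ S : Set ℝ, S.Finite ∧
    ∀ u ∈ Ioo (0 : ℝ) 1 \ S, DifferentiableAt ℝ α u ∧ 1 ≤ deriv α u

/-- There is no fully filled interval, i.e. no nonempty open subinterval of `[0,1]` all along
which `α' = 1`. Isolated points with `α' = 1` are allowed. -/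
def NoFilledInterval (α : ℝ → ℝ) : Prop :=
  ∀ c d : ℝ, 0 ≤ c → c < d → d ≤ 1 → ∃ u ∈ Ioo c d, ¬ HasDerivAt α 1 u

noncomputable section

/-- The `q`-deformed exponential moment-generating function `x(t)` of `α`. -/
def momentGen (α : ℝ → ℝ) (q t : ℝ) : ℝ :=
  q ^ (-t * ∫ u in (0 : ℝ)..1, 1 / (t - q ^ α u))

/-- The right-hand side of the parametric equation for `q ^ X(t)`. -/
def arcticExpX (α : ℝ → ℝ) (q t : ℝ) : ℝ :=
  t ^ 2 * deriv (momentGen α q) t /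
    (t * deriv (momentGen α q) t + momentGen α q t * (1 - momentGen α q t))

/-- The right-hand side of the parametric equation for `q ^ Y(t)`. -/
def arcticExpY (α : ℝ → ℝ) (q t : ℝ) : ℝ :=
  (t * deriv (momentGen α q) t + 1 - momentGen α q t) /
    (t * deriv (momentGen α q) t + momentGen α q t * (1 - momentGen α q t))

/-- The point `(X(t), Y(t))` of the arctic curve. -/
def arcticPoint (α : ℝ → ℝ) (q t : ℝ) : ℝ × ℝ :=
  (Real.logb q (arcticExpX α q t), Real.logb q (arcticExpY α q t))

/-- Range of `t` for the left part: `]-∞, 1[` if `q > 1`, `]1, ∞[` if `q < 1`. -/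
def leftRange (q : ℝ) : Set ℝ :=
  {t | (1 < q ∧ t < 1) ∨ (q < 1 ∧ 1 < t)}

/-- Range of `t` for the right part: `]q ^ α(1), ∞[` if `q > 1`, `]-∞, q ^ α(1)[` if `q < 1`. -/
def rightRange (α : ℝ → ℝ) (q : ℝ) : Set ℝ :=
  {t | (1 < q ∧ q ^ α 1 < t) ∨ (q < 1 ∧ t < q ^ α 1)}

/-- The left part of the arctic curve. The parameter `t = 0` is omitted, since both quotients
read `0 / 0` there; the missing point is a limit of the others, so Hausdorff distances to the
curve are not affected. -/
def leftPart (α : ℝ → ℝ) (q : ℝ) : Set (ℝ × ℝ) :=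
  arcticPoint α q '' (leftRange q \ {0})

/-- The right part of the arctic curve (again with `t = 0` omitted). -/
def rightPart (α : ℝ → ℝ) (q : ℝ) : Set (ℝ × ℝ) :=
  arcticPoint α q '' (rightRange α q \ {0})

/-- The plane sets `C q` converge to `K` in the Hausdorff distance along the filter `l`. -/
def HausdorffTendsto (C : ℝ → Set (ℝ × ℝ)) (l : Filter ℝ) (K : Set (ℝ × ℝ)) : Prop :=
  Tendsto (fun q => Metric.hausdorffEDist (C q) K) l (𝓝 0)

end

/-! ### General lemmas -/

/-! Take q > 1 and write p(u) = t / (t - q^α(u)), Z(v) = log q · ∫₀ᵛ p, P = Z(1) and J = log q · ∫₀¹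
p(1 - p). Then x = e^(-P), and t dp/dt = p(1 - p) gives t x' = -x J. A factor x cancels from both
quotients: q^X = -tJ/E and q^Y = N/E, with E = 1 - e^(-P) - J and N = e^P - 1 - J.

The hypothesis α' ≥ 1 enters through R = log|1 - p| - Z, whose u-derivative is log q · p · (α' - 1):
R is monotone in the direction given by the sign of p (`IsOff.monotoneOn_logRatio`). Since p e^Z log
q is the derivative of e^Z and J is the integral of p e^Z log q against e^(-Z)(1 - p) = ±e^R, this
monotonicity controls E, J and their derivatives. It makes E and N positive (`IsOff.denom_pos`), and
a Chebyshev-Cauchy inequality (`WeightSigns.firstVar_sq_mul_le`) shows that X and Y are monotone in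
t on each of t < 0, 0 < t < 1 and t > q^α(1). Monotonicity turns pointwise limits into uniform ones,
and reduces bounds for all t to the behaviour at one end of the range.

As q → ∞ with t = -q^α(τ), the weight p tends to the indicator of u < τ. So e^P is about q^τ, while
J and E are q^o(1); the lower bound on E needs α - id to increase strictly to the left of τ, which
is what the absence of filled intervals provides (`tendsto_arcticPoint_neg_rpow`). The points with 0
< t < 1 collapse to the origin (`eventually_logb_le_of_pos`).

On the right part X tends to α(1) uniformly. With p(1) = q^ρ, the slope a of α at 1 gives ∫p → 1 +
ρ/a; hence N grows like the larger of q^(1 + ρ/a) and q^ρ, and E like q^ρ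
(`tendsto_logb_arcticExpY_right`). If α agrees with slope 1 at the end up to a quadratic error,
comparison with the exactly linear profile costs only a bounded amount in P, and q^Y ≥ e^(-C)(q - 1)
for all t (`le_arcticExpY_of_gt`).

The limit q → 0 follows by duality: reading α from its right end, inverting q and rescaling t
replaces x by 1/x, and acts on the plane by the Lipschitz map (X, Y) ↦ (α(1) - X + Y, Y)
(`arcticPoint_dual`), which exchanges left and right parts. -/

theorem monotoneOn_Icc_of_deriv_nonneg_off_finite {f f' : ℝ → ℝ} {S : Set ℝ} (hS : S.Finite) :
    ∀ {a b : ℝ}, ContinuousOn f (Icc a b) →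
      (∀ u ∈ Ioo a b \ S, HasDerivAt f (f' u) u ∧ 0 ≤ f' u) → MonotoneOn f (Icc a b) := by
  induction S, hS using Set.Finite.induction_on with
  | empty =>
    intro a b hf hd
    simp only [sdiff_empty] at hd
    refine monotoneOn_of_deriv_nonneg (convex_Icc a b) hf ?_ ?_
    · rw [interior_Icc]
      exact fun u hu => (hd u hu).1.differentiableAt.differentiableWithinAt
    · rw [interior_Icc]
      intro u hu
      rw [(hd u hu).1.deriv]
      exact (hd u hu).2
  | @insert c S _ _ ih =>
    intro a b hf hd
    -- An exceptional point inside the interval splits it in two; each half has one exceptional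
    -- point fewer, and continuity lets the two monotone pieces be glued at `c`.
    by_cases hc : c ∈ Ioo a b
    · have h1 : MonotoneOn f (Icc a c) := by
        refine ih (hf.mono (Icc_subset_Icc_right hc.2.le)) fun u hu => hd u ⟨⟨hu.1.1, hu.1.2.trans hc.2⟩, ?_⟩
        rintro (h | h)
        · exact hu.1.2.ne h
        · exact hu.2 h
      have h2 : MonotoneOn f (Icc c b) := by
        refine ih (hf.mono (Icc_subset_Icc_left hc.1.le)) fun u hu => hd u ⟨⟨hc.1.trans hu.1.1, hu.1.2⟩, ?_⟩
        rintro (h | h)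
        · exact hu.1.1.ne' h
        · exact hu.2 h
      have := h1.union_right h2 (isGreatest_Icc hc.1.le) (isLeast_Icc hc.2.le)
      rwa [Icc_union_Icc_eq_Icc hc.1.le hc.2.le] at this
    · refine ih hf fun u hu => hd u ⟨hu.1, ?_⟩
      rintro (h | h)
      · exact hc (h ▸ hu.1)
      · exact hu.2 h

/-- Differentiation under the integral sign: a gap `δ` between `t` and the values of `s` leaves a
gap `δ / 2` on a ball around `t`, and this dominates the derivative by a constant. The moments of
the weight are all built from these integrals. -/
theorem hasDerivAt_integral_inv_pow {s : ℝ → ℝ} (hs : Continuous s) {t δ : ℝ} (hδ : 0 < δ)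
    (ht : ∀ u, δ ≤ |t - s u|) (n : ℕ) :
    HasDerivAt (fun t => ∫ u in (0 : ℝ)..1, ((t - s u) ^ n)⁻¹)
      (-n * ∫ u in (0 : ℝ)..1, ((t - s u) ^ (n + 1))⁻¹) t := by
  have hball : ∀ x ∈ Metric.ball t (δ / 2), ∀ u, δ / 2 ≤ |x - s u| := by
    intro x hx u
    rw [Metric.mem_ball, Real.dist_eq, abs_sub_comm] at hx
    have h1 := ht u
    have h2 := abs_add_le (t - x) (x - s u)
    rw [show t - x + (x - s u) = t - s u by ring] at h2
    linarith
  have hne : ∀ x ∈ Metric.ball t (δ / 2), ∀ u, x - s u ≠ 0 := by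
    intro x hx u h
    have := hball x hx u
    rw [h, abs_zero] at this
    linarith
  have hmem : Metric.ball t (δ / 2) ∈ 𝓝 t := Metric.ball_mem_nhds _ (by positivity)
  have hcont : ∀ x ∈ Metric.ball t (δ / 2), ∀ m : ℕ, Continuous fun u => ((x - s u) ^ m)⁻¹ :=
    fun x hx m => ((continuous_const.sub hs).pow m).inv₀ fun u => pow_ne_zero _ (hne x hx u)
  have htm := mem_of_mem_nhds hmem
  have key := intervalIntegral.hasDerivAt_integral_of_dominated_loc_of_deriv_le
    (F := fun t u => ((t - s u) ^ n)⁻¹) (F' := fun t u => -n * ((t - s u) ^ (n + 1))⁻¹)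
    (bound := fun _ => n * ((δ / 2) ^ (n + 1))⁻¹) (μ := MeasureTheory.volume) (a := 0) (b := 1)
    (x₀ := t) hmem
    (by filter_upwards [hmem] with x hx using (hcont x hx n).aestronglyMeasurable)
    ((hcont t htm n).intervalIntegrable _ _)
    ((continuous_const.mul (hcont t htm (n + 1))).aestronglyMeasurable)
    (by
      refine Eventually.of_forall fun u _ x hx => ?_
      rw [norm_mul, norm_neg, norm_inv, norm_pow, Real.norm_natCast, Real.norm_eq_abs]
      gcongr
      exact hball x hx u)
    intervalIntegrable_const
    (by
      refine Eventually.of_forall fun u _ x hx => ?_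
      have h1 : HasDerivAt (fun x => (x - s u) ^ n) (n * (x - s u) ^ (n - 1) * 1) x :=
        ((hasDerivAt_id x).sub_const (s u)).pow n
      have h0 := hne x hx u
      refine (h1.inv (pow_ne_zero n h0)).congr_deriv ?_
      rcases n with _ | n
      · simp
      · simp only [Nat.add_sub_cancel]
        field_simp
        ring)
  have h2 := key.2
  rwa [intervalIntegral.integral_const_mul] at h2

/-- Chebyshev's and Cauchy's integral inequalities combined, for a weight `w` and two
similarly ordered functions `e`, `g`. -/
theorem sq_integral_mul_integral_le {w e g : ℝ → ℝ} (hw : Continuous w) (he : Continuous e)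
    (hg : Continuous g) (hw0 : ∀ u ∈ Icc (0 : ℝ) 1, 0 ≤ w u) (hg0 : ∀ u ∈ Icc (0 : ℝ) 1, 0 ≤ g u)
    {c : ℝ} (hc : c ∈ Icc (0 : ℝ) 1) (hec : e c * (∫ u in (0 : ℝ)..1, w u) = ∫ u in (0 : ℝ)..1, w u * e u)
    (hec0 : 0 ≤ e c)
    (hmono : ∀ u ∈ Icc (0 : ℝ) 1, 0 ≤ (e u - e c) * (g u - g c)) :
    (∫ u in (0 : ℝ)..1, w u * g u) ^ 2 * (∫ u in (0 : ℝ)..1, w u * e u) ≤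
      (∫ u in (0 : ℝ)..1, w u) ^ 2 * ∫ u in (0 : ℝ)..1, w u * (e u * g u ^ 2) := by
  set W := ∫ u in (0 : ℝ)..1, w u
  set G := ∫ u in (0 : ℝ)..1, w u * g u
  set T := ∫ u in (0 : ℝ)..1, w u * g u ^ 2
  have hW : 0 ≤ W := intervalIntegral.integral_nonneg zero_le_one hw0
  have i1 : IntervalIntegrable w MeasureTheory.volume 0 1 := hw.intervalIntegrable _ _
  have i2 : IntervalIntegrable (fun u => w u * g u) MeasureTheory.volume 0 1 :=
    (hw.mul hg).intervalIntegrable _ _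
  have i3 : IntervalIntegrable (fun u => w u * g u ^ 2) MeasureTheory.volume 0 1 :=
    (hw.mul (hg.pow 2)).intervalIntegrable _ _
  have i4 : IntervalIntegrable (fun u => w u * e u) MeasureTheory.volume 0 1 :=
    (hw.mul he).intervalIntegrable _ _
  have i5 : IntervalIntegrable (fun u => w u * (e u * g u ^ 2)) MeasureTheory.volume 0 1 :=
    (hw.mul (he.mul (hg.pow 2))).intervalIntegrable _ _
  -- Cauchy's inequality, as nonnegativity of the variance of `g` under `w`.
  have h1 : 0 ≤ ∫ u in (0 : ℝ)..1, w u * (W * g u - G) ^ 2 :=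
    intervalIntegral.integral_nonneg zero_le_one fun u hu => mul_nonneg (hw0 u hu) (sq_nonneg _)
  have h1' : ∫ u in (0 : ℝ)..1, w u * (W * g u - G) ^ 2 = W * (W * T - G ^ 2) := by
    have : (fun u => w u * (W * g u - G) ^ 2) =
        fun u => W ^ 2 * (w u * g u ^ 2) - 2 * W * G * (w u * g u) + G ^ 2 * w u := by
      funext u; ring
    rw [this, intervalIntegral.integral_add ((i3.const_mul _).sub (i2.const_mul _)) (i1.const_mul _),
      intervalIntegral.integral_sub (i3.const_mul _) (i2.const_mul _),
      intervalIntegral.integral_const_mul, intervalIntegral.integral_const_mul,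
      intervalIntegral.integral_const_mul]
    ring
  -- Chebyshev's inequality for `e` and `g ^ 2`. As `e c` is the `w`-mean of `e`, centring at `c`
  -- removes the `g c ^ 2` terms and no double integral is needed.
  have h2 : 0 ≤ ∫ u in (0 : ℝ)..1, w u * ((e u - e c) * (g u ^ 2 - g c ^ 2)) := by
    refine intervalIntegral.integral_nonneg zero_le_one fun u hu => mul_nonneg (hw0 u hu) ?_
    have := mul_nonneg (hmono u hu) (add_nonneg (hg0 u hu) (hg0 c hc))
    nlinarith
  have h2' : ∫ u in (0 : ℝ)..1, w u * ((e u - e c) * (g u ^ 2 - g c ^ 2)) =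
      (∫ u in (0 : ℝ)..1, w u * (e u * g u ^ 2)) - e c * T := by
    have : (fun u => w u * ((e u - e c) * (g u ^ 2 - g c ^ 2))) =
        fun u => w u * (e u * g u ^ 2) - e c * (w u * g u ^ 2) -
          (g c ^ 2 * (w u * e u) - g c ^ 2 * e c * w u) := by
      funext u; ring
    rw [this, intervalIntegral.integral_sub (i5.sub (i3.const_mul _))
        ((i4.const_mul _).sub (i1.const_mul _)),
      intervalIntegral.integral_sub i5 (i3.const_mul _),
      intervalIntegral.integral_sub (i4.const_mul _) (i1.const_mul _),
      intervalIntegral.integral_const_mul, intervalIntegral.integral_const_mul,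
      intervalIntegral.integral_const_mul, ← hec]
    ring
  rw [h1'] at h1
  rw [h2'] at h2
  rw [← hec]
  have h3 := mul_nonneg hec0 h1
  have h4 := mul_nonneg (sq_nonneg W) h2
  nlinarith

/-- Pointwise convergence of monotone functions to a continuous one is uniform on compact
subintervals. -/
theorem eventually_forall_abs_sub_le_of_monotoneOn {ι : Type*} {l : Filter ι} {f : ι → ℝ → ℝ}
    {h : ℝ → ℝ} {a b c d : ℝ} (hac : a < c) (hdb : d < b)
    (hf : ∀ᶠ q in l, MonotoneOn (f q) (Ioo a b)) (hh : ContinuousOn h (Ioo a b))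
    (hlim : ∀ τ ∈ Ioo a b, Tendsto (fun q => f q τ) l (𝓝 (h τ))) {ε : ℝ} (hε : 0 < ε) :
    ∀ᶠ q in l, ∀ τ ∈ Icc c d, |f q τ - h τ| ≤ ε := by
  have hsub : Icc c d ⊆ Ioo a b := fun x hx => ⟨hac.trans_le hx.1, hx.2.trans_lt hdb⟩
  -- The claim passes to subsets and finite unions, so by compactness it suffices near one point
  -- `x`. There the values at two nearby points `u < x < v` trap `f q` in between by monotonicity.
  refine (isCompact_Icc (a := c) (b := d)).induction_on
    (p := fun s => ∀ᶠ q in l, ∀ τ ∈ s, |f q τ - h τ| ≤ ε) ?_ ?_ ?_ ?_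
  · exact Eventually.of_forall fun q τ hτ => hτ.elim
  · exact fun s t hst ht => ht.mono fun q hq τ hτ => hq τ (hst hτ)
  · intro s t hs ht
    filter_upwards [hs, ht] with q h1 h2 τ hτ
    exact hτ.elim (h1 τ) (h2 τ)
  · intro x hx
    have hx' := hsub hx
    have hcx : ContinuousAt h x := hh.continuousAt (Ioo_mem_nhds hx'.1 hx'.2)
    obtain ⟨δ, hδ, hδh⟩ := Metric.continuousAt_iff.1 hcx (ε / 4) (by positivity)
    obtain ⟨u, hu1, hu2⟩ := exists_between (max_lt hx'.1 (sub_lt_self x hδ))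
    obtain ⟨v, hv1, hv2⟩ := exists_between (lt_min hx'.2 (lt_add_of_pos_right x hδ))
    rw [max_lt_iff] at hu1
    rw [lt_min_iff] at hv2
    have key : ∀ y ∈ Icc u v, |h y - h x| < ε / 4 := by
      intro y hy
      have := @hδh y (by rw [Real.dist_eq, abs_lt]; constructor <;> linarith [hy.1, hy.2, hu1.2, hv2.2])
      rwa [Real.dist_eq] at this
    have hum : u ∈ Ioo a b := ⟨hu1.1, hu2.trans hx'.2⟩
    have hvm : v ∈ Ioo a b := ⟨hx'.1.trans hv1, hv2.1⟩
    refine ⟨Ioo u v, mem_nhdsWithin_of_mem_nhds (Ioo_mem_nhds hu2 hv1), ?_⟩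
    filter_upwards [hf, Metric.tendsto_nhds.1 (hlim u hum) (ε / 4) (by positivity),
      Metric.tendsto_nhds.1 (hlim v hvm) (ε / 4) (by positivity)] with q hq hqu hqv τ hτ
    have hτm : τ ∈ Ioo a b := ⟨hum.1.trans hτ.1, hτ.2.trans hvm.2⟩
    have m1 := hq hum hτm hτ.1.le
    have m2 := hq hτm hvm hτ.2.le
    rw [Real.dist_eq] at hqu hqv
    have k1 := abs_lt.1 (key u ⟨le_rfl, (hu2.trans hv1).le⟩)
    have k2 := abs_lt.1 (key v ⟨(hu2.trans hv1).le, le_rfl⟩)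
    have k3 := abs_lt.1 (key τ ⟨hτ.1.le, hτ.2.le⟩)
    have k4 := abs_lt.1 hqu
    have k5 := abs_lt.1 hqv
    rw [abs_le]
    constructor <;> linarith

/-- Only one direction has to be checked uniformly. Approximating `K` by points of `C q` is needed
merely pointwise and on a dense part, since compactness of `K` makes it uniform. -/
theorem hausdorffTendsto_of_forall {C : ℝ → Set (ℝ × ℝ)} {l : Filter ℝ} {K D : Set (ℝ × ℝ)}
    (hK : IsCompact K) (hKD : K ⊆ closure D)
    (h1 : ∀ ε : ℝ, 0 < ε → ∀ᶠ q in l, ∀ x ∈ C q, ∃ y ∈ K, dist x y ≤ ε)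
    (h2 : ∀ y ∈ D, ∃ x : ℝ → ℝ × ℝ, (∀ᶠ q in l, x q ∈ C q) ∧ Tendsto x l (𝓝 y)) :
    HausdorffTendsto C l K := by
  have h2' : ∀ ε : ℝ, 0 < ε → ∀ᶠ q in l, ∀ y ∈ K, ∃ x ∈ C q, dist y x ≤ ε := by
    intro ε hε
    refine hK.induction_on (p := fun s => ∀ᶠ q in l, ∀ y ∈ s, ∃ x ∈ C q, dist y x ≤ ε) ?_ ?_ ?_ ?_
    · exact Eventually.of_forall fun q τ hτ => hτ.elim
    · exact fun s t hst ht => ht.mono fun q hq τ hτ => hq τ (hst hτ)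
    · intro s t hs ht
      filter_upwards [hs, ht] with q h1 h2 τ hτ
      exact hτ.elim (h1 τ) (h2 τ)
    · intro z hz
      obtain ⟨y, hy, hyz⟩ := Metric.mem_closure_iff.1 (hKD hz) (ε / 3) (by positivity)
      obtain ⟨x, hxC, hx⟩ := h2 y hy
      refine ⟨Metric.ball z (ε / 3), mem_nhdsWithin_of_mem_nhds (Metric.ball_mem_nhds _ (by positivity)), ?_⟩
      filter_upwards [hxC, Metric.tendsto_nhds.1 hx (ε / 3) (by positivity)] with q hq1 hq2 w hw
      refine ⟨x q, hq1, ?_⟩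
      rw [Metric.mem_ball] at hw
      have t1 := dist_triangle4 w z y (x q)
      rw [dist_comm y (x q)] at t1
      linarith
  unfold HausdorffTendsto
  rw [ENNReal.tendsto_nhds_zero]
  intro ε hε
  obtain ⟨δ, hδ, hδε⟩ : ∃ δ : ℝ, 0 < δ ∧ ENNReal.ofReal δ ≤ ε := by
    rcases eq_or_ne ε ⊤ with rfl | h
    · exact ⟨1, one_pos, le_top⟩
    · exact ⟨ε.toReal, ENNReal.toReal_pos hε.ne' h, ENNReal.ofReal_toReal_le⟩
  filter_upwards [h1 δ hδ, h2' δ hδ] with q k1 k2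
  refine (Metric.hausdorffEDist_le_of_mem_edist ?_ ?_).trans hδε
  · intro x hx
    obtain ⟨y, hy, hxy⟩ := k1 x hx
    exact ⟨y, hy, by rw [edist_dist]; exact ENNReal.ofReal_le_ofReal hxy⟩
  · intro x hx
    obtain ⟨y, hy, hxy⟩ := k2 x hx
    exact ⟨y, hy, by rw [edist_dist]; exact ENNReal.ofReal_le_ofReal hxy⟩

/-- A Lipschitz map multiplies Hausdorff distances by at most its constant; `k ≠ 0` serves to move
`k` inside the infima of extended distances. -/
theorem HausdorffTendsto.image {C : ℝ → Set (ℝ × ℝ)} {l : Filter ℝ} {K : Set (ℝ × ℝ)}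
    (h : HausdorffTendsto C l K) {k : NNReal} (hk : k ≠ 0) {φ : ℝ × ℝ → ℝ × ℝ} (hφ : LipschitzWith k φ) :
    HausdorffTendsto (fun q => φ '' C q) l (φ '' K) := by
  have key : ∀ q, Metric.hausdorffEDist (φ '' C q) (φ '' K) ≤
      (k : ENNReal) * Metric.hausdorffEDist (C q) K := by
    intro q
    have aux : ∀ A B : Set (ℝ × ℝ), ∀ x ∈ A, Metric.infEDist (φ x) (φ '' B) ≤
        (k : ENNReal) * Metric.hausdorffEDist A B := by
      intro A B x hx
      refine le_trans ?_ (mul_le_mul_right (Metric.infEDist_le_hausdorffEDist_of_mem hx) _)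
      rw [Metric.infEDist, Metric.infEDist,
        ENNReal.mul_iInf_of_ne (ENNReal.coe_ne_zero.2 hk) ENNReal.coe_ne_top]
      refine le_iInf fun y => ?_
      rw [ENNReal.mul_iInf_of_ne (ENNReal.coe_ne_zero.2 hk) ENNReal.coe_ne_top]
      exact le_iInf fun hy => (iInf₂_le (φ y) (mem_image_of_mem φ hy)).trans (hφ x y)
    refine Metric.hausdorffEDist_le_of_infEDist ?_ ?_
    · rintro _ ⟨x, hx, rfl⟩
      exact aux _ _ x hx
    · rintro _ ⟨x, hx, rfl⟩
      rw [Metric.hausdorffEDist_comm]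
      exact aux _ _ x hx
  unfold HausdorffTendsto at h ⊢
  have h0 := ENNReal.Tendsto.const_mul (a := (k : ENNReal)) h (Or.inr ENNReal.coe_ne_top)
  rw [mul_zero] at h0
  exact tendsto_of_tendsto_of_tendsto_of_le_of_le tendsto_const_nhds h0 (fun _ => zero_le) key

/-! ### Profiles extended to the whole line -/

/-- A starting profile that is continuous on the whole line, with all values between those at
`0` and `1`. -/
structure IsGlobalProfile (α : ℝ → ℝ) : Prop extends IsStartingProfile α where
  continuous : Continuous α
  mem_Icc : ∀ u, α u ∈ Icc 0 (α 1)

/-- The integrated form of `α' ≥ 1`; continuity bridges the finitely many exceptional points. -/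
theorem IsStartingProfile.monotoneOn_sub {α : ℝ → ℝ} (hα : IsStartingProfile α) :
    MonotoneOn (fun u => α u - u) (Icc 0 1) := by
  obtain ⟨S, hS, hd⟩ := hα.piecewise
  refine monotoneOn_Icc_of_deriv_nonneg_off_finite (f' := fun u => deriv α u - 1) hS
    (hα.continuousOn.sub continuousOn_id) fun u hu => ?_
  obtain ⟨h1, h2⟩ := hd u hu
  exact ⟨h1.hasDerivAt.sub (hasDerivAt_id u), by linarith⟩

/-! ### The weight, its integrals and their signs -/

section

variable {α : ℝ → ℝ} {q t : ℝ}

noncomputable section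

/-- The weight `t / (t - q ^ α u)`. -/
def weight (α : ℝ → ℝ) (q t u : ℝ) : ℝ := t / (t - q ^ α u)

/-- `log q` times the primitive of the weight. -/
def cumWeight (α : ℝ → ℝ) (q t v : ℝ) : ℝ := Real.log q * ∫ u in (0 : ℝ)..v, weight α q t u

/-- `-log x(t)`. -/
def logMoment (α : ℝ → ℝ) (q t : ℝ) : ℝ := cumWeight α q t 1

/-- The logarithmic derivative of `1 / x(t)` along `t d/dt`. -/
def firstVar (α : ℝ → ℝ) (q t : ℝ) : ℝ :=
  Real.log q * ∫ u in (0 : ℝ)..1, weight α q t u * (1 - weight α q t u)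

/-- The quadratic moment entering `t d/dt` of `firstVar`. -/
def secondVar (α : ℝ → ℝ) (q t : ℝ) : ℝ :=
  Real.log q * ∫ u in (0 : ℝ)..1, weight α q t u * (1 - weight α q t u) ^ 2

/-- The common denominator of the parametric equations, divided by `x(t)`. -/
def denom (α : ℝ → ℝ) (q t : ℝ) : ℝ := 1 - Real.exp (-logMoment α q t) - firstVar α q t

/-- The numerator in the equation for `q ^ Y(t)`, divided by `x(t)`. -/
def numer (α : ℝ → ℝ) (q t : ℝ) : ℝ := Real.exp (logMoment α q t) - 1 - firstVar α q t

/-- The logarithm of `|1 - weight|`, corrected by `cumWeight`. -/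
def logRatio (α : ℝ → ℝ) (q t v : ℝ) : ℝ :=
  Real.log (1 - weight α q t v) - cumWeight α q t v

end

/-- The parameter `t` avoids the range of `q ^ α`. -/
def IsOff (α : ℝ → ℝ) (q t : ℝ) : Prop := t < 1 ∨ q ^ α 1 < t

theorem IsGlobalProfile.one_le_rpow (hα : IsGlobalProfile α) (hq : 1 < q) (u : ℝ) : 1 ≤ q ^ α u :=
  Real.one_le_rpow hq.le (hα.mem_Icc u).1

theorem IsGlobalProfile.rpow_le (hα : IsGlobalProfile α) (hq : 1 < q) (u : ℝ) :
    q ^ α u ≤ q ^ α 1 :=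
  Real.rpow_le_rpow_of_exponent_le hq.le (hα.mem_Icc u).2

theorem IsGlobalProfile.continuous_rpow (hα : IsGlobalProfile α) (hq : 1 < q) :
    Continuous fun u => q ^ α u :=
  continuous_const.rpow hα.continuous fun _ => Or.inl (by positivity)

theorem IsOff.exists_le_abs_sub (h : IsOff α q t) (hα : IsGlobalProfile α) (hq : 1 < q) :
    ∃ δ, 0 < δ ∧ ∀ u, δ ≤ |t - q ^ α u| := by
  rcases h with h | h
  · refine ⟨1 - t, by linarith, fun u => ?_⟩
    rw [abs_sub_comm]
    exact le_trans (by linarith [hα.one_le_rpow hq u]) (le_abs_self _)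
  · exact ⟨t - q ^ α 1, by linarith, fun u =>
      le_trans (by linarith [hα.rpow_le hq u]) (le_abs_self _)⟩

theorem IsOff.sub_ne_zero (h : IsOff α q t) (hα : IsGlobalProfile α) (hq : 1 < q) (u : ℝ) :
    t - q ^ α u ≠ 0 := by
  obtain ⟨δ, hδ, hd⟩ := h.exists_le_abs_sub hα hq
  exact abs_pos.1 (hδ.trans_le (hd u))

theorem IsOff.continuous_weight (h : IsOff α q t) (hα : IsGlobalProfile α) (hq : 1 < q) :
    Continuous (weight α q t) :=
  continuous_const.div (continuous_const.sub (hα.continuous_rpow hq)) (h.sub_ne_zero hα hq)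

theorem IsOff.hasDerivAt_cumWeight (h : IsOff α q t) (hα : IsGlobalProfile α) (hq : 1 < q) (v : ℝ) :
    HasDerivAt (cumWeight α q t) (Real.log q * weight α q t v) v :=
  (((h.continuous_weight hα hq).integral_hasStrictDerivAt 0 v).hasDerivAt).const_mul _

theorem IsOff.continuous_cumWeight (h : IsOff α q t) (hα : IsGlobalProfile α) (hq : 1 < q) :
    Continuous (cumWeight α q t) :=
  continuous_iff_continuousAt.2 fun v => (h.hasDerivAt_cumWeight hα hq v).continuousAt

theorem cumWeight_zero : cumWeight α q t 0 = 0 := by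
  simp [cumWeight]

theorem momentGen_eq_exp (hq : 0 < q) : momentGen α q t = Real.exp (-logMoment α q t) := by
  rw [momentGen, logMoment, cumWeight, Real.rpow_def_of_pos hq]
  simp only [weight, div_eq_mul_inv t, one_div, intervalIntegral.integral_const_mul]
  congr 1
  ring

theorem IsOff.one_sub_weight (h : IsOff α q t) (hα : IsGlobalProfile α) (hq : 1 < q) (u : ℝ) :
    1 - weight α q t u = - q ^ α u / (t - q ^ α u) := by
  have := h.sub_ne_zero hα hq u
  rw [weight]
  field_simp
  ring

theorem IsOff.one_sub_weight_ne_zero (h : IsOff α q t) (hα : IsGlobalProfile α) (hq : 1 < q)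
    (u : ℝ) : 1 - weight α q t u ≠ 0 := by
  rw [h.one_sub_weight hα hq]
  exact div_ne_zero (neg_ne_zero.2 (by positivity)) (h.sub_ne_zero hα hq u)

theorem weight_mem_Ioo (hα : IsGlobalProfile α) (hq : 1 < q) (ht : t < 0) (u : ℝ) :
    weight α q t u ∈ Ioo 0 1 := by
  have h1 := hα.one_le_rpow hq u
  constructor
  · exact div_pos_of_neg_of_neg ht (by linarith)
  · rw [weight, div_lt_one_of_neg (by linarith)]
    linarith

theorem weight_neg (hα : IsGlobalProfile α) (hq : 1 < q) (ht : 0 < t) (ht1 : t < 1) (u : ℝ) :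
    weight α q t u < 0 :=
  div_neg_of_pos_of_neg ht (by linarith [hα.one_le_rpow hq u])

theorem one_lt_weight (hα : IsGlobalProfile α) (hq : 1 < q) (ht : q ^ α 1 < t) (u : ℝ) :
    1 < weight α q t u := by
  have h1 := hα.one_le_rpow hq u
  have h2 := hα.rpow_le hq u
  rw [weight, one_lt_div (by linarith)]
  linarith

/-! ### Derivatives in `t` -/

theorem integral_weight_pow (n : ℕ) :
    ∫ u in (0 : ℝ)..1, weight α q t u ^ n = t ^ n * ∫ u in (0 : ℝ)..1, ((t - q ^ α u) ^ n)⁻¹ := by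
  simp only [weight, div_eq_mul_inv, mul_pow, inv_pow, intervalIntegral.integral_const_mul]

theorem logMoment_eq : logMoment α q t =
    Real.log q * (t * ∫ u in (0 : ℝ)..1, ((t - q ^ α u) ^ 1)⁻¹) := by
  have := integral_weight_pow (α := α) (q := q) (t := t) 1
  simp only [pow_one] at this ⊢
  rw [logMoment, cumWeight, this]

theorem IsOff.firstVar_eq (h : IsOff α q t) (hα : IsGlobalProfile α) (hq : 1 < q) :
    firstVar α q t = Real.log q * (t * (∫ u in (0 : ℝ)..1, ((t - q ^ α u) ^ 1)⁻¹) -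
      t ^ 2 * ∫ u in (0 : ℝ)..1, ((t - q ^ α u) ^ 2)⁻¹) := by
  have h1 := integral_weight_pow (α := α) (q := q) (t := t) 1
  have h2 := integral_weight_pow (α := α) (q := q) (t := t) 2
  have hc := h.continuous_weight hα hq
  rw [pow_one] at h1
  rw [firstVar, ← h1, ← h2, ← intervalIntegral.integral_sub]
  · congr 2
    funext u
    ring
  · exact (hc.pow 1).intervalIntegrable _ _
  · exact (hc.pow 2).intervalIntegrable _ _

theorem IsOff.secondVar_eq (h : IsOff α q t) (hα : IsGlobalProfile α) (hq : 1 < q) :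
    secondVar α q t = Real.log q * (t * (∫ u in (0 : ℝ)..1, ((t - q ^ α u) ^ 1)⁻¹) -
      2 * (t ^ 2 * ∫ u in (0 : ℝ)..1, ((t - q ^ α u) ^ 2)⁻¹) +
      t ^ 3 * ∫ u in (0 : ℝ)..1, ((t - q ^ α u) ^ 3)⁻¹) := by
  have h1 := integral_weight_pow (α := α) (q := q) (t := t) 1
  have h2 := integral_weight_pow (α := α) (q := q) (t := t) 2
  have h3 := integral_weight_pow (α := α) (q := q) (t := t) 3
  have hc := h.continuous_weight hα hq
  have i1 : IntervalIntegrable (fun u => weight α q t u) MeasureTheory.volume 0 1 :=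
    hc.intervalIntegrable _ _
  have i2 : IntervalIntegrable (fun u => 2 * weight α q t u ^ 2) MeasureTheory.volume 0 1 :=
    ((hc.pow 2).const_mul 2).intervalIntegrable _ _
  have i3 : IntervalIntegrable (fun u => weight α q t u ^ 3) MeasureTheory.volume 0 1 :=
    (hc.pow 3).intervalIntegrable _ _
  have key : ∫ u in (0 : ℝ)..1, weight α q t u * (1 - weight α q t u) ^ 2 =
      (∫ u in (0 : ℝ)..1, weight α q t u) - 2 * (∫ u in (0 : ℝ)..1, weight α q t u ^ 2) +
        ∫ u in (0 : ℝ)..1, weight α q t u ^ 3 := by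
    rw [← intervalIntegral.integral_const_mul, ← intervalIntegral.integral_sub i1 i2,
      ← intervalIntegral.integral_add (i1.sub i2) i3]
    congr 1
    funext u
    ring
  rw [secondVar, key, ← h2, ← h3]
  simp only [pow_one] at h1 ⊢
  rw [h1]

theorem IsOff.hasDerivAt_logMoment (h : IsOff α q t) (hα : IsGlobalProfile α) (hq : 1 < q) :
    HasDerivAt (logMoment α q) (Real.log q * ((∫ u in (0 : ℝ)..1, ((t - q ^ α u) ^ 1)⁻¹) -
      t * ∫ u in (0 : ℝ)..1, ((t - q ^ α u) ^ 2)⁻¹)) t := by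
  obtain ⟨δ, hδ, hd⟩ := h.exists_le_abs_sub hα hq
  have h1 := hasDerivAt_integral_inv_pow (hα.continuous_rpow hq) hδ hd 1
  have h2 := ((hasDerivAt_id t).mul h1).const_mul (Real.log q)
  have h3 : logMoment α q = fun t => Real.log q *
      (id t * ∫ u in (0 : ℝ)..1, ((t - q ^ α u) ^ 1)⁻¹) := by
    funext t
    rw [logMoment_eq, id]
  rw [h3]
  refine h2.congr_deriv ?_
  simp only [id, Nat.cast_one]
  ring

theorem IsOff.hasDerivAt_logMoment' (h : IsOff α q t) (hα : IsGlobalProfile α) (hq : 1 < q)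
    (ht : t ≠ 0) : HasDerivAt (logMoment α q) (firstVar α q t / t) t := by
  refine (h.hasDerivAt_logMoment hα hq).congr_deriv ?_
  rw [h.firstVar_eq hα hq]
  field_simp

theorem IsOff.eventually (h : IsOff α q t) : ∀ᶠ t' in 𝓝 t, IsOff α q t' := by
  rcases h with h | h
  · filter_upwards [eventually_lt_nhds h] with t' h' using Or.inl h'
  · filter_upwards [eventually_gt_nhds h] with t' h' using Or.inr h'

/-- With p the weight, `t d/dt` sends p to p(1 - p), hence p(1 - p) to p(1 - p)(1 - 2p) = 2p(1 - p)²
- p(1 - p). -/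
theorem IsOff.hasDerivAt_firstVar (h : IsOff α q t) (hα : IsGlobalProfile α) (hq : 1 < q)
    (ht : t ≠ 0) :
    HasDerivAt (firstVar α q) ((2 * secondVar α q t - firstVar α q t) / t) t := by
  obtain ⟨δ, hδ, hd⟩ := h.exists_le_abs_sub hα hq
  have h1 := hasDerivAt_integral_inv_pow (hα.continuous_rpow hq) hδ hd 1
  have h2 := hasDerivAt_integral_inv_pow (hα.continuous_rpow hq) hδ hd 2
  have h3 := (((hasDerivAt_id t).mul h1).sub (((hasDerivAt_id t).pow 2).mul h2)).const_mul
    (Real.log q)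
  have h4 : firstVar α q =ᶠ[𝓝 t] fun t => Real.log q *
      (id t * (∫ u in (0 : ℝ)..1, ((t - q ^ α u) ^ 1)⁻¹) -
      id t ^ 2 * ∫ u in (0 : ℝ)..1, ((t - q ^ α u) ^ 2)⁻¹) := by
    filter_upwards [h.eventually] with t' h' using h'.firstVar_eq hα hq
  refine (h3.congr_of_eventuallyEq h4).congr_deriv ?_
  rw [h.firstVar_eq hα hq, h.secondVar_eq hα hq, eq_div_iff ht]
  simp only [id, Nat.cast_one, Nat.cast_ofNat, Pi.pow_apply]
  ring

theorem IsOff.hasDerivAt_momentGen (h : IsOff α q t) (hα : IsGlobalProfile α) (hq : 1 < q) :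
    DifferentiableAt ℝ (momentGen α q) t ∧
      (t ≠ 0 → t * deriv (momentGen α q) t = -Real.exp (-logMoment α q t) * firstVar α q t) := by
  have h0 : momentGen α q = fun t => Real.exp (-logMoment α q t) := by
    funext t
    exact momentGen_eq_exp (by linarith)
  rw [h0]
  refine ⟨(h.hasDerivAt_logMoment hα hq).neg.exp.differentiableAt, fun ht => ?_⟩
  have := (h.hasDerivAt_logMoment' hα hq ht).neg.exp.deriv
  simp only [Pi.neg_apply] at this
  rw [this]
  field_simp

/-- From t x' = -x J the numerator is -x t J and the denominator x(1 - x - J), so x cancels. -/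
theorem IsOff.arcticExpX_eq (h : IsOff α q t) (hα : IsGlobalProfile α) (hq : 1 < q) (ht : t ≠ 0) :
    arcticExpX α q t = -(t * firstVar α q t) / denom α q t := by
  have h1 := (h.hasDerivAt_momentGen hα hq).2 ht
  rw [arcticExpX, pow_two, mul_assoc, h1, momentGen_eq_exp (by linarith), denom]
  have : Real.exp (-logMoment α q t) ≠ 0 := (Real.exp_pos _).ne'
  rw [show -Real.exp (-logMoment α q t) * firstVar α q t + Real.exp (-logMoment α q t) *
    (1 - Real.exp (-logMoment α q t)) = Real.exp (-logMoment α q t) *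
      (1 - Real.exp (-logMoment α q t) - firstVar α q t) by ring,
    show t * (-Real.exp (-logMoment α q t) * firstVar α q t) =
      Real.exp (-logMoment α q t) * -(t * firstVar α q t) by ring, mul_div_mul_left _ _ this]

theorem IsOff.arcticExpY_eq (h : IsOff α q t) (hα : IsGlobalProfile α) (hq : 1 < q) (ht : t ≠ 0) :
    arcticExpY α q t = numer α q t / denom α q t := by
  have h1 := (h.hasDerivAt_momentGen hα hq).2 ht
  rw [arcticExpY, h1, momentGen_eq_exp (by linarith), denom, numer]
  have : Real.exp (-logMoment α q t) ≠ 0 := (Real.exp_pos _).ne'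
  have h2 : Real.exp (-logMoment α q t) * Real.exp (logMoment α q t) = 1 := by
    rw [← Real.exp_add]; simp
  rw [show -Real.exp (-logMoment α q t) * firstVar α q t + Real.exp (-logMoment α q t) *
    (1 - Real.exp (-logMoment α q t)) = Real.exp (-logMoment α q t) *
      (1 - Real.exp (-logMoment α q t) - firstVar α q t) by ring,
    show -Real.exp (-logMoment α q t) * firstVar α q t + 1 - Real.exp (-logMoment α q t) =
      Real.exp (-logMoment α q t) * (Real.exp (logMoment α q t) - 1 - firstVar α q t) by
        linear_combination -h2, mul_div_mul_left _ _ this]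

/-! ### Monotonicity of `logRatio` and the Chebyshev-Cauchy inequality -/

theorem IsOff.continuous_logRatio (h : IsOff α q t) (hα : IsGlobalProfile α) (hq : 1 < q) :
    Continuous (logRatio α q t) :=
  ((continuous_const.sub (h.continuous_weight hα hq)).log
    (h.one_sub_weight_ne_zero hα hq)).sub (h.continuous_cumWeight hα hq)

/-- The derivative of `logRatio` is log q · p · (α' - 1): the logarithm contributes log q · p · α',
and `cumWeight` contributes log q · p. Comparing log q · p with a constant `c` therefore compares
`logRatio` with `c` times α - id. The factor `κ` selects the direction; `c = 0` gives plain
monotonicity, `c ≠ 0` a quantitative gain. -/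
theorem IsOff.monotoneOn_logRatio (h : IsOff α q t) (hα : IsGlobalProfile α) (hq : 1 < q)
    {κ c v w : ℝ} (hv : 0 ≤ v) (hw : w ≤ 1)
    (hc : ∀ u ∈ Ioo v w, 0 ≤ κ * (Real.log q * weight α q t u - c)) :
    MonotoneOn (fun u => κ * (logRatio α q t u - c * (α u - u))) (Icc v w) := by
  obtain ⟨S, hS, hd⟩ := hα.piecewise
  refine monotoneOn_Icc_of_deriv_nonneg_off_finite
    (f' := fun u => κ * (Real.log q * weight α q t u - c) * (deriv α u - 1)) hS
    (continuous_const.mul ((h.continuous_logRatio hα hq).sub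
      (continuous_const.mul (hα.continuous.sub continuous_id)))).continuousOn fun u hu => ?_
  obtain ⟨h1, h2⟩ := hd u ⟨⟨hv.trans_lt hu.1.1, hu.1.2.trans_le hw⟩, hu.2⟩
  refine ⟨?_, mul_nonneg (hc u hu.1) (by linarith)⟩
  have hs : HasDerivAt (fun u => q ^ α u) (Real.log q * deriv α u * q ^ α u) u :=
    h1.hasDerivAt.const_rpow (by linarith)
  have h0 := h.sub_ne_zero hα hq u
  have hp : HasDerivAt (weight α q t) (t * (Real.log q * deriv α u * q ^ α u) / (t - q ^ α u) ^ 2) u := by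
    refine ((hasDerivAt_const u t).div (hs.const_sub t) h0).congr_deriv ?_
    ring
  have hl := ((hp.const_sub 1).log (h.one_sub_weight_ne_zero hα hq u)).sub
    (h.hasDerivAt_cumWeight hα hq u)
  refine ((hl.sub ((h1.hasDerivAt.sub (hasDerivAt_id u)).const_mul c)).const_mul κ).congr_deriv ?_
  have hspos : q ^ α u ≠ 0 := by positivity
  have : -(t * (Real.log q * deriv α u * q ^ α u) / (t - q ^ α u) ^ 2) / (1 - weight α q t u) =
      Real.log q * weight α q t u * deriv α u := by
    rw [h.one_sub_weight hα hq, weight]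
    field_simp
  rw [this]
  ring

/-- The sign data of `weight` and `1 - weight`. -/
structure WeightSigns (α : ℝ → ℝ) (q t κ ς : ℝ) : Prop where
  eq_left : κ = 1 ∨ κ = -1
  eq_right : ς = 1 ∨ ς = -1
  pos_left : ∀ u, 0 < κ * weight α q t u
  pos_right : ∀ u, 0 < ς * (1 - weight α q t u)

theorem WeightSigns.sq_left {κ ς : ℝ} (hs : WeightSigns α q t κ ς) : κ ^ 2 = 1 := by
  rcases hs.eq_left with h | h <;> simp [h]

theorem WeightSigns.sq_right {κ ς : ℝ} (hs : WeightSigns α q t κ ς) : ς ^ 2 = 1 := by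
  rcases hs.eq_right with h | h <;> simp [h]

theorem weightSigns_of_neg (hα : IsGlobalProfile α) (hq : 1 < q) (ht : t < 0) :
    WeightSigns α q t 1 1 := by
  refine ⟨by simp, by simp, fun u => ?_, fun u => ?_⟩ <;>
  linarith [(weight_mem_Ioo hα hq ht u).1, (weight_mem_Ioo hα hq ht u).2]

theorem weightSigns_of_pos (hα : IsGlobalProfile α) (hq : 1 < q) (ht : 0 < t) (ht1 : t < 1) :
    WeightSigns α q t (-1) 1 := by
  refine ⟨by simp, by simp, fun u => ?_, fun u => ?_⟩ <;>
  linarith [weight_neg hα hq ht ht1 u]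

theorem weightSigns_of_gt (hα : IsGlobalProfile α) (hq : 1 < q) (ht : q ^ α 1 < t) :
    WeightSigns α q t 1 (-1) := by
  refine ⟨by simp, by simp, fun u => ?_, fun u => ?_⟩ <;>
  linarith [one_lt_weight hα hq ht u]

theorem WeightSigns.exp_logRatio {κ ς : ℝ} (hs : WeightSigns α q t κ ς) (v : ℝ) :
    Real.exp (logRatio α q t v) =
      ς * (1 - weight α q t v) * Real.exp (-cumWeight α q t v) := by
  have h1 : Real.log (1 - weight α q t v) = Real.log (ς * (1 - weight α q t v)) := by
    rcases hs.eq_right with h | h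
    · rw [h, one_mul]
    · rw [h, neg_one_mul, Real.log_neg_eq_log]
  rw [logRatio, sub_eq_add_neg, Real.exp_add, h1, Real.exp_log (hs.pos_right v)]

theorem WeightSigns.strictMono_cumWeight {κ ς : ℝ} (hs : WeightSigns α q t κ ς) (h : IsOff α q t)
    (hα : IsGlobalProfile α) (hq : 1 < q) : StrictMono (fun v => κ * cumWeight α q t v) := by
  refine strictMono_of_hasDerivAt_pos (fun v => (h.hasDerivAt_cumWeight hα hq v).const_mul κ) ?_
  intro v
  have := mul_pos (Real.log_pos hq) (hs.pos_left v)
  linarith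

theorem WeightSigns.monotoneOn_logRatio {κ ς : ℝ} (hs : WeightSigns α q t κ ς) (h : IsOff α q t)
    (hα : IsGlobalProfile α) (hq : 1 < q) :
    MonotoneOn (fun v => κ * logRatio α q t v) (Icc 0 1) := by
  have := h.monotoneOn_logRatio hα hq (κ := κ) (c := 0) le_rfl le_rfl fun u _ => by
    have := mul_pos (Real.log_pos hq) (hs.pos_left u)
    linarith
  simpa using this

/-- The integrand is the exact derivative of exp of `cumWeight`, which is why p e^Z is the natural
weight for all later comparisons. -/
theorem IsOff.integral_weight_mul_exp (h : IsOff α q t) (hα : IsGlobalProfile α) (hq : 1 < q) :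
    ∫ u in (0 : ℝ)..1, Real.log q * weight α q t u * Real.exp (cumWeight α q t u) =
      Real.exp (logMoment α q t) - 1 := by
  have hc := h.continuous_weight hα hq
  have hz := h.continuous_cumWeight hα hq
  rw [intervalIntegral.integral_eq_sub_of_hasDerivAt (f := fun u => Real.exp (cumWeight α q t u))]
  · rw [cumWeight_zero, Real.exp_zero, logMoment]
  · intro u _
    exact (h.hasDerivAt_cumWeight hα hq u).exp.congr_deriv (by ring)
  · exact Continuous.intervalIntegrable (by fun_prop) _ _

theorem IsOff.integral_weight_mul_exp_sq (h : IsOff α q t) (hα : IsGlobalProfile α) (hq : 1 < q) :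
    ∫ u in (0 : ℝ)..1, Real.log q * weight α q t u * Real.exp (cumWeight α q t u) ^ 2 =
      (Real.exp (logMoment α q t) ^ 2 - 1) / 2 := by
  have hc := h.continuous_weight hα hq
  have hz := h.continuous_cumWeight hα hq
  rw [intervalIntegral.integral_eq_sub_of_hasDerivAt
    (f := fun u => Real.exp (cumWeight α q t u) ^ 2 / 2)]
  · rw [cumWeight_zero, Real.exp_zero, logMoment]
    ring
  · intro u _
    refine (((h.hasDerivAt_cumWeight hα hq u).exp.pow 2).div_const 2).congr_deriv ?_
    push_cast
    ring
  · exact Continuous.intervalIntegrable (by fun_prop) _ _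

/-- The inequality behind the monotonicity of both coordinates of the arctic curve. -/
theorem WeightSigns.firstVar_sq_mul_le {κ ς : ℝ} (hs : WeightSigns α q t κ ς) (h : IsOff α q t)
    (hα : IsGlobalProfile α) (hq : 1 < q) :
    firstVar α q t ^ 2 * (1 + Real.exp (-logMoment α q t)) ≤
      2 * secondVar α q t * (1 - Real.exp (-logMoment α q t)) := by
  have hL := Real.log_pos hq
  have hc := h.continuous_weight hα hq
  have hz := h.continuous_cumWeight hα hq
  have hκ := hs.eq_left
  set L := Real.log q with hLdef
  set y := Real.exp (logMoment α q t) with hy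
  have hypos : 0 < y := Real.exp_pos _
  -- With these choices `w`, `w * e`, `w * g` and `w * e * g ^ 2` integrate, up to signs, to y - 1,
  -- (y² - 1)/2, J and `secondVar`; moreover `w` is positive and `g` is exp of `logRatio`.
  set w := fun u => κ * (L * weight α q t u * Real.exp (cumWeight α q t u)) with hw
  set e := fun u => Real.exp (cumWeight α q t u) with he
  set g := fun u => ς * (1 - weight α q t u) * Real.exp (-cumWeight α q t u) with hg
  have hexp : ∀ u, Real.exp (cumWeight α q t u) * Real.exp (-cumWeight α q t u) = 1 := by
    intro u
    rw [← Real.exp_add]; simp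
  have I1 : ∫ u in (0 : ℝ)..1, w u = κ * (y - 1) := by
    rw [hw, intervalIntegral.integral_const_mul, h.integral_weight_mul_exp hα hq]
  have I2 : ∫ u in (0 : ℝ)..1, w u * e u = κ * ((y ^ 2 - 1) / 2) := by
    rw [hy, ← h.integral_weight_mul_exp_sq hα hq, ← intervalIntegral.integral_const_mul]
    congr 1
    funext u
    simp only [hw, he]
    ring
  have I3 : ∫ u in (0 : ℝ)..1, w u * g u = κ * ς * firstVar α q t := by
    rw [firstVar, ← intervalIntegral.integral_const_mul, ← intervalIntegral.integral_const_mul]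
    congr 1
    funext u
    simp only [hw, hg]
    linear_combination (κ * L * weight α q t u * ς * (1 - weight α q t u)) * hexp u
  have I4 : ∫ u in (0 : ℝ)..1, w u * (e u * g u ^ 2) = κ * secondVar α q t := by
    rw [secondVar, ← intervalIntegral.integral_const_mul, ← intervalIntegral.integral_const_mul]
    congr 1
    funext u
    simp only [hw, hg, he]
    have h1 : (Real.exp (cumWeight α q t u) * Real.exp (-cumWeight α q t u)) ^ 2 * ς ^ 2 = 1 := by
      rw [hexp, hs.sq_right]; norm_num
    linear_combination (κ * L * weight α q t u * (1 - weight α q t u) ^ 2) * h1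
  have hκy : 0 < κ * (y - 1) := by
    have h1 := hs.strictMono_cumWeight h hα hq (zero_lt_one)
    simp only [cumWeight_zero, mul_zero] at h1
    change 0 < κ * logMoment α q t at h1
    rcases hκ with h2 | h2 <;> rw [h2] at h1 ⊢
    · have : 1 < y := Real.one_lt_exp_iff.2 (by linarith)
      linarith
    · have : y < 1 := by
        rw [hy, ← Real.exp_zero]
        exact Real.exp_lt_exp.2 (by linarith)
      linarith
  -- The `w`-mean of `e` is (y² - 1)/2 divided by y - 1. It is the midpoint of the end values 1 and
  -- y of `e`, hence attained.
  obtain ⟨c, hc1, hec⟩ : ∃ c ∈ Icc (0 : ℝ) 1, e c = (y + 1) / 2 := by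
    have h1 := intermediate_value_uIcc (f := e) (a := 0) (b := 1) (by
      exact (Real.continuous_exp.comp hz).continuousOn)
    have h2 : (y + 1) / 2 ∈ uIcc (e 0) (e 1) := by
      have e0 : e 0 = 1 := by simp [he, cumWeight_zero]
      have e1 : e 1 = y := rfl
      rw [e0, e1, mem_uIcc]
      rcases le_total 1 y with h | h
      · left; constructor <;> linarith
      · right; constructor <;> linarith
    obtain ⟨c, hc, hec⟩ := h1 h2
    rw [uIcc_of_le zero_le_one] at hc
    exact ⟨c, hc, hec⟩
  have hgexp : ∀ u, g u = Real.exp (logRatio α q t u) := fun u => (hs.exp_logRatio u).symm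
  have hZm := (hs.strictMono_cumWeight h hα hq).monotone
  have hRm := hs.monotoneOn_logRatio h hα hq
  -- `cumWeight` and `logRatio` both increase if `κ = 1` and both decrease if `κ = -1`, so `e` and
  -- `g` are similarly ordered in either case.
  have hmono : ∀ u ∈ Icc (0 : ℝ) 1, 0 ≤ (e u - e c) * (g u - g c) := by
    intro u hu
    simp only [hgexp, he]
    rcases le_total u c with huc | huc
    · have m1 := hZm huc
      have m2 := hRm hu hc1 huc
      simp only at m1 m2
      rcases hκ with h2 | h2 <;> rw [h2] at m1 m2
      · exact mul_nonneg_of_nonpos_of_nonpos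
          (sub_nonpos.2 (Real.exp_le_exp.2 (by linarith))) (sub_nonpos.2 (Real.exp_le_exp.2 (by linarith)))
      · exact mul_nonneg
          (sub_nonneg.2 (Real.exp_le_exp.2 (by linarith))) (sub_nonneg.2 (Real.exp_le_exp.2 (by linarith)))
    · have m1 := hZm huc
      have m2 := hRm hc1 hu huc
      simp only at m1 m2
      rcases hκ with h2 | h2 <;> rw [h2] at m1 m2
      · exact mul_nonneg
          (sub_nonneg.2 (Real.exp_le_exp.2 (by linarith))) (sub_nonneg.2 (Real.exp_le_exp.2 (by linarith)))
      · exact mul_nonneg_of_nonpos_of_nonpos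
          (sub_nonpos.2 (Real.exp_le_exp.2 (by linarith))) (sub_nonpos.2 (Real.exp_le_exp.2 (by linarith)))
  have key := sq_integral_mul_integral_le (w := w) (e := e) (g := g) (by fun_prop) (by fun_prop)
    (by fun_prop)
    (fun u _ => by
      have := mul_pos (mul_pos hL (hs.pos_left u)) (Real.exp_pos (cumWeight α q t u))
      simp only [hw]
      linarith)
    (fun u _ => by rw [hgexp]; exact (Real.exp_pos _).le) hc1
    (by rw [I1, I2, hec]; ring) (Real.exp_pos _).le hmono
  rw [I1, I2, I3, I4] at key
  have k1 : κ * (y - 1) * (firstVar α q t ^ 2 * (y + 1) / 2) ≤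
      κ * (y - 1) * ((y - 1) * secondVar α q t) := by
    have e1 : (κ * ς * firstVar α q t) ^ 2 * (κ * ((y ^ 2 - 1) / 2)) =
        κ * (y - 1) * (firstVar α q t ^ 2 * (y + 1) / 2) := by
      linear_combination (ς ^ 2 * firstVar α q t ^ 2 * (κ * ((y ^ 2 - 1) / 2))) * hs.sq_left +
        (firstVar α q t ^ 2 * (κ * ((y ^ 2 - 1) / 2))) * hs.sq_right
    have e2 : (κ * (y - 1)) ^ 2 * (κ * secondVar α q t) =
        κ * (y - 1) * ((y - 1) * secondVar α q t) := by
      linear_combination ((y - 1) ^ 2 * κ * secondVar α q t) * hs.sq_left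
    rwa [e1, e2] at key
  have k2 := le_of_mul_le_mul_left k1 hκy
  have hx : Real.exp (-logMoment α q t) = y⁻¹ := by rw [hy, Real.exp_neg]
  rw [hx]
  have e3 : firstVar α q t ^ 2 * (1 + y⁻¹) = 2 * y⁻¹ * (firstVar α q t ^ 2 * (y + 1) / 2) := by
    field_simp
  have e4 : 2 * secondVar α q t * (1 - y⁻¹) = 2 * y⁻¹ * ((y - 1) * secondVar α q t) := by
    field_simp
  rw [e3, e4]
  exact mul_le_mul_of_nonneg_left k2 (by positivity)

/-! ### Positivity -/

/-- Writing 1 - x and J as integrals against the same weight reduces the sign of `denom` to a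
pointwise comparison of integrands. -/
theorem IsOff.denom_eq (h : IsOff α q t) (hα : IsGlobalProfile α) (hq : 1 < q) :
    denom α q t = ∫ u in (0 : ℝ)..1, Real.log q * weight α q t u *
      (Real.exp (cumWeight α q t u - logMoment α q t) - (1 - weight α q t u)) := by
  have hc := h.continuous_weight hα hq
  have hz := h.continuous_cumWeight hα hq
  have h1 : 1 - Real.exp (-logMoment α q t) = Real.exp (-logMoment α q t) *
      (Real.exp (logMoment α q t) - 1) := by
    rw [mul_sub, ← Real.exp_add]; simp
  rw [denom, h1, ← h.integral_weight_mul_exp hα hq, firstVar, ← intervalIntegral.integral_const_mul,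
    ← intervalIntegral.integral_const_mul, ← intervalIntegral.integral_sub]
  · congr 1
    funext u
    rw [sub_eq_add_neg (cumWeight α q t u), Real.exp_add]
    ring
  · exact Continuous.intervalIntegrable (by fun_prop) _ _
  · exact Continuous.intervalIntegrable (by fun_prop) _ _

theorem IsOff.numer_eq (h : IsOff α q t) (hα : IsGlobalProfile α) (hq : 1 < q) :
    numer α q t = ∫ u in (0 : ℝ)..1, Real.log q * weight α q t u *
      (Real.exp (cumWeight α q t u) - (1 - weight α q t u)) := by
  have hc := h.continuous_weight hα hq
  have hz := h.continuous_cumWeight hα hq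
  rw [numer, ← h.integral_weight_mul_exp hα hq, firstVar, ← intervalIntegral.integral_const_mul,
    ← intervalIntegral.integral_sub]
  · congr 1
    funext u
    ring
  · exact Continuous.intervalIntegrable (by fun_prop) _ _
  · exact Continuous.intervalIntegrable (by fun_prop) _ _

/-- `logRatio` increases from `u` to 1, and at 1 it lies below -P because 0 < 1 - p(1) < 1. -/
theorem one_sub_weight_lt_exp (hα : IsGlobalProfile α) (hq : 1 < q) (ht : t < 0) {u : ℝ}
    (hu : u ∈ Icc (0 : ℝ) 1) :
    1 - weight α q t u < Real.exp (cumWeight α q t u - logMoment α q t) := by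
  have hw := weight_mem_Ioo hα hq ht
  have h := (weightSigns_of_neg hα hq ht).monotoneOn_logRatio (Or.inl (by linarith)) hα hq hu
    (right_mem_Icc.2 zero_le_one) hu.2
  simp only [logRatio, one_mul] at h
  have h1 : Real.log (1 - weight α q t 1) < 0 :=
    Real.log_neg (by linarith [(hw 1).2]) (by linarith [(hw 1).1])
  rw [← Real.log_lt_iff_lt_exp (by linarith [(hw u).2]), logMoment]
  linarith

/-- The mirror image for 0 < t < 1: the weight is negative, `logRatio` decreases, and now 1 - p(1) >
1. -/
theorem exp_lt_one_sub_weight (hα : IsGlobalProfile α) (hq : 1 < q) (ht : 0 < t) (ht1 : t < 1)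
    {u : ℝ} (hu : u ∈ Icc (0 : ℝ) 1) :
    Real.exp (cumWeight α q t u - logMoment α q t) < 1 - weight α q t u := by
  have hw := weight_neg hα hq ht ht1
  have h := (weightSigns_of_pos hα hq ht ht1).monotoneOn_logRatio (Or.inl ht1) hα hq hu
    (right_mem_Icc.2 zero_le_one) hu.2
  simp only [logRatio] at h
  have h1 : 0 < Real.log (1 - weight α q t 1) := Real.log_pos (by linarith [hw 1])
  rw [← Real.lt_log_iff_exp_lt (by linarith [hw u]), logMoment]
  linarith

theorem IsOff.denom_pos (h : IsOff α q t) (hα : IsGlobalProfile α) (hq : 1 < q) (ht : t ≠ 0) :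
    0 < denom α q t := by
  have hc := h.continuous_weight hα hq
  have hz := h.continuous_cumWeight hα hq
  have hL := Real.log_pos hq
  rw [h.denom_eq hα hq]
  refine intervalIntegral.intervalIntegral_pos_of_pos_on
    (Continuous.intervalIntegrable (by fun_prop) _ _) (fun u hu => ?_) zero_lt_one
  have hu' := Ioo_subset_Icc_self hu
  rcases h with h | h
  · rcases lt_or_gt_of_ne ht with ht | ht
    · exact mul_pos (mul_pos hL (weight_mem_Ioo hα hq ht u).1)
        (sub_pos.2 (one_sub_weight_lt_exp hα hq ht hu'))
    · exact mul_pos_of_neg_of_neg (mul_neg_of_pos_of_neg hL (weight_neg hα hq ht h u))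
        (sub_neg.2 (exp_lt_one_sub_weight hα hq ht h hu'))
  · have := one_lt_weight hα hq h u
    exact mul_pos (mul_pos hL (by linarith)) (by linarith [Real.exp_pos (cumWeight α q t u - logMoment α q t)])

/-- The difference is y + 1/y - 2 with y = e^P. -/
theorem denom_le_numer (α : ℝ → ℝ) (q t : ℝ) : denom α q t ≤ numer α q t := by
  have h2 : Real.exp (-logMoment α q t) * Real.exp (logMoment α q t) = 1 := by
    rw [← Real.exp_add]; simp
  rw [denom, numer]
  nlinarith [Real.exp_pos (-logMoment α q t), sq_nonneg (Real.exp (logMoment α q t) - 1)]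

theorem IsOff.numer_pos (h : IsOff α q t) (hα : IsGlobalProfile α) (hq : 1 < q) (ht : t ≠ 0) :
    0 < numer α q t := (h.denom_pos hα hq ht).trans_le (denom_le_numer α q t)

theorem firstVar_pos (hα : IsGlobalProfile α) (hq : 1 < q) (ht : t < 0) : 0 < firstVar α q t := by
  have hc := IsOff.continuous_weight (t := t) (Or.inl (by linarith)) hα hq
  refine mul_pos (Real.log_pos hq) (intervalIntegral.intervalIntegral_pos_of_pos_on
    (Continuous.intervalIntegrable (by fun_prop) _ _) (fun u _ => ?_) zero_lt_one)
  have := weight_mem_Ioo hα hq ht u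
  exact mul_pos this.1 (by linarith [this.2])

theorem firstVar_neg (h : IsOff α q t) (hα : IsGlobalProfile α) (hq : 1 < q) (ht : 0 < t) :
    firstVar α q t < 0 := by
  have hc := h.continuous_weight hα hq
  have : 0 < ∫ u in (0 : ℝ)..1, -(weight α q t u * (1 - weight α q t u)) := by
    refine intervalIntegral.intervalIntegral_pos_of_pos_on
      (Continuous.intervalIntegrable (by fun_prop) _ _) (fun u _ => ?_) zero_lt_one
    rcases h with h | h
    · have := weight_neg hα hq ht h u
      nlinarith
    · have := one_lt_weight hα hq h u
      nlinarith
  rw [intervalIntegral.integral_neg] at this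
  exact mul_neg_of_pos_of_neg (Real.log_pos hq) (by linarith)

theorem IsOff.mul_firstVar_neg (h : IsOff α q t) (hα : IsGlobalProfile α) (hq : 1 < q)
    (ht : t ≠ 0) : t * firstVar α q t < 0 := by
  rcases lt_or_gt_of_ne ht with ht | ht
  · exact mul_neg_of_neg_of_pos ht (firstVar_pos hα hq ht)
  · exact mul_neg_of_pos_of_neg ht (firstVar_neg h hα hq ht)

theorem IsOff.arcticExpX_pos (h : IsOff α q t) (hα : IsGlobalProfile α) (hq : 1 < q) (ht : t ≠ 0) :
    0 < arcticExpX α q t := by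
  rw [h.arcticExpX_eq hα hq ht]
  exact div_pos (neg_pos.2 (h.mul_firstVar_neg hα hq ht)) (h.denom_pos hα hq ht)

theorem IsOff.arcticExpY_pos (h : IsOff α q t) (hα : IsGlobalProfile α) (hq : 1 < q) (ht : t ≠ 0) :
    0 < arcticExpY α q t := by
  rw [h.arcticExpY_eq hα hq ht]
  exact div_pos (h.numer_pos hα hq ht) (h.denom_pos hα hq ht)

/-! ### Monotonicity in `t` -/

theorem IsOff.firstVar_sq_mul_le (h : IsOff α q t) (hα : IsGlobalProfile α) (hq : 1 < q)
    (ht : t ≠ 0) :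
    firstVar α q t ^ 2 * (1 + Real.exp (-logMoment α q t)) ≤
      2 * secondVar α q t * (1 - Real.exp (-logMoment α q t)) := by
  rcases h with h | h
  · rcases lt_or_gt_of_ne ht with ht | ht
    · exact (weightSigns_of_neg hα hq ht).firstVar_sq_mul_le (Or.inl h) hα hq
    · exact (weightSigns_of_pos hα hq ht h).firstVar_sq_mul_le (Or.inl h) hα hq
  · exact (weightSigns_of_gt hα hq h).firstVar_sq_mul_le (Or.inr h) hα hq

theorem WeightSigns.logMoment_pos {κ ς : ℝ} (hs : WeightSigns α q t κ ς) (h : IsOff α q t)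
    (hα : IsGlobalProfile α) (hq : 1 < q) : 0 < κ * logMoment α q t := by
  have h1 := hs.strictMono_cumWeight h hα hq (zero_lt_one)
  simp only [cumWeight_zero, mul_zero] at h1
  exact h1

theorem IsOff.hasDerivAt_denom (h : IsOff α q t) (hα : IsGlobalProfile α) (hq : 1 < q)
    (ht : t ≠ 0) :
    HasDerivAt (denom α q) ((Real.exp (-logMoment α q t) * firstVar α q t -
      2 * secondVar α q t + firstVar α q t) / t) t := by
  refine (((h.hasDerivAt_logMoment' hα hq ht).neg.exp.const_sub 1).sub
    (h.hasDerivAt_firstVar hα hq ht)).congr_deriv ?_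
  simp only [Pi.neg_apply]
  field_simp
  ring

theorem IsOff.hasDerivAt_numer (h : IsOff α q t) (hα : IsGlobalProfile α) (hq : 1 < q)
    (ht : t ≠ 0) :
    HasDerivAt (numer α q) ((Real.exp (logMoment α q t) * firstVar α q t -
      2 * secondVar α q t + firstVar α q t) / t) t := by
  refine (((h.hasDerivAt_logMoment' hα hq ht).exp.sub_const 1).sub
    (h.hasDerivAt_firstVar hα hq ht)).congr_deriv ?_
  field_simp
  ring

/-- The numerator that appears is exactly the difference of the two sides of
`IsOff.firstVar_sq_mul_le`. The product tJ is negative, which is harmless since `Real.log` sees only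
the absolute value. -/
theorem IsOff.hasDerivAt_log_arcticExpX (h : IsOff α q t) (hα : IsGlobalProfile α) (hq : 1 < q)
    (ht : t ≠ 0) :
    HasDerivAt (fun t => Real.log (t * firstVar α q t) - Real.log (denom α q t))
      ((2 * secondVar α q t * (1 - Real.exp (-logMoment α q t)) -
        firstVar α q t ^ 2 * (1 + Real.exp (-logMoment α q t))) /
        (t * firstVar α q t * denom α q t)) t := by
  have hJ := (h.mul_firstVar_neg hα hq ht).ne
  have hJ' : firstVar α q t ≠ 0 := fun h0 => hJ (by rw [h0, mul_zero])
  have hE := (h.denom_pos hα hq ht).ne'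
  refine ((((hasDerivAt_id t).mul (h.hasDerivAt_firstVar hα hq ht)).log hJ).sub
    ((h.hasDerivAt_denom hα hq ht).log hE)).congr_deriv ?_
  have e : Real.exp (-logMoment α q t) = 1 - firstVar α q t - denom α q t := by
    rw [denom]; ring
  simp only [id, Pi.mul_apply]
  rw [e]
  field_simp
  ring

/-- The same nonnegative numerator occurs, now multiplied by (1 - x)/t. The sign of this factor
decides the direction: negative for t < 0 and for 0 < t < 1, positive for t > q^α(1). -/
theorem IsOff.hasDerivAt_log_arcticExpY (h : IsOff α q t) (hα : IsGlobalProfile α) (hq : 1 < q)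
    (ht : t ≠ 0) :
    HasDerivAt (fun t => Real.log (numer α q t) - Real.log (denom α q t))
      ((1 - Real.exp (-logMoment α q t)) / t *
        ((2 * secondVar α q t * (1 - Real.exp (-logMoment α q t)) -
        firstVar α q t ^ 2 * (1 + Real.exp (-logMoment α q t))) /
        (Real.exp (-logMoment α q t) * numer α q t * denom α q t))) t := by
  have hN := (h.numer_pos hα hq ht).ne'
  have hE := (h.denom_pos hα hq ht).ne'
  refine (((h.hasDerivAt_numer hα hq ht).log hN).sub
    ((h.hasDerivAt_denom hα hq ht).log hE)).congr_deriv ?_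
  have hx : Real.exp (-logMoment α q t) ≠ 0 := (Real.exp_pos _).ne'
  have e : Real.exp (logMoment α q t) = (Real.exp (-logMoment α q t))⁻¹ := by
    rw [Real.exp_neg, inv_inv]
  rw [numer, e] at hN ⊢
  rw [denom] at hE ⊢
  set x := Real.exp (-logMoment α q t)
  set J := firstVar α q t
  have hN' : 1 - x - x * J ≠ 0 := by
    intro h0
    apply hN
    field_simp
    linarith
  have hN2 : x⁻¹ - 1 - J = (1 - x - x * J) / x := by
    field_simp
  rw [hN2]
  field_simp
  ring

theorem arcticExpX_antitoneOn (hα : IsGlobalProfile α) (hq : 1 < q) {D : Set ℝ}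
    (hD : Convex ℝ D) (ho : IsOpen D) (h : ∀ t ∈ D, IsOff α q t ∧ t ≠ 0) :
    AntitoneOn (arcticExpX α q) D := by
  have key : AntitoneOn (fun t => Real.log (t * firstVar α q t) - Real.log (denom α q t)) D := by
    have hd := fun t ht => (h t ht).1.hasDerivAt_log_arcticExpX hα hq (h t ht).2
    refine antitoneOn_of_deriv_nonpos hD
      (fun t ht => (hd t ht).continuousAt.continuousWithinAt) ?_ ?_ <;> rw [ho.interior_eq]
    · exact fun t ht => (hd t ht).differentiableAt.differentiableWithinAt
    · intro t ht
      rw [(hd t ht).deriv]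
      exact div_nonpos_of_nonneg_of_nonpos
        (sub_nonneg.2 ((h t ht).1.firstVar_sq_mul_le hα hq (h t ht).2))
        (mul_nonpos_of_nonpos_of_nonneg ((h t ht).1.mul_firstVar_neg hα hq (h t ht).2).le
          ((h t ht).1.denom_pos hα hq (h t ht).2).le)
  have e : ∀ t ∈ D, Real.log (t * firstVar α q t) - Real.log (denom α q t) =
      Real.log (arcticExpX α q t) := by
    intro t ht
    rw [(h t ht).1.arcticExpX_eq hα hq (h t ht).2, Real.log_div, Real.log_neg_eq_log]
    · exact (neg_pos.2 ((h t ht).1.mul_firstVar_neg hα hq (h t ht).2)).ne'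
    · exact ((h t ht).1.denom_pos hα hq (h t ht).2).ne'
  intro a ha b hb hab
  have := key ha hb hab
  simp only at this
  rw [e a ha, e b hb] at this
  exact (Real.log_le_log_iff ((h b hb).1.arcticExpX_pos hα hq (h b hb).2)
    ((h a ha).1.arcticExpX_pos hα hq (h a ha).2)).1 this

theorem log_arcticExpY_monotoneOn (hα : IsGlobalProfile α) (hq : 1 < q) {D : Set ℝ} {κ : ℝ}
    (hD : Convex ℝ D) (ho : IsOpen D) (h : ∀ t ∈ D, IsOff α q t ∧ t ≠ 0)
    (hκ : ∀ t ∈ D, 0 ≤ κ * ((1 - Real.exp (-logMoment α q t)) / t)) :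
    MonotoneOn (fun t => κ * Real.log (arcticExpY α q t)) D := by
  have hd := fun t ht => ((h t ht).1.hasDerivAt_log_arcticExpY hα hq (h t ht).2).const_mul κ
  have key : MonotoneOn
      (fun t => κ * (Real.log (numer α q t) - Real.log (denom α q t))) D := by
    refine monotoneOn_of_deriv_nonneg hD
      (fun t ht => (hd t ht).continuousAt.continuousWithinAt) ?_ ?_ <;> rw [ho.interior_eq]
    · exact fun t ht => (hd t ht).differentiableAt.differentiableWithinAt
    · intro t ht
      rw [(hd t ht).deriv, ← mul_assoc]
      exact mul_nonneg (hκ t ht) (div_nonneg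
        (sub_nonneg.2 ((h t ht).1.firstVar_sq_mul_le hα hq (h t ht).2))
        (mul_nonneg (mul_nonneg (Real.exp_pos _).le ((h t ht).1.numer_pos hα hq (h t ht).2).le)
          ((h t ht).1.denom_pos hα hq (h t ht).2).le))
  refine key.congr fun t ht => ?_
  simp only
  rw [(h t ht).1.arcticExpY_eq hα hq (h t ht).2, Real.log_div]
  · exact ((h t ht).1.numer_pos hα hq (h t ht).2).ne'
  · exact ((h t ht).1.denom_pos hα hq (h t ht).2).ne'

theorem arcticExpX_antitoneOn_Iio (hα : IsGlobalProfile α) (hq : 1 < q) :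
    AntitoneOn (arcticExpX α q) (Iio 0) :=
  arcticExpX_antitoneOn hα hq (convex_Iio 0) isOpen_Iio fun _ ht =>
    ⟨Or.inl ((mem_Iio.1 ht).trans one_pos), (mem_Iio.1 ht).ne⟩

theorem arcticExpX_antitoneOn_Ioo (hα : IsGlobalProfile α) (hq : 1 < q) :
    AntitoneOn (arcticExpX α q) (Ioo 0 1) :=
  arcticExpX_antitoneOn hα hq (convex_Ioo 0 1) isOpen_Ioo fun _ ht => ⟨Or.inl ht.2, ht.1.ne'⟩

theorem arcticExpX_antitoneOn_Ioi (hα : IsGlobalProfile α) (hq : 1 < q) :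
    AntitoneOn (arcticExpX α q) (Ioi (q ^ α 1)) :=
  arcticExpX_antitoneOn hα hq (convex_Ioi _) isOpen_Ioi fun _ ht =>
    ⟨Or.inr ht, ((by positivity : 0 < q ^ α 1).trans ht).ne'⟩

theorem arcticExpY_antitoneOn_Iio (hα : IsGlobalProfile α) (hq : 1 < q) :
    AntitoneOn (arcticExpY α q) (Iio 0) := by
  have h : ∀ t ∈ Iio (0 : ℝ), IsOff α q t ∧ t ≠ 0 := fun t ht =>
    ⟨Or.inl ((mem_Iio.1 ht).trans one_pos), (mem_Iio.1 ht).ne⟩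
  have := log_arcticExpY_monotoneOn hα hq (κ := -1) (convex_Iio 0) isOpen_Iio h fun t ht => by
    have h1 := (weightSigns_of_neg hα hq ht).logMoment_pos (h t ht).1 hα hq
    have h2 : Real.exp (-logMoment α q t) ≤ 1 := Real.exp_le_one_iff.2 (by linarith)
    have h3 := div_nonpos_of_nonneg_of_nonpos (sub_nonneg.2 h2) (le_of_lt (mem_Iio.1 ht))
    linarith
  intro a ha b hb hab
  have := this ha hb hab
  simp only at this
  exact (Real.log_le_log_iff ((h b hb).1.arcticExpY_pos hα hq (h b hb).2)
    ((h a ha).1.arcticExpY_pos hα hq (h a ha).2)).1 (by linarith)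

theorem arcticExpY_antitoneOn_Ioo (hα : IsGlobalProfile α) (hq : 1 < q) :
    AntitoneOn (arcticExpY α q) (Ioo 0 1) := by
  have h : ∀ t ∈ Ioo (0 : ℝ) 1, IsOff α q t ∧ t ≠ 0 := fun _ ht => ⟨Or.inl ht.2, ht.1.ne'⟩
  have := log_arcticExpY_monotoneOn hα hq (κ := -1) (convex_Ioo 0 1) isOpen_Ioo h fun t ht => by
    have h1 := (weightSigns_of_pos hα hq ht.1 ht.2).logMoment_pos (h t ht).1 hα hq
    have h2 : 1 ≤ Real.exp (-logMoment α q t) := Real.one_le_exp_iff.2 (by linarith)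
    have h3 := div_nonpos_of_nonpos_of_nonneg (sub_nonpos.2 h2) ht.1.le
    linarith
  intro a ha b hb hab
  have := this ha hb hab
  simp only at this
  exact (Real.log_le_log_iff ((h b hb).1.arcticExpY_pos hα hq (h b hb).2)
    ((h a ha).1.arcticExpY_pos hα hq (h a ha).2)).1 (by linarith)

theorem arcticExpY_monotoneOn_Ioi (hα : IsGlobalProfile α) (hq : 1 < q) :
    MonotoneOn (arcticExpY α q) (Ioi (q ^ α 1)) := by
  have hQ : 0 < q ^ α 1 := by positivity
  have h : ∀ t ∈ Ioi (q ^ α 1), IsOff α q t ∧ t ≠ 0 := fun t ht =>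
    ⟨Or.inr ht, (hQ.trans ht).ne'⟩
  have := log_arcticExpY_monotoneOn hα hq (κ := 1) (convex_Ioi _) isOpen_Ioi h fun t ht => by
    have h1 := (weightSigns_of_gt hα hq ht).logMoment_pos (h t ht).1 hα hq
    have h2 : Real.exp (-logMoment α q t) ≤ 1 := Real.exp_le_one_iff.2 (by linarith)
    have h3 := div_nonneg (sub_nonneg.2 h2) (hQ.trans ht).le
    linarith
  intro a ha b hb hab
  have := this ha hb hab
  simp only at this
  exact (Real.log_le_log_iff ((h a ha).1.arcticExpY_pos hα hq (h a ha).2)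
    ((h b hb).1.arcticExpY_pos hα hq (h b hb).2)).1 (by linarith)

/-! ### Bounds valid for all `t` -/

theorem IsOff.one_le_arcticExpY (h : IsOff α q t) (hα : IsGlobalProfile α) (hq : 1 < q)
    (ht : t ≠ 0) : 1 ≤ arcticExpY α q t := by
  rw [h.arcticExpY_eq hα hq ht, one_le_div (h.denom_pos hα hq ht)]
  exact denom_le_numer α q t

/-- The claim amounts to 1 - x ≤ (1 - t)J. Here 1 - e^(-P) ≤ P, and P ≤ (1 - t)J holds integrand by
integrand because q^α ≥ 1. -/
theorem one_le_arcticExpX (hα : IsGlobalProfile α) (hq : 1 < q) (ht : t ≠ 0) (ht1 : t < 1) :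
    1 ≤ arcticExpX α q t := by
  have h : IsOff α q t := Or.inl ht1
  have hc := h.continuous_weight hα hq
  have h1 : logMoment α q t ≤ (1 - t) * firstVar α q t := by
    have : (1 - t) * firstVar α q t = Real.log q *
        ∫ u in (0 : ℝ)..1, (1 - t) * (weight α q t u * (1 - weight α q t u)) := by
      rw [intervalIntegral.integral_const_mul, firstVar]
      ring
    rw [this, logMoment, cumWeight]
    refine mul_le_mul_of_nonneg_left ?_ (Real.log_pos hq).le
    refine intervalIntegral.integral_mono_on zero_le_one (hc.intervalIntegrable _ _)
      (Continuous.intervalIntegrable (by fun_prop) _ _) fun u _ => ?_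
    have hs := hα.one_le_rpow hq u
    have hne := h.sub_ne_zero hα hq u
    have e : (1 - t) * (weight α q t u * (1 - weight α q t u)) - weight α q t u =
        t ^ 2 * (q ^ α u - 1) / (t - q ^ α u) ^ 2 := by
      rw [h.one_sub_weight hα hq, weight]
      field_simp
      ring
    have : 0 ≤ t ^ 2 * (q ^ α u - 1) / (t - q ^ α u) ^ 2 :=
      div_nonneg (mul_nonneg (sq_nonneg _) (by linarith)) (sq_nonneg _)
    linarith
  have h2 := Real.add_one_le_exp (-logMoment α q t)
  rw [h.arcticExpX_eq hα hq ht, one_le_div (h.denom_pos hα hq ht), denom]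
  linarith

/-- For `t < 0` or `t > q ^ α 1`. -/
theorem WeightSigns.firstVar_le {ς : ℝ} (hs : WeightSigns α q t 1 ς) (h : IsOff α q t)
    (hα : IsGlobalProfile α) (hq : 1 < q) :
    ς * firstVar α q t ≤ ς * (1 - weight α q t 1) * (1 - Real.exp (-logMoment α q t)) := by
  have hc := h.continuous_weight hα hq
  have hz := h.continuous_cumWeight hα hq
  have h1 : 1 - Real.exp (-logMoment α q t) = Real.exp (-logMoment α q t) *
      (Real.exp (logMoment α q t) - 1) := by
    rw [mul_sub, ← Real.exp_add]; simp
  rw [h1, ← h.integral_weight_mul_exp hα hq, firstVar, ← mul_assoc, ← mul_assoc,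
    ← intervalIntegral.integral_const_mul, ← intervalIntegral.integral_const_mul]
  refine intervalIntegral.integral_mono_on zero_le_one (Continuous.intervalIntegrable (by fun_prop) _ _)
    (Continuous.intervalIntegrable (by fun_prop) _ _) fun u hu => ?_
  have h2 := hs.monotoneOn_logRatio h hα hq hu (right_mem_Icc.2 zero_le_one) hu.2
  simp only [one_mul] at h2
  have h3 := Real.exp_le_exp.2 h2
  rw [hs.exp_logRatio, hs.exp_logRatio] at h3
  have h4 : Real.exp (cumWeight α q t u) * Real.exp (-cumWeight α q t u) = 1 := by
    rw [← Real.exp_add]; simp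
  have h5 : ς * (1 - weight α q t u) ≤ ς * (1 - weight α q t 1) * Real.exp (-logMoment α q t) *
      Real.exp (cumWeight α q t u) := by
    have h6 := mul_le_mul_of_nonneg_right h3 (Real.exp_pos (cumWeight α q t u)).le
    rw [mul_assoc _ (Real.exp _) (Real.exp _), mul_comm (Real.exp (-cumWeight α q t u)), h4, mul_one] at h6
    exact h6
  have h7 := hs.pos_left u
  have h8 := mul_le_mul_of_nonneg_left h5 (mul_nonneg (Real.log_pos hq).le h7.le)
  simp only [one_mul] at h8
  calc _ = Real.log q * weight α q t u * (ς * (1 - weight α q t u)) := by ring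
    _ ≤ _ := h8
    _ = _ := by ring

/-- With Q = q^α(1), the weight satisfies 1 - p(1) = Q/(Q - t), and the resulting bound J(Q - t) ≤
Q(1 - x) is a rearrangement of the claim. -/
theorem arcticExpX_le_of_neg (hα : IsGlobalProfile α) (hq : 1 < q) (ht : t < 0) :
    arcticExpX α q t ≤ q ^ α 1 := by
  have h : IsOff α q t := Or.inl (by linarith)
  have h1 := (weightSigns_of_neg hα hq ht).firstVar_le h hα hq
  have hQ : 0 < q ^ α 1 := by positivity
  rw [h.one_sub_weight hα hq, one_mul, one_mul] at h1
  rw [h.arcticExpX_eq hα hq ht.ne, div_le_iff₀ (h.denom_pos hα hq ht.ne), denom]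
  have h2 : -q ^ α 1 / (t - q ^ α 1) = q ^ α 1 / (q ^ α 1 - t) := by
    rw [← neg_sub, neg_div_neg_eq]
  rw [h2, div_mul_eq_mul_div, le_div_iff₀ (by linarith)] at h1
  nlinarith

theorem exp_neg_logMoment_lt_one {κ : ℝ} (hs : WeightSigns α q t 1 κ) (h : IsOff α q t)
    (hα : IsGlobalProfile α) (hq : 1 < q) : Real.exp (-logMoment α q t) < 1 := by
  rw [← Real.exp_zero]
  exact Real.exp_lt_exp.2 (by linarith [hs.logMoment_pos h hα hq])

theorem arcticExpX_le_of_gt (hα : IsGlobalProfile α) (hq : 1 < q) (ht : q ^ α 1 < t) :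
    arcticExpX α q t ≤ q ^ α 1 := by
  have hQ : 0 < q ^ α 1 := by positivity
  -- By monotonicity `t` may be moved down to `min b t`, where -J ≤ `denom` bounds the quotient by
  -- the parameter itself; then `b` descends to q^α(1).
  refine le_of_forall_gt_imp_ge_of_dense fun b hb => ?_
  have hb' : q ^ α 1 < min b t := lt_min hb ht
  have h : IsOff α q (min b t) := Or.inr hb'
  have h0 : 0 < min b t := hQ.trans hb'
  refine (arcticExpX_antitoneOn_Ioi hα hq hb' ht (min_le_right b t)).trans (le_trans ?_ (min_le_left b t))
  rw [h.arcticExpX_eq hα hq h0.ne', div_le_iff₀ (h.denom_pos hα hq h0.ne'), denom]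
  have := exp_neg_logMoment_lt_one (weightSigns_of_gt hα hq hb') h hα hq
  nlinarith

theorem weight_sub_one_le (hα : IsGlobalProfile α) (hq : 1 < q) (ht : 2 * q ^ α 1 ≤ t) (u : ℝ) :
    weight α q t u - 1 ≤ 2 * q ^ α 1 / t := by
  have hQ : 0 < q ^ α 1 := by positivity
  have hs := hα.rpow_le hq u
  have hs1 := hα.one_le_rpow hq u
  have ht0 : 0 < t := by linarith
  rw [weight, div_sub_one (by linarith), div_le_div_iff₀ (by linarith) ht0]
  nlinarith

theorem neg_firstVar_le (hα : IsGlobalProfile α) (hq : 1 < q) (ht : 2 * q ^ α 1 ≤ t) :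
    -firstVar α q t ≤ Real.log q * (4 * q ^ α 1 / t) := by
  have hQ : 0 < q ^ α 1 := by positivity
  have h : IsOff α q t := Or.inr (by linarith)
  have hc := h.continuous_weight hα hq
  rw [firstVar, ← mul_neg, ← intervalIntegral.integral_neg]
  refine mul_le_mul_of_nonneg_left ?_ (Real.log_pos hq).le
  have h1 : ∫ u in (0 : ℝ)..1, -(weight α q t u * (1 - weight α q t u)) ≤
      ∫ u in (0 : ℝ)..1, (4 * q ^ α 1 / t) := by
    refine intervalIntegral.integral_mono_on zero_le_one (Continuous.intervalIntegrable (by fun_prop) _ _)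
      intervalIntegrable_const fun u _ => ?_
    have h1 := weight_sub_one_le hα hq ht u
    have h2 := one_lt_weight hα hq (by linarith : q ^ α 1 < t) u
    have h3 : 2 * q ^ α 1 / t ≤ 1 := by rw [div_le_one (by linarith)]; exact ht
    have h4 : 4 * q ^ α 1 / t = 2 * (2 * q ^ α 1 / t) := by ring
    rw [h4]
    nlinarith
  simpa using h1

/-- By monotonicity the bound need only be checked at a parameter T far to the right, where -TJ is
at least log q · ∫ q^α and `denom` is at most 2. -/
theorem le_arcticExpX_of_gt (hα : IsGlobalProfile α) (hq : 1 < q) (ht : q ^ α 1 < t) :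
    Real.log q * (∫ u in (0 : ℝ)..1, q ^ α u) / 2 ≤ arcticExpX α q t := by
  have hQ : 0 < q ^ α 1 := by positivity
  have hL := Real.log_pos hq
  -- The first bound makes `neg_firstVar_le` applicable, the second turns its right-hand side into
  -- at most 1.
  obtain ⟨T, hT⟩ := exists_ge_ge t (max (2 * q ^ α 1) (4 * q ^ α 1 * Real.log q))
  have hT2 := (le_max_left _ _).trans hT.2
  have hT3 := (le_max_right _ _).trans hT.2
  have hT' : q ^ α 1 < T := by linarith
  have h : IsOff α q T := Or.inr hT'
  have h0 : 0 < T := hQ.trans hT'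
  have hc := h.continuous_weight hα hq
  have hcs := hα.continuous_rpow hq
  refine le_trans ?_ (arcticExpX_antitoneOn_Ioi hα hq ht hT' hT.1)
  have hJ : -firstVar α q T ≤ 1 := by
    refine (neg_firstVar_le hα hq hT2).trans ?_
    rw [mul_div_assoc', div_le_one h0]
    linarith
  rw [h.arcticExpX_eq hα hq h0.ne', le_div_iff₀ (h.denom_pos hα hq h0.ne')]
  have hE : denom α q T ≤ 2 := by
    rw [denom]
    linarith [Real.exp_pos (-logMoment α q T)]
  have hI : Real.log q * (∫ u in (0 : ℝ)..1, q ^ α u) ≤ -(T * firstVar α q T) := by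
    rw [firstVar, ← mul_assoc, mul_comm T, mul_assoc, ← mul_neg, ← intervalIntegral.integral_const_mul T,
      ← intervalIntegral.integral_neg]
    refine mul_le_mul_of_nonneg_left ?_ hL.le
    refine intervalIntegral.integral_mono_on zero_le_one (hcs.intervalIntegrable _ _)
      (Continuous.intervalIntegrable (by fun_prop) _ _) fun u _ => ?_
    have hs := hα.rpow_le hq u
    have hs1 := hα.one_le_rpow hq u
    have hne := h.sub_ne_zero hα hq u
    rw [h.one_sub_weight hα hq, weight]
    rw [show -(T * (T / (T - q ^ α u) * (-q ^ α u / (T - q ^ α u)))) =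
      T ^ 2 * q ^ α u / (T - q ^ α u) ^ 2 by field_simp, le_div_iff₀ (by positivity)]
    rw [mul_comm]
    exact mul_le_mul_of_nonneg_right (by nlinarith) (by linarith)
  have hI0 : 0 ≤ ∫ u in (0 : ℝ)..1, q ^ α u :=
    intervalIntegral.integral_nonneg zero_le_one fun u _ => by positivity
  nlinarith [mul_nonneg hL.le hI0]

/-- Here q^Y increases with t, so the worst case is T far to the right, where e^P ≤ eq ≤ 3q and
`denom` is at least 1/2. -/
theorem arcticExpY_le_of_gt (hα : IsGlobalProfile α) (hq : 2 ≤ q) (ht : q ^ α 1 < t) :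
    arcticExpY α q t ≤ 8 * q := by
  have hq1 : 1 < q := by linarith
  have hQ : 0 < q ^ α 1 := by positivity
  have hL := Real.log_pos hq1
  obtain ⟨T, hT⟩ := exists_ge_ge t (max (2 * q ^ α 1) (4 * q ^ α 1 * Real.log q))
  have hT2 := (le_max_left _ _).trans hT.2
  have hT3 := (le_max_right _ _).trans hT.2
  have hT' : q ^ α 1 < T := by linarith
  have h : IsOff α q T := Or.inr hT'
  have h0 : 0 < T := hQ.trans hT'
  have hc := h.continuous_weight hα hq1
  refine (arcticExpY_monotoneOn_Ioi hα hq1 ht hT' hT.1).trans ?_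
  have hJ : -firstVar α q T ≤ 1 := by
    refine (neg_firstVar_le hα hq1 hT2).trans ?_
    rw [mul_div_assoc', div_le_one h0]
    linarith
  have hP1 : Real.log q ≤ logMoment α q T := by
    have : Real.log q * ∫ u in (0 : ℝ)..1, (1 : ℝ) ≤ logMoment α q T := by
      refine mul_le_mul_of_nonneg_left ?_ hL.le
      exact intervalIntegral.integral_mono_on zero_le_one intervalIntegrable_const
        (hc.intervalIntegrable _ _) fun u _ => (one_lt_weight hα hq1 hT' u).le
    simpa using this
  have hP2 : logMoment α q T ≤ Real.log q + 1 := by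
    have h1 : logMoment α q T ≤ Real.log q * ∫ u in (0 : ℝ)..1, (1 + 2 * q ^ α 1 / T) := by
      refine mul_le_mul_of_nonneg_left ?_ hL.le
      exact intervalIntegral.integral_mono_on zero_le_one (hc.intervalIntegrable _ _)
        intervalIntegrable_const fun u _ => by linarith [weight_sub_one_le hα hq1 hT2 u]
    have h2 : Real.log q * (2 * q ^ α 1 / T) ≤ 1 := by
      rw [mul_div_assoc', div_le_one h0]
      nlinarith
    simp only [intervalIntegral.integral_const, sub_zero, smul_eq_mul, one_mul] at h1
    linarith
  have hx : Real.exp (-logMoment α q T) ≤ 1 / 2 := by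
    refine (Real.exp_le_exp.2 (neg_le_neg hP1)).trans ?_
    rw [Real.exp_neg, Real.exp_log (by linarith), one_div]
    exact inv_anti₀ (by norm_num) hq
  have hy : Real.exp (logMoment α q T) ≤ 3 * q := by
    refine (Real.exp_le_exp.2 hP2).trans ?_
    rw [Real.exp_add, Real.exp_log (by linarith)]
    nlinarith [Real.exp_one_lt_d9]
  have hJ0 := firstVar_neg h hα hq1 h0
  rw [h.arcticExpY_eq hα hq1 h0.ne', div_le_iff₀ (h.denom_pos hα hq1 h0.ne'), numer, denom]
  nlinarith

/-- Here q^Y decreases with t, so the worst case lies near -∞, where J is small, p is close to 1 and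
e^P ≤ q. -/
theorem arcticExpY_le_of_neg (hα : IsGlobalProfile α) (hq : 12 ≤ q) (ht : t < 0) :
    arcticExpY α q t ≤ 8 * q := by
  have hq1 : 1 < q := by linarith
  have hQ : 0 < q ^ α 1 := by positivity
  have hL := Real.log_pos hq1
  obtain ⟨T, hT⟩ := exists_ge_ge (-t) (4 * q ^ α 1 * Real.log q)
  have hT' : -T < 0 := by linarith [hT.1]
  have hT0 : 0 < T := by linarith
  have h : IsOff α q (-T) := Or.inl (by linarith)
  have hc := h.continuous_weight hα hq1
  refine (arcticExpY_antitoneOn_Iio hα hq1 hT' ht (by linarith [hT.1])).trans ?_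
  have hw := weight_mem_Ioo hα hq1 hT'
  have hLQ : Real.log q * (q ^ α 1 / T) ≤ 1 / 4 := by
    rw [mul_div_assoc', div_le_div_iff₀ hT0 (by norm_num)]
    linarith [hT.2]
  have hr : ∀ u, 1 - weight α q (-T) u ≤ q ^ α 1 / T := by
    intro u
    have hs := hα.rpow_le hq1 u
    have hs1 := hα.one_le_rpow hq1 u
    rw [h.one_sub_weight hα hq1, ← neg_sub, neg_div_neg_eq, div_le_div_iff₀ (by linarith) hT0]
    nlinarith
  have hJ : firstVar α q (-T) ≤ 1 / 4 := by
    have h1 : firstVar α q (-T) ≤ Real.log q * ∫ u in (0 : ℝ)..1, (q ^ α 1 / T) := by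
      refine mul_le_mul_of_nonneg_left ?_ hL.le
      exact intervalIntegral.integral_mono_on zero_le_one
        (Continuous.intervalIntegrable (by fun_prop) _ _)
        intervalIntegrable_const fun u _ => by nlinarith [hr u, (hw u).1, (hw u).2]
    simp only [intervalIntegral.integral_const, sub_zero, smul_eq_mul, one_mul] at h1
    linarith
  have hP1 : Real.log q - 1 ≤ logMoment α q (-T) := by
    have h1 : Real.log q * (∫ u in (0 : ℝ)..1, (1 - q ^ α 1 / T)) ≤ logMoment α q (-T) := by
      refine mul_le_mul_of_nonneg_left ?_ hL.le
      exact intervalIntegral.integral_mono_on zero_le_one intervalIntegrable_const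
        (hc.intervalIntegrable _ _) fun u _ => by linarith [hr u]
    simp only [intervalIntegral.integral_const, sub_zero, smul_eq_mul, one_mul] at h1
    linarith
  have hP2 : logMoment α q (-T) ≤ Real.log q := by
    have h1 : logMoment α q (-T) ≤ Real.log q * (∫ u in (0 : ℝ)..1, (1 : ℝ)) := by
      refine mul_le_mul_of_nonneg_left ?_ hL.le
      exact intervalIntegral.integral_mono_on zero_le_one (hc.intervalIntegrable _ _)
        intervalIntegrable_const fun u _ => (hw u).2.le
    simpa using h1
  -- From P ≥ log q - 1 one gets x ≤ e/q; the assumption `12 ≤ q` is there because 12 > 4e.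
  have hx : Real.exp (-logMoment α q (-T)) ≤ 1 / 4 := by
    refine (Real.exp_le_exp.2 (neg_le_neg hP1)).trans ?_
    rw [neg_sub, Real.exp_sub, Real.exp_log (by linarith), div_le_iff₀ (by linarith)]
    nlinarith [Real.exp_one_lt_d9]
  have hy : Real.exp (logMoment α q (-T)) ≤ q := by
    refine (Real.exp_le_exp.2 hP2).trans ?_
    rw [Real.exp_log (by linarith)]
  have hJ0 := firstVar_pos hα hq1 hT'
  rw [h.arcticExpY_eq hα hq1 hT'.ne, div_le_iff₀ (h.denom_pos hα hq1 hT'.ne), numer, denom]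
  nlinarith

/-! ### Lower bounds for the denominator -/

theorem mul_le_integral_of_le {f : ℝ → ℝ} (hf : Continuous f) (h0 : ∀ u ∈ Icc (0 : ℝ) 1, 0 ≤ f u)
    {a b m : ℝ} (ha : 0 ≤ a) (hab : a ≤ b) (hb : b ≤ 1) (hm : ∀ u ∈ Icc a b, m ≤ f u) :
    (b - a) * m ≤ ∫ u in (0 : ℝ)..1, f u := by
  have h1 : ∫ _ in a..b, m ≤ ∫ u in a..b, f u :=
    intervalIntegral.integral_mono_on hab intervalIntegrable_const (hf.intervalIntegrable _ _) hm
  rw [intervalIntegral.integral_const, smul_eq_mul] at h1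
  refine h1.trans (intervalIntegral.integral_mono_interval ha hab hb ?_ (hf.intervalIntegrable _ _))
  refine MeasureTheory.ae_restrict_of_forall_mem measurableSet_Ioc fun u hu => ?_
  exact h0 u (Ioc_subset_Icc_self hu)

/-- If α - id took the same value at both ends, then, being monotone, it would be constant in
between and α would have slope 1 there. The limits use the absence of filled intervals through this
strict inequality. -/
theorem NoFilledInterval.sub_lt_sub (hN : NoFilledInterval α) (hα : IsStartingProfile α) {c d : ℝ}
    (hc : 0 ≤ c) (hcd : c < d) (hd : d ≤ 1) : α c - c < α d - d := by
  have hm := hα.monotoneOn_sub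
  have hcm : c ∈ Icc (0 : ℝ) 1 := ⟨hc, hcd.le.trans hd⟩
  have hdm : d ∈ Icc (0 : ℝ) 1 := ⟨hc.trans hcd.le, hd⟩
  refine lt_of_le_of_ne (hm hcm hdm hcd.le) fun heq => ?_
  obtain ⟨u, hu, hnd⟩ := hN c d hc hcd hd
  apply hnd
  have h1 : HasDerivAt (fun v => v + (α c - c)) 1 u := (hasDerivAt_id u).add_const _
  refine h1.congr_of_eventuallyEq ?_
  filter_upwards [Ioo_mem_nhds hu.1 hu.2] with v hv
  have hvm : v ∈ Icc (0 : ℝ) 1 := ⟨hc.trans hv.1.le, hv.2.le.trans hd⟩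
  have h2 := hm hcm hvm hv.1.le
  have h3 := hm hvm hdm hv.2.le
  simp only at h2 h3
  linarith

/-- A quantitative `denom_pos`. The gain of `logRatio` over [b, d] is at least log q · c times the
increase of α - id there, and it makes the integrand of `denom` correspondingly positive at every
point of [a, b]. -/
theorem le_denom_of_neg (hα : IsGlobalProfile α) (hq : 1 < q) (ht : t < 0) {a b d m c : ℝ}
    (ha : 0 ≤ a) (hab : a ≤ b) (hbd : b ≤ d) (hd : d ≤ 1) (hc0 : 0 ≤ c)
    (hm : ∀ u ∈ Icc a b, m ≤ weight α q t u * (1 - weight α q t u))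
    (hc : ∀ u ∈ Icc b d, c ≤ weight α q t u) :
    (b - a) * (Real.log q * m * (Real.log q * c * ((α d - d) - (α b - b)))) ≤ denom α q t := by
  have h : IsOff α q t := Or.inl (by linarith)
  have hcw := h.continuous_weight hα hq
  have hz := h.continuous_cumWeight hα hq
  have hL := Real.log_pos hq
  have hw := weight_mem_Ioo hα hq ht
  have hs := weightSigns_of_neg hα hq ht
  rw [h.denom_eq hα hq]
  refine mul_le_integral_of_le (by fun_prop) (fun u hu => ?_) ha hab (hbd.trans hd) fun u hu => ?_
  · exact mul_nonneg (mul_pos hL (hw u).1).le (sub_nonneg.2 (one_sub_weight_lt_exp hα hq ht hu).le)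
  · have hum : u ∈ Icc (0 : ℝ) 1 := ⟨ha.trans hu.1, hu.2.trans (hbd.trans hd)⟩
    have hbm : b ∈ Icc (0 : ℝ) 1 := ⟨ha.trans hab, hbd.trans hd⟩
    have hdm : d ∈ Icc (0 : ℝ) 1 := ⟨hbm.1.trans hbd, hd⟩
    have h1m : (1 : ℝ) ∈ Icc (0 : ℝ) 1 := right_mem_Icc.2 zero_le_one
    have m1 := hs.monotoneOn_logRatio h hα hq hum hbm hu.2
    have m3 := hs.monotoneOn_logRatio h hα hq hdm h1m hdm.2
    have m2 := h.monotoneOn_logRatio hα hq (κ := 1) (c := Real.log q * c) hbm.1 hd (fun v hv => by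
      rw [one_mul, ← mul_sub]
      exact mul_nonneg hL.le (sub_nonneg.2 (hc v (Ioo_subset_Icc_self hv))))
      (left_mem_Icc.2 hbd) (right_mem_Icc.2 hbd) hbd
    simp only [one_mul] at m1 m2 m3
    -- `D` measures by how much the pointwise comparison behind positivity is strict: e^D ≥ 1 + D
    -- turns a gain of `logRatio` into a gap between the two integrands.
    set D := logRatio α q t 1 - logRatio α q t u with hD
    have hD1 : Real.log q * c * ((α d - d) - (α b - b)) ≤ D := by rw [hD]; linarith
    have e1 : (1 - weight α q t u) * Real.exp D =
        (1 - weight α q t 1) * Real.exp (cumWeight α q t u - logMoment α q t) := by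
      have hpu : 0 < 1 - weight α q t u := by linarith [(hw u).2]
      have hp1 : 0 < 1 - weight α q t 1 := by linarith [(hw 1).2]
      have : D = Real.log (1 - weight α q t 1) - Real.log (1 - weight α q t u) +
          (cumWeight α q t u - logMoment α q t) := by
        rw [hD, logRatio, logRatio, logMoment]; ring
      rw [this, Real.exp_add, Real.exp_sub, Real.exp_log hpu, Real.exp_log hp1]
      field_simp
    have e2 : (1 - weight α q t u) * D ≤
        Real.exp (cumWeight α q t u - logMoment α q t) - (1 - weight α q t u) := by
      have k1 := Real.add_one_le_exp D
      have k2 := mul_le_mul_of_nonneg_left k1 (sub_nonneg.2 (hw u).2.le)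
      have k3 : (1 - weight α q t 1) * Real.exp (cumWeight α q t u - logMoment α q t) ≤
          1 * Real.exp (cumWeight α q t u - logMoment α q t) :=
        mul_le_mul_of_nonneg_right (by linarith [(hw 1).1]) (Real.exp_pos _).le
      linarith
    have hβ : 0 ≤ (α d - d) - (α b - b) := sub_nonneg.2 (hα.monotoneOn_sub hbm hdm hbd)
    have hc1 : 0 ≤ Real.log q * c * ((α d - d) - (α b - b)) :=
      mul_nonneg (mul_nonneg hL.le hc0) hβ
    calc Real.log q * m * (Real.log q * c * ((α d - d) - (α b - b)))
        ≤ Real.log q * (weight α q t u * (1 - weight α q t u)) *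
          (Real.log q * c * ((α d - d) - (α b - b))) :=
          mul_le_mul_of_nonneg_right (mul_le_mul_of_nonneg_left (hm u hu) hL.le) hc1
      _ ≤ Real.log q * (weight α q t u * (1 - weight α q t u)) * D :=
          mul_le_mul_of_nonneg_left hD1 (mul_nonneg hL.le
            (mul_nonneg (hw u).1.le (sub_nonneg.2 (hw u).2.le)))
      _ = Real.log q * weight α q t u * ((1 - weight α q t u) * D) := by ring
      _ ≤ _ := mul_le_mul_of_nonneg_left e2 (mul_pos hL (hw u).1).le

theorem le_denom_of_pos (hα : IsGlobalProfile α) (hq : 1 < q) (ht : 0 < t) (ht1 : t < 1)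
    {a b d c : ℝ} (ha : 0 ≤ a) (hab : a ≤ b) (hbd : b ≤ d) (hd : d ≤ 1) (hc0 : 0 ≤ c)
    (hc : ∀ u ∈ Icc a d, c ≤ -weight α q t u) :
    (b - a) * (Real.log q * c * (Real.log q * c * ((α d - d) - (α b - b)))) ≤ denom α q t := by
  have h : IsOff α q t := Or.inl ht1
  have hcw := h.continuous_weight hα hq
  have hz := h.continuous_cumWeight hα hq
  have hL := Real.log_pos hq
  have hw := weight_neg hα hq ht ht1
  have hs := weightSigns_of_pos hα hq ht ht1
  rw [h.denom_eq hα hq]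
  refine mul_le_integral_of_le (by fun_prop) (fun u hu => ?_) ha hab (hbd.trans hd) fun u hu => ?_
  · exact mul_nonneg_of_nonpos_of_nonpos (mul_neg_of_pos_of_neg hL (hw u)).le
      (sub_nonpos.2 (exp_lt_one_sub_weight hα hq ht ht1 hu).le)
  · have hum : u ∈ Icc (0 : ℝ) 1 := ⟨ha.trans hu.1, hu.2.trans (hbd.trans hd)⟩
    have hbm : b ∈ Icc (0 : ℝ) 1 := ⟨ha.trans hab, hbd.trans hd⟩
    have hdm : d ∈ Icc (0 : ℝ) 1 := ⟨hbm.1.trans hbd, hd⟩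
    have h1m : (1 : ℝ) ∈ Icc (0 : ℝ) 1 := right_mem_Icc.2 zero_le_one
    have m1 := hs.monotoneOn_logRatio h hα hq hum hbm hu.2
    have m3 := hs.monotoneOn_logRatio h hα hq hdm h1m hdm.2
    have m2 := h.monotoneOn_logRatio hα hq (κ := -1) (c := -(Real.log q * c)) hbm.1 hd (fun v hv => by
      have := mul_nonneg hL.le (sub_nonneg.2 (hc v ⟨hab.trans hv.1.le, hv.2.le⟩))
      linarith)
      (left_mem_Icc.2 hbd) (right_mem_Icc.2 hbd) hbd
    have m4 := (hs.strictMono_cumWeight h hα hq).monotone hum.2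
    simp only at m1 m2 m3 m4
    set D := logRatio α q t u - logRatio α q t 1 with hD
    have hD1 : Real.log q * c * ((α d - d) - (α b - b)) ≤ D := by rw [hD]; linarith
    have hβ : 0 ≤ (α d - d) - (α b - b) := sub_nonneg.2 (hα.monotoneOn_sub hbm hdm hbd)
    have hc1 : 0 ≤ Real.log q * c * ((α d - d) - (α b - b)) :=
      mul_nonneg (mul_nonneg hL.le hc0) hβ
    have e1 : 1 - weight α q t u = (1 - weight α q t 1) *
        (Real.exp D * Real.exp (cumWeight α q t u - logMoment α q t)) := by
      have hpu : 0 < 1 - weight α q t u := by linarith [hw u]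
      have hp1 : 0 < 1 - weight α q t 1 := by linarith [hw 1]
      have : D + (cumWeight α q t u - logMoment α q t) =
          Real.log (1 - weight α q t u) - Real.log (1 - weight α q t 1) := by
        rw [hD, logRatio, logRatio, logMoment]; ring
      rw [← Real.exp_add, this, Real.exp_sub, Real.exp_log hpu, Real.exp_log hp1]
      field_simp
    -- For 0 < t < 1 both 1 - p(1) and exp(Z(u) - P) are at least 1, so the gap is at least e^D - 1,
    -- hence at least D.
    have e2 : D ≤ (1 - weight α q t u) - Real.exp (cumWeight α q t u - logMoment α q t) := by
      have k1 := Real.add_one_le_exp D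
      have k2 : 1 ≤ Real.exp (cumWeight α q t u - logMoment α q t) :=
        Real.one_le_exp_iff.2 (by rw [logMoment]; linarith)
      have k3 : Real.exp D * Real.exp (cumWeight α q t u - logMoment α q t) ≤ 1 - weight α q t u := by
        rw [e1]
        exact le_mul_of_one_le_left (by positivity) (by linarith [hw 1])
      nlinarith
    calc Real.log q * c * (Real.log q * c * ((α d - d) - (α b - b)))
        ≤ Real.log q * (-weight α q t u) * D :=
          mul_le_mul (mul_le_mul_of_nonneg_left (hc u ⟨hu.1, hu.2.trans hbd⟩) hL.le) hD1 hc1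
            (mul_nonneg hL.le (by linarith [hw u]))
      _ ≤ Real.log q * (-weight α q t u) *
          ((1 - weight α q t u) - Real.exp (cumWeight α q t u - logMoment α q t)) :=
          mul_le_mul_of_nonneg_left e2 (mul_nonneg hL.le (by linarith [hw u]))
      _ = _ := by ring

/-! ### Asymptotics of logarithms -/

theorem eventually_const_mul_rpow_le {C a b : ℝ} (hab : a < b) :
    ∀ᶠ q : ℝ in atTop, C * q ^ a ≤ q ^ b := by
  have h := tendsto_rpow_atTop (sub_pos.2 hab)
  filter_upwards [h.eventually_ge_atTop C, eventually_gt_atTop 0] with q h1 h2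
  calc C * q ^ a ≤ q ^ (b - a) * q ^ a := mul_le_mul_of_nonneg_right h1 (by positivity)
    _ = q ^ b := by rw [← Real.rpow_add h2]; ring_nf

/-- Constant factors do not matter for the logarithm to base q: they are absorbed in an extra power
q^(ε/4). -/
theorem tendsto_logb_of_le_of_le {f : ℝ → ℝ} {a : ℝ}
    (h1 : ∀ ε : ℝ, 0 < ε → ∃ c : ℝ, 0 < c ∧ ∀ᶠ q in atTop, c * q ^ (a - ε) ≤ f q)
    (h2 : ∀ ε : ℝ, 0 < ε → ∃ C : ℝ, ∀ᶠ q in atTop, f q ≤ C * q ^ (a + ε)) :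
    Tendsto (fun q => Real.logb q (f q)) atTop (𝓝 a) := by
  rw [Metric.tendsto_nhds]
  intro ε hε
  obtain ⟨c, hc, h1⟩ := h1 (ε / 4) (by positivity)
  obtain ⟨C, h2⟩ := h2 (ε / 4) (by positivity)
  filter_upwards [h1, h2, eventually_const_mul_rpow_le (C := c⁻¹) (a := a - ε / 2) (b := a - ε / 4)
    (by linarith), eventually_const_mul_rpow_le (C := C) (a := a + ε / 4) (b := a + ε / 2)
    (by linarith), eventually_gt_atTop 1] with q k1 k2 k3 k4 hq
  have hq0 : 0 < q := by linarith
  have hpos : 0 < f q := (by positivity : 0 < c * q ^ (a - ε / 4)).trans_le k1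
  have l1 : a - ε / 2 ≤ Real.logb q (f q) := by
    rw [Real.le_logb_iff_rpow_le hq hpos]
    rw [inv_mul_le_iff₀ hc] at k3
    exact k3.trans k1
  have l2 : Real.logb q (f q) ≤ a + ε / 2 := by
    rw [Real.logb_le_iff_le_rpow hq hpos]
    exact k2.trans k4
  rw [Real.dist_eq, abs_lt]
  constructor <;> linarith

/-! ### The left part near the origin -/

/-- Both coordinates decrease in t, so it suffices to treat s ≤ 1/2, where the weight is O(s). Both
numerators are then O((log q)² s²), while `denom` is at least a constant times (log q)² s² q^(-ε/2).
The factor s² cancels, which makes the bound uniform down to s = 0. -/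
theorem eventually_logb_le_of_pos (hα : IsGlobalProfile α) (hN : NoFilledInterval α) {ε : ℝ}
    (hε : 0 < ε) : ∀ᶠ q in atTop, ∀ t ∈ Ioo (0 : ℝ) 1,
      Real.logb q (arcticExpX α q t) ≤ ε ∧ Real.logb q (arcticExpY α q t) ≤ ε := by
  -- On [0, 2δ] the weight then has size at least s q^(-ε/4); two such factors enter the lower bound
  -- for `denom`.
  obtain ⟨δ, hδ0, hδ1, hδ⟩ : ∃ δ : ℝ, 0 < δ ∧ 2 * δ ≤ 1 ∧ α (2 * δ) ≤ ε / 4 := by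
    have h1 : Tendsto (fun δ : ℝ => α (2 * δ)) (𝓝[>] 0) (𝓝 0) := by
      have : Tendsto (fun δ : ℝ => α (2 * δ)) (𝓝 0) (𝓝 (α (2 * 0))) :=
        (hα.continuous.comp (continuous_const.mul continuous_id)).tendsto 0
      rw [mul_zero, hα.zero] at this
      exact this.mono_left nhdsWithin_le_nhds
    have h2 : ∀ᶠ δ : ℝ in 𝓝[>] 0, δ < 1 / 2 :=
      (eventually_lt_nhds (by norm_num : (0 : ℝ) < 1 / 2)).filter_mono nhdsWithin_le_nhds
    obtain ⟨δ, k1, k2, k3⟩ := ((h1.eventually_lt_const (by positivity : 0 < ε / 4)).and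
      (h2.and self_mem_nhdsWithin)).exists
    exact ⟨δ, k3, by linarith, k1.le⟩
  set β := (α (2 * δ) - 2 * δ) - (α δ - δ) with hβdef
  have hβ : 0 < β := sub_pos.2 (hN.sub_lt_sub hα.toIsStartingProfile hδ0.le (by linarith) hδ1)
  filter_upwards [eventually_const_mul_rpow_le (C := 8 / (δ * β)) (a := ε / 2) (b := ε)
    (by linarith), Real.tendsto_log_atTop.eventually_ge_atTop 1, eventually_gt_atTop 1]
    with q hC hL1 hq t ht
  have hq0 : 0 < q := by linarith
  set L := Real.log q with hLdef
  have hs0 : 0 < min t (1 / 2) := lt_min ht.1 (by norm_num)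
  have hs1 : min t (1 / 2) ≤ 1 / 2 := min_le_right _ _
  have hsm : min t (1 / 2) ∈ Ioo (0 : ℝ) 1 := ⟨hs0, by linarith⟩
  have mX := arcticExpX_antitoneOn_Ioo hα hq hsm ht (min_le_left _ _)
  have mY := arcticExpY_antitoneOn_Ioo hα hq hsm ht (min_le_left _ _)
  have hoff : IsOff α q t := Or.inl ht.2
  rw [Real.logb_le_iff_le_rpow hq (hoff.arcticExpX_pos hα hq ht.1.ne'),
    Real.logb_le_iff_le_rpow hq (hoff.arcticExpY_pos hα hq ht.1.ne')]
  suffices arcticExpX α q (min t (1 / 2)) ≤ 8 / (δ * β) * q ^ (ε / 2) ∧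
      arcticExpY α q (min t (1 / 2)) ≤ 8 / (δ * β) * q ^ (ε / 2) from
    ⟨mX.trans (this.1.trans hC), mY.trans (this.2.trans hC)⟩
  generalize min t (1 / 2) = s at hs0 hs1 hsm
  have h : IsOff α q s := Or.inl hsm.2
  have hw := weight_neg hα hq hs0 hsm.2
  have hcw := h.continuous_weight hα hq
  have hz := h.continuous_cumWeight hα hq
  have hw2 : ∀ u, -weight α q s u ≤ 2 * s := by
    intro u
    have h1 := hα.one_le_rpow hq u
    rw [weight, ← div_neg, div_le_iff₀ (by linarith)]
    nlinarith
  have hE : δ * β * L ^ 2 * s ^ 2 * q ^ (-(ε / 2)) ≤ denom α q s := by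
    have := le_denom_of_pos hα hq hs0 hsm.2 (a := 0) (b := δ) (d := 2 * δ) (c := s * q ^ (-(ε / 4)))
      le_rfl hδ0.le (by linarith) hδ1 (by positivity) (fun u hu => by
        have h1 := hα.one_le_rpow hq u
        have hum : u ∈ Icc (0 : ℝ) 1 := ⟨hu.1, hu.2.trans hδ1⟩
        have h2 : α u ≤ ε / 4 := (hα.increasing.monotoneOn hum ⟨by linarith, hδ1⟩ hu.2).trans hδ
        have h3 : q ^ α u ≤ q ^ (ε / 4) := Real.rpow_le_rpow_of_exponent_le hq.le h2
        rw [weight, ← div_neg s, le_div_iff₀ (by linarith), Real.rpow_neg hq0.le]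
        have h4 : (q ^ (ε / 4))⁻¹ * (q ^ α u) ≤ 1 := by
          rw [inv_mul_le_iff₀ (by positivity), mul_one]; exact h3
        have h5 : 0 < (q ^ (ε / 4))⁻¹ := by positivity
        nlinarith [mul_pos hs0 (mul_pos h5 hs0)])
    refine le_trans (le_of_eq ?_) this
    have e : q ^ (-(ε / 2)) = q ^ (-(ε / 4)) * q ^ (-(ε / 4)) := by
      rw [← Real.rpow_add hq0]; ring_nf
    rw [e, hβdef, hLdef]
    ring
  have hE0 := h.denom_pos hα hq hs0.ne'
  have hJ : -firstVar α q s ≤ 4 * L * s := by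
    rw [firstVar, ← mul_neg, ← intervalIntegral.integral_neg]
    have : ∫ u in (0 : ℝ)..1, -(weight α q s u * (1 - weight α q s u)) ≤
        ∫ u in (0 : ℝ)..1, 4 * s :=
      intervalIntegral.integral_mono_on zero_le_one (Continuous.intervalIntegrable (by fun_prop) _ _)
        intervalIntegrable_const fun u _ => by nlinarith [hw2 u, hw u]
    simp only [intervalIntegral.integral_const, sub_zero, smul_eq_mul, one_mul] at this
    nlinarith
  have hP : -(2 * L * s) ≤ logMoment α q s := by
    have : L * ∫ u in (0 : ℝ)..1, -(2 * s) ≤ logMoment α q s := by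
      refine mul_le_mul_of_nonneg_left ?_ (by linarith)
      exact intervalIntegral.integral_mono_on zero_le_one intervalIntegrable_const
        (hcw.intervalIntegrable _ _) fun u _ => by linarith [hw2 u]
    simp only [intervalIntegral.integral_const, sub_zero, smul_eq_mul, one_mul] at this
    linarith
  -- Bounding the three terms of `numer` separately would give only order s. In integral form the
  -- weight supplies one factor s, and the difference between 1 - p and e^Z the other.
  have hNu : numer α q s ≤ 8 * L ^ 2 * s ^ 2 := by
    rw [h.numer_eq hα hq]
    have : ∫ u in (0 : ℝ)..1, L * weight α q s u * (Real.exp (cumWeight α q s u) -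
        (1 - weight α q s u)) ≤ ∫ u in (0 : ℝ)..1, 8 * L ^ 2 * s ^ 2 := by
      refine intervalIntegral.integral_mono_on zero_le_one (Continuous.intervalIntegrable (by fun_prop) _ _)
        intervalIntegrable_const fun u hu => ?_
      have m4 := ((weightSigns_of_pos hα hq hs0 hsm.2).strictMono_cumWeight h hα hq).monotone hu.2
      have h1 := Real.add_one_le_exp (cumWeight α q s u)
      change -1 * _ ≤ -1 * logMoment α q s at m4
      have h3 : (1 - weight α q s u) - Real.exp (cumWeight α q s u) ≤ 4 * L * s := by
        nlinarith [hw2 u]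
      calc _ = L * (-weight α q s u) * ((1 - weight α q s u) - Real.exp (cumWeight α q s u)) := by ring
        _ ≤ L * (-weight α q s u) * (4 * L * s) :=
            mul_le_mul_of_nonneg_left h3 (mul_nonneg (by linarith) (by linarith [hw u]))
        _ ≤ L * (2 * s) * (4 * L * s) :=
            mul_le_mul_of_nonneg_right (mul_le_mul_of_nonneg_left (hw2 u) (by linarith))
              (by positivity)
        _ = _ := by ring
    simpa using this
  have hqq : q ^ (-(ε / 2)) * q ^ (ε / 2) = 1 := by
    rw [← Real.rpow_add hq0]; simp
  have hmain : 8 * L ^ 2 * s ^ 2 ≤ 8 / (δ * β) * q ^ (ε / 2) * denom α q s := by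
    calc 8 * L ^ 2 * s ^ 2 = 8 / (δ * β) * q ^ (ε / 2) *
        (δ * β * L ^ 2 * s ^ 2 * q ^ (-(ε / 2))) := by
          field_simp
          linear_combination -hqq
      _ ≤ _ := mul_le_mul_of_nonneg_left hE (by positivity)
  rw [h.arcticExpX_eq hα hq hs0.ne', h.arcticExpY_eq hα hq hs0.ne', div_le_iff₀ hE0, div_le_iff₀ hE0]
  refine ⟨le_trans ?_ hmain, hNu.trans hmain⟩
  have : s * (-firstVar α q s) ≤ s * (4 * L * s) := mul_le_mul_of_nonneg_left hJ hs0.le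
  have h1 : L * s ^ 2 ≤ L ^ 2 * s ^ 2 := mul_le_mul_of_nonneg_right (by nlinarith) (sq_nonneg s)
  nlinarith [sq_nonneg s]

/-! ### The left part as `q → ∞` -/

theorem weight_neg_rpow (hq : 0 < q) (α : ℝ → ℝ) (a u : ℝ) :
    weight α q (-q ^ a) u = (1 + q ^ (α u - a))⁻¹ := by
  have h1 : 0 < q ^ a := by positivity
  have h2 : 0 < q ^ α u := by positivity
  rw [weight, Real.rpow_sub hq, ← neg_add', neg_div_neg_eq]
  field_simp

/-- The weight 1/(1 + q^(α(u) - α(τ))) tends to 1 for u < τ and to 0 for u > τ, and is dominated by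
1. -/
theorem tendsto_integral_weight (hα : IsGlobalProfile α) {τ : ℝ} (hτ : τ ∈ Ioo (0 : ℝ) 1) :
    Tendsto (fun q => ∫ u in (0 : ℝ)..1, weight α q (-q ^ α τ) u) atTop (𝓝 τ) := by
  have h1 : ∫ u in (0 : ℝ)..1, indicator {u | u ≤ τ} (fun _ => (1 : ℝ)) u = τ := by
    rw [intervalIntegral.integral_indicator ⟨hτ.1.le, hτ.2.le⟩]
    simp
  suffices Tendsto (fun q => ∫ u in (0 : ℝ)..1, weight α q (-q ^ α τ) u) atTop
      (𝓝 (∫ u in (0 : ℝ)..1, indicator {u | u ≤ τ} (fun _ => (1 : ℝ)) u)) by rwa [h1] at this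
  have hneg : ∀ q : ℝ, 1 < q → -q ^ α τ < 0 := fun q hq => by
    have : 0 < q ^ α τ := by positivity
    linarith
  refine intervalIntegral.tendsto_integral_filter_of_dominated_convergence (fun _ => 1) ?_ ?_
    intervalIntegrable_const ?_
  · filter_upwards [eventually_gt_atTop 1] with q hq
    exact (IsOff.continuous_weight (Or.inl (by linarith [hneg q hq])) hα hq).aestronglyMeasurable
  · filter_upwards [eventually_gt_atTop 1] with q hq
    refine Eventually.of_forall fun u _ => ?_
    have := weight_mem_Ioo hα hq (hneg q hq) u
    rw [Real.norm_eq_abs, abs_of_pos this.1]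
    exact this.2.le
  · have : ∀ᵐ u : ℝ, u ≠ τ := by
      simp [MeasureTheory.ae_iff, MeasureTheory.measure_singleton]
    filter_upwards [this] with u hu hu1
    rw [uIoc_of_le zero_le_one] at hu1
    have hum : u ∈ Icc (0 : ℝ) 1 := Ioc_subset_Icc_self hu1
    have hτm : τ ∈ Icc (0 : ℝ) 1 := Ioo_subset_Icc_self hτ
    have key : ∀ c : ℝ, Tendsto (fun q : ℝ => (1 + q ^ (α u - α τ))) atTop (𝓝 c) → c ≠ 0 →
        Tendsto (fun q => weight α q (-q ^ α τ) u) atTop (𝓝 c⁻¹) := by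
      intro c hc hc0
      refine (hc.inv₀ hc0).congr' ?_
      filter_upwards [eventually_gt_atTop 0] with q hq
      rw [weight_neg_rpow hq]
    rcases lt_or_gt_of_ne hu with h | h
    · rw [indicator_of_mem (show u ∈ {u | u ≤ τ} from h.le)]
      have h2 := tendsto_rpow_neg_atTop (sub_pos.2 (hα.increasing hum hτm h))
      rw [neg_sub] at h2
      simpa using key 1 (by simpa using h2.const_add 1) one_ne_zero
    · rw [indicator_of_notMem (show u ∉ {u | u ≤ τ} from not_le.2 h)]
      have h2 := tendsto_rpow_atTop (sub_pos.2 (hα.increasing hτm hum h))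
      have h3 : Tendsto (fun q : ℝ => 1 + q ^ (α u - α τ)) atTop atTop :=
        tendsto_atTop_add_const_left _ _ h2
      refine h3.inv_tendsto_atTop.congr' ?_
      filter_upwards [eventually_gt_atTop 0] with q hq
      rw [weight_neg_rpow hq, Pi.inv_apply]

/-- On a short interval to the left of τ the weight is at least 1/2 and its complement at least
q^(-ε)/2. This bounds J directly; for `denom` the interval is halved, its right half supplying the
strict increase of α - id. -/
theorem exists_le_firstVar_denom (hα : IsGlobalProfile α) (hN : NoFilledInterval α) {τ : ℝ}
    (hτ : τ ∈ Ioo (0 : ℝ) 1) {ε : ℝ} (hε : 0 < ε) :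
    ∃ c : ℝ, 0 < c ∧ ∀ᶠ q in atTop, c * q ^ (0 - ε) ≤ firstVar α q (-q ^ α τ) ∧
      c * q ^ (0 - ε) ≤ denom α q (-q ^ α τ) := by
  obtain ⟨δ, hδ0, hδ1, hδ⟩ : ∃ δ : ℝ, 0 < δ ∧ 0 ≤ τ - 2 * δ ∧ α τ - ε ≤ α (τ - 2 * δ) := by
    have h1 : Tendsto (fun δ : ℝ => α (τ - 2 * δ)) (𝓝[>] 0) (𝓝 (α τ)) := by
      have : Tendsto (fun δ : ℝ => α (τ - 2 * δ)) (𝓝 0) (𝓝 (α (τ - 2 * 0))) :=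
        (hα.continuous.comp (continuous_const.sub (continuous_const.mul continuous_id))).tendsto 0
      rw [mul_zero, sub_zero] at this
      exact this.mono_left nhdsWithin_le_nhds
    have h2 : ∀ᶠ δ : ℝ in 𝓝[>] 0, δ < τ / 2 :=
      (eventually_lt_nhds (half_pos hτ.1)).filter_mono nhdsWithin_le_nhds
    obtain ⟨δ, k1, k2, k3⟩ := ((h1.eventually_const_lt (by linarith : α τ - ε < α τ)).and
      (h2.and self_mem_nhdsWithin)).exists
    exact ⟨δ, k3, by linarith, k1.le⟩
  set β := (α τ - τ) - (α (τ - δ) - (τ - δ)) with hβdef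
  have hβ : 0 < β := sub_pos.2 (hN.sub_lt_sub hα.toIsStartingProfile (by linarith) (by linarith)
    hτ.2.le)
  refine ⟨δ / 8 * min 1 β, by positivity, ?_⟩
  filter_upwards [Real.tendsto_log_atTop.eventually_ge_atTop 1, eventually_gt_atTop 1] with q hL hq
  have hq0 : 0 < q := by linarith
  have hT : 0 < q ^ α τ := by positivity
  have hneg : -q ^ α τ < 0 := by linarith
  have h : IsOff α q (-q ^ α τ) := Or.inl (by linarith)
  have hcw := h.continuous_weight hα hq
  have hw := weight_mem_Ioo hα hq hneg
  have hτm : τ ∈ Icc (0 : ℝ) 1 := Ioo_subset_Icc_self hτ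
  have hp : ∀ u ∈ Icc (τ - 2 * δ) τ, 1 / 2 ≤ weight α q (-q ^ α τ) u := by
    intro u hu
    have hum : u ∈ Icc (0 : ℝ) 1 := ⟨hδ1.trans hu.1, hu.2.trans hτ.2.le⟩
    have h1 : q ^ (α u - α τ) ≤ 1 := Real.rpow_le_one_of_one_le_of_nonpos hq.le
      (sub_nonpos.2 (hα.increasing.monotoneOn hum hτm hu.2))
    have h2 : 0 < q ^ (α u - α τ) := by positivity
    rw [weight_neg_rpow hq0, one_div]
    exact inv_anti₀ (by linarith) (by linarith)
  have hr : ∀ u ∈ Icc (τ - 2 * δ) τ, 1 / 2 * q ^ (0 - ε) ≤ 1 - weight α q (-q ^ α τ) u := by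
    intro u hu
    have hum : u ∈ Icc (0 : ℝ) 1 := ⟨hδ1.trans hu.1, hu.2.trans hτ.2.le⟩
    have h0 : α (τ - 2 * δ) ≤ α u :=
      hα.increasing.monotoneOn ⟨hδ1, by linarith [hτ.2]⟩ hum hu.1
    have h1 : q ^ (0 - ε) ≤ q ^ (α u - α τ) :=
      Real.rpow_le_rpow_of_exponent_le hq.le (by linarith)
    have h2 : 0 < q ^ (α u - α τ) := by positivity
    have h3 := hp u hu
    have e : 1 - weight α q (-q ^ α τ) u = weight α q (-q ^ α τ) u * q ^ (α u - α τ) := by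
      rw [weight_neg_rpow hq0]
      field_simp
      ring
    rw [e]
    exact mul_le_mul h3 h1 (by positivity) (by linarith)
  have hm : ∀ u ∈ Icc (τ - 2 * δ) τ, 1 / 4 * q ^ (0 - ε) ≤
      weight α q (-q ^ α τ) u * (1 - weight α q (-q ^ α τ) u) := by
    intro u hu
    have := mul_le_mul (hp u hu) (hr u hu) (by positivity) (hw u).1.le
    linarith
  constructor
  · have h1 := mul_le_integral_of_le (f := fun u => weight α q (-q ^ α τ) u *
      (1 - weight α q (-q ^ α τ) u)) (by fun_prop)
      (fun u _ => mul_nonneg (hw u).1.le (sub_nonneg.2 (hw u).2.le)) hδ1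
      (by linarith : τ - 2 * δ ≤ τ) hτ.2.le hm
    have h2 : (τ - (τ - 2 * δ)) * (1 / 4 * q ^ (0 - ε)) ≤ firstVar α q (-q ^ α τ) := by
      refine h1.trans (le_mul_of_one_le_left ?_ hL)
      exact intervalIntegral.integral_nonneg zero_le_one
        fun u _ => mul_nonneg (hw u).1.le (sub_nonneg.2 (hw u).2.le)
    refine le_trans ?_ h2
    have h3 : min 1 β ≤ 1 := min_le_left _ _
    calc δ / 8 * min 1 β * q ^ (0 - ε) ≤ δ / 2 * 1 * q ^ (0 - ε) := by gcongr; norm_num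
      _ = _ := by ring
  · have h1 := le_denom_of_neg hα hq hneg (a := τ - 2 * δ) (b := τ - δ) (d := τ)
      (m := 1 / 4 * q ^ (0 - ε)) (c := 1 / 2) hδ1 (by linarith) (by linarith) hτ.2.le (by norm_num)
      (fun u hu => hm u ⟨hu.1, by linarith [hu.2]⟩) (fun u hu => hp u ⟨by linarith [hu.1], hu.2⟩)
    refine le_trans ?_ h1
    rw [← hβdef]
    have h3 : min 1 β ≤ β := min_le_right _ _
    calc δ / 8 * min 1 β * q ^ (0 - ε) ≤ δ / 8 * β * q ^ (0 - ε) := by gcongr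
      _ = δ * (1 * (1 / 4 * q ^ (0 - ε)) * (1 * (1 / 2) * β)) := by ring
      _ ≤ δ * (Real.log q * (1 / 4 * q ^ (0 - ε)) * (Real.log q * (1 / 2) * β)) := by gcongr
      _ = _ := by ring

/-- On the logarithmic scale J and E contribute nothing, -t contributes α(τ), and N is dominated by
e^P = q^(∫p), which contributes τ. -/
theorem tendsto_arcticPoint_neg_rpow (hα : IsGlobalProfile α) (hN : NoFilledInterval α) {τ : ℝ}
    (hτ : τ ∈ Ioo (0 : ℝ) 1) :
    Tendsto (fun q => arcticPoint α q (-q ^ α τ)) atTop (𝓝 (α τ, τ)) := by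
  have hev : ∀ᶠ q : ℝ in atTop, 1 < q ∧ -q ^ α τ < 0 := by
    filter_upwards [eventually_gt_atTop 1] with q hq
    have : 0 < q ^ α τ := by positivity
    exact ⟨hq, by linarith⟩
  -- Both quantities are positive and their sum is 1 - x.
  have hJE : ∀ᶠ q : ℝ in atTop, firstVar α q (-q ^ α τ) ≤ 1 ∧ denom α q (-q ^ α τ) ≤ 1 := by
    filter_upwards [hev] with q ⟨hq, hneg⟩
    have h : IsOff α q (-q ^ α τ) := Or.inl (by linarith)
    have h1 := firstVar_pos hα hq hneg
    have h2 := h.denom_pos hα hq hneg.ne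
    rw [denom] at h2 ⊢
    have := Real.exp_pos (-logMoment α q (-q ^ α τ))
    constructor <;> linarith
  have h1le : ∀ ε : ℝ, 0 < ε → ∀ᶠ q : ℝ in atTop, (1 : ℝ) ≤ 1 * q ^ (0 + ε) := by
    intro ε hε
    filter_upwards [eventually_ge_atTop 1] with q hq
    rw [one_mul]
    exact Real.one_le_rpow hq (by linarith)
  have limJ : Tendsto (fun q => Real.logb q (firstVar α q (-q ^ α τ))) atTop (𝓝 0) := by
    refine tendsto_logb_of_le_of_le (fun ε hε => ?_) fun ε hε => ⟨1, ?_⟩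
    · obtain ⟨c, hc, h⟩ := exists_le_firstVar_denom hα hN hτ hε
      exact ⟨c, hc, h.mono fun q h => h.1⟩
    · filter_upwards [hJE, h1le ε hε] with q h1 h2 using h1.1.trans h2
  have limE : Tendsto (fun q => Real.logb q (denom α q (-q ^ α τ))) atTop (𝓝 0) := by
    refine tendsto_logb_of_le_of_le (fun ε hε => ?_) fun ε hε => ⟨1, ?_⟩
    · obtain ⟨c, hc, h⟩ := exists_le_firstVar_denom hα hN hτ hε
      exact ⟨c, hc, h.mono fun q h => h.2⟩
    · filter_upwards [hJE, h1le ε hε] with q h1 h2 using h1.2.trans h2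
  have limP := tendsto_integral_weight hα hτ
  have hexp : ∀ᶠ q : ℝ in atTop, Real.exp (logMoment α q (-q ^ α τ)) =
      q ^ (∫ u in (0 : ℝ)..1, weight α q (-q ^ α τ) u) := by
    filter_upwards [eventually_gt_atTop 0] with q hq
    rw [Real.rpow_def_of_pos hq (∫ u in (0 : ℝ)..1, weight α q (-q ^ α τ) u), logMoment, cumWeight]
  have limN : Tendsto (fun q => Real.logb q (numer α q (-q ^ α τ))) atTop (𝓝 τ) := by
    refine tendsto_logb_of_le_of_le (fun ε hε => ⟨1 / 2, by norm_num, ?_⟩) fun ε hε => ⟨1, ?_⟩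
    · filter_upwards [hexp, hJE, eventually_gt_atTop 1,
        limP.eventually_const_lt (by linarith : τ - ε < τ),
        limP.eventually_const_lt (half_lt_self hτ.1),
        (tendsto_rpow_atTop (half_pos hτ.1)).eventually_ge_atTop 4] with q k1 k2 hq k3 k4 k5
      have m1 := Real.rpow_le_rpow_of_exponent_le hq.le k3.le
      have m2 := Real.rpow_le_rpow_of_exponent_le hq.le k4.le
      rw [numer, k1]
      linarith [k2.1]
    · filter_upwards [hexp, hev, limP.eventually_lt_const (by linarith : τ < τ + ε)]
        with q k1 k2 k3
      have m1 := Real.rpow_le_rpow_of_exponent_le k2.1.le k3.le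
      rw [numer, k1]
      linarith [firstVar_pos hα k2.1 k2.2]
  refine Tendsto.prodMk_nhds ?_ ?_
  · have := (tendsto_const_nhds (x := α τ)).add (limJ.sub limE)
    rw [sub_zero, add_zero] at this
    refine this.congr' ?_
    filter_upwards [hev] with q ⟨hq, hneg⟩
    have h : IsOff α q (-q ^ α τ) := Or.inl (by linarith)
    rw [h.arcticExpX_eq hα hq hneg.ne, ← neg_mul, neg_neg, Real.logb_div
      (mul_pos (by linarith) (firstVar_pos hα hq hneg)).ne' (h.denom_pos hα hq hneg.ne).ne',
      Real.logb_mul (by linarith) (firstVar_pos hα hq hneg).ne', Real.logb_rpow (by linarith) hq.ne']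
    ring
  · have := limN.sub limE
    rw [sub_zero] at this
    refine this.congr' ?_
    filter_upwards [hev] with q ⟨hq, hneg⟩
    have h : IsOff α q (-q ^ α τ) := Or.inl (by linarith)
    rw [h.arcticExpY_eq hα hq hneg.ne, Real.logb_div (h.numer_pos hα hq hneg.ne).ne'
      (h.denom_pos hα hq hneg.ne).ne']

theorem dist_le_of_abs_le {x y : ℝ × ℝ} {ε : ℝ} (h1 : |x.1 - y.1| ≤ ε) (h2 : |x.2 - y.2| ≤ ε) :
    dist x y ≤ ε := by
  rw [Prod.dist_eq, Real.dist_eq, Real.dist_eq]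
  exact max_le h1 h2

theorem logb_arcticExpX_antitoneOn (hα : IsGlobalProfile α) (hq : 1 < q) :
    AntitoneOn (fun t => Real.logb q (arcticExpX α q t)) (Iio 0) := fun a ha b hb hab => by
  have h : IsOff α q b := Or.inl ((mem_Iio.1 hb).trans one_pos)
  exact Real.logb_le_logb_of_le hq (h.arcticExpX_pos hα hq (mem_Iio.1 hb).ne)
    (arcticExpX_antitoneOn_Iio hα hq ha hb hab)

theorem logb_arcticExpY_antitoneOn (hα : IsGlobalProfile α) (hq : 1 < q) :
    AntitoneOn (fun t => Real.logb q (arcticExpY α q t)) (Iio 0) := fun a ha b hb hab => by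
  have h : IsOff α q b := Or.inl ((mem_Iio.1 hb).trans one_pos)
  exact Real.logb_le_logb_of_le hq (h.arcticExpY_pos hα hq (mem_Iio.1 hb).ne)
    (arcticExpY_antitoneOn_Iio hα hq ha hb hab)

theorem eventually_logb_le_one_add {ε : ℝ} (hε : 0 < ε) :
    ∀ᶠ q : ℝ in atTop, ∀ y : ℝ, 0 < y → y ≤ 8 * q → Real.logb q y ≤ 1 + ε := by
  filter_upwards [eventually_const_mul_rpow_le (C := 8) (a := 1) (b := 1 + ε) (by linarith),
    eventually_gt_atTop 1] with q h1 hq y hy0 hy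
  rw [Real.rpow_one] at h1
  rw [Real.logb_le_iff_le_rpow hq hy0]
  exact hy.trans h1

theorem mem_closure_image_Ioo {f : ℝ → ℝ × ℝ} (hf : Continuous f) :
    f '' Icc 0 1 ⊆ closure (f '' Ioo 0 1) := by
  rw [← closure_Ioo (zero_ne_one)]
  exact image_closure_subset_closure_image hf

theorem leftRange_of_one_lt (hq : 1 < q) : t ∈ leftRange q ↔ t < 1 := by
  simp [leftRange, hq, hq.not_gt]

theorem rightRange_of_one_lt (hq : 1 < q) : t ∈ rightRange α q ↔ q ^ α 1 < t := by
  simp [rightRange, hq, hq.not_gt]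

/-- For t < 0 between two fixed parameters τ₀ and τ₁ the convergence is uniform by monotonicity.
Beyond them the point is squeezed between its value at τ₀ or τ₁ and the bounds valid for all t, so
it stays near an end of the curve. For 0 < t < 1 it is near the origin. -/
theorem hausdorffTendsto_leftPart_atTop (hα : IsGlobalProfile α) (hN : NoFilledInterval α) :
    HausdorffTendsto (leftPart α) atTop ((fun τ : ℝ => (α τ, τ)) '' Icc 0 1) := by
  have hcont : Continuous fun τ : ℝ => (α τ, τ) := hα.continuous.prodMk continuous_id
  have hneg : ∀ q : ℝ, 1 < q → ∀ τ, -q ^ α τ < 0 := fun q hq τ => by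
    have : 0 < q ^ α τ := by positivity
    linarith
  refine hausdorffTendsto_of_forall (isCompact_Icc.image hcont) (mem_closure_image_Ioo hcont) ?_ ?_
  · intro ε hε
    have hη : 0 < ε / 4 := by positivity
    obtain ⟨τ₀, h0m, h0a, h0⟩ : ∃ τ ∈ Ioo (0 : ℝ) 1, α τ < ε / 4 ∧ τ < ε / 4 := by
      have h1 : Tendsto α (𝓝[>] 0) (𝓝 0) := by
        have := hα.continuous.tendsto 0
        rw [hα.zero] at this
        exact this.mono_left nhdsWithin_le_nhds
      have h2 : ∀ᶠ δ : ℝ in 𝓝[>] 0, δ < min 1 (ε / 4) :=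
        (eventually_lt_nhds (by positivity)).filter_mono nhdsWithin_le_nhds
      obtain ⟨τ, k1, k2, k3⟩ := ((h1.eventually_lt_const hη).and (h2.and self_mem_nhdsWithin)).exists
      exact ⟨τ, ⟨k3, k2.trans_le (min_le_left _ _)⟩, k1, k2.trans_le (min_le_right _ _)⟩
    obtain ⟨τ₁, h1m, h1a, h1⟩ : ∃ τ ∈ Ioo (0 : ℝ) 1, α 1 - ε / 4 < α τ ∧ 1 - ε / 4 < τ := by
      have h1 : Tendsto α (𝓝[<] 1) (𝓝 (α 1)) := (hα.continuous.tendsto 1).mono_left nhdsWithin_le_nhds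
      have h2 : ∀ᶠ δ : ℝ in 𝓝[<] 1, max 0 (1 - ε / 4) < δ :=
        (eventually_gt_nhds (max_lt one_pos (by linarith))).filter_mono nhdsWithin_le_nhds
      obtain ⟨τ, k1, k2, k3⟩ := ((h1.eventually_const_lt (by linarith : α 1 - ε / 4 < α 1)).and
        (h2.and self_mem_nhdsWithin)).exists
      exact ⟨τ, ⟨(le_max_left _ _).trans_lt k2, k3⟩, k1, (le_max_right _ _).trans_lt k2⟩
    have hrange : ∀ q : ℝ, 1 < q → MapsTo (fun τ => -q ^ α τ) (Ioo 0 1) (Iio 0) :=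
      fun q hq τ _ => hneg q hq τ
    have hanti : ∀ q : ℝ, 1 < q → AntitoneOn (fun τ => -q ^ α τ) (Ioo 0 1) :=
      fun q hq a ha b hb hab => neg_le_neg (Real.rpow_le_rpow_of_exponent_le hq.le
        (hα.increasing.monotoneOn (Ioo_subset_Icc_self ha) (Ioo_subset_Icc_self hb) hab))
    have hlim := fun τ hτ => tendsto_arcticPoint_neg_rpow hα hN (τ := τ) hτ
    have uX := eventually_forall_abs_sub_le_of_monotoneOn (l := atTop)
      (f := fun q τ => Real.logb q (arcticExpX α q (-q ^ α τ))) (h := α) (c := τ₀) (d := τ₁) h0m.1 h1m.2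
      (by
        filter_upwards [eventually_gt_atTop 1] with q hq
        exact (logb_arcticExpX_antitoneOn hα hq).comp (hanti q hq) (hrange q hq))
      hα.continuous.continuousOn (fun τ hτ => (Prod.tendsto_iff _ _ |>.1 (hlim τ hτ)).1) hη
    have uY := eventually_forall_abs_sub_le_of_monotoneOn (l := atTop)
      (f := fun q τ => Real.logb q (arcticExpY α q (-q ^ α τ))) (h := id) (c := τ₀) (d := τ₁) h0m.1 h1m.2
      (by
        filter_upwards [eventually_gt_atTop 1] with q hq
        exact (logb_arcticExpY_antitoneOn hα hq).comp (hanti q hq) (hrange q hq))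
      continuous_id.continuousOn (fun τ hτ => (Prod.tendsto_iff _ _ |>.1 (hlim τ hτ)).2) hη
    have lX := fun τ hτ => (Prod.tendsto_iff _ _ |>.1 (hlim τ hτ)).1
    have lY := fun τ hτ => (Prod.tendsto_iff _ _ |>.1 (hlim τ hτ)).2
    filter_upwards [uX, uY, eventually_logb_le_of_pos hα hN hη, eventually_logb_le_one_add hη,
      eventually_ge_atTop 12, (lX τ₀ h0m).eventually_lt_const (by linarith : α τ₀ < α τ₀ + ε / 4),
      (lY τ₀ h0m).eventually_lt_const (by linarith : τ₀ < τ₀ + ε / 4),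
      (lX τ₁ h1m).eventually_const_lt (by linarith : α τ₁ - ε / 4 < α τ₁),
      (lY τ₁ h1m).eventually_const_lt (by linarith : τ₁ - ε / 4 < τ₁)]
      with q uX uY upos hlog hq12 x0 y0 x1 y1
    have hq : 1 < q := by linarith
    rintro _ ⟨t, ⟨ht, ht0⟩, rfl⟩
    rw [leftRange_of_one_lt hq] at ht
    have ht0 : t ≠ 0 := ht0
    have hoff : IsOff α q t := Or.inl ht
    have hX0 : 0 ≤ Real.logb q (arcticExpX α q t) :=
      Real.logb_nonneg hq (one_le_arcticExpX hα hq ht0 ht)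
    have hY0 : 0 ≤ Real.logb q (arcticExpY α q t) :=
      Real.logb_nonneg hq (hoff.one_le_arcticExpY hα hq ht0)
    have near0 : Real.logb q (arcticExpX α q t) ≤ ε / 2 → Real.logb q (arcticExpY α q t) ≤ ε / 2 →
        ∃ y ∈ (fun τ : ℝ => (α τ, τ)) '' Icc 0 1, dist (arcticPoint α q t) y ≤ ε := by
      intro k1 k2
      refine ⟨_, ⟨0, ⟨le_rfl, zero_le_one⟩, rfl⟩, dist_le_of_abs_le ?_ ?_⟩
      · simp only [arcticPoint, hα.zero]
        rw [abs_le]; constructor <;> linarith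
      · simp only [arcticPoint]
        rw [abs_le]; constructor <;> linarith
    rcases lt_or_gt_of_ne ht0 with htn | htp
    · have hX1 : Real.logb q (arcticExpX α q t) ≤ α 1 := by
        rw [Real.logb_le_iff_le_rpow hq (hoff.arcticExpX_pos hα hq ht0)]
        exact arcticExpX_le_of_neg hα hq htn
      have hY1 := hlog _ (hoff.arcticExpY_pos hα hq ht0) (arcticExpY_le_of_neg hα hq12 htn)
      rcases le_total (-q ^ α τ₀) t with hc | hc
      · have k1 := logb_arcticExpX_antitoneOn hα hq (hneg q hq τ₀) htn hc
        have k2 := logb_arcticExpY_antitoneOn hα hq (hneg q hq τ₀) htn hc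
        simp only [arcticPoint] at k1 k2 x0 y0
        exact near0 (by linarith) (by linarith)
      rcases le_total t (-q ^ α τ₁) with hd | hd
      · have k1 := logb_arcticExpX_antitoneOn hα hq htn (hneg q hq τ₁) hd
        have k2 := logb_arcticExpY_antitoneOn hα hq htn (hneg q hq τ₁) hd
        simp only [arcticPoint] at k1 k2 x1 y1
        refine ⟨_, ⟨1, ⟨zero_le_one, le_rfl⟩, rfl⟩, dist_le_of_abs_le ?_ ?_⟩
        · simp only [arcticPoint]
          rw [abs_le]; constructor <;> linarith
        · simp only [arcticPoint]
          rw [abs_le]; constructor <;> linarith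
      · have h01 : τ₀ ≤ τ₁ := by
          by_contra hcon
          have hlt := hα.increasing (Ioo_subset_Icc_self h1m) (Ioo_subset_Icc_self h0m) (not_le.1 hcon)
          have := Real.rpow_lt_rpow_of_exponent_lt hq hlt
          linarith
        obtain ⟨τ, hτ, hτt : -q ^ α τ = t⟩ := intermediate_value_Icc' h01
          ((hα.continuous_rpow hq).neg.continuousOn) ⟨hd, hc⟩
        refine ⟨_, ⟨τ, ⟨h0m.1.le.trans hτ.1, hτ.2.trans h1m.2.le⟩, rfl⟩, dist_le_of_abs_le ?_ ?_⟩
        · have := uX τ hτ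
          rw [hτt] at this
          simp only [arcticPoint]
          linarith
        · have := uY τ hτ
          rw [hτt] at this
          simp only [arcticPoint]
          simp only [id] at this
          linarith
    · have := upos t ⟨htp, ht⟩
      exact near0 (by linarith [this.1]) (by linarith [this.2])
  · rintro _ ⟨τ, hτ, rfl⟩
    refine ⟨fun q => arcticPoint α q (-q ^ α τ), ?_, tendsto_arcticPoint_neg_rpow hα hN hτ⟩
    filter_upwards [eventually_gt_atTop 1] with q hq
    refine mem_image_of_mem _ ⟨?_, (hneg q hq τ).ne⟩
    rw [leftRange_of_one_lt hq]
    linarith [hneg q hq τ]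

/-! ### The right part as `q → ∞` -/

/-- The integral of q^α over the last δ of the interval is already of order q^(α(1) - ε/2). -/
theorem eventually_sub_le_logb_arcticExpX (hα : IsGlobalProfile α) {ε : ℝ} (hε : 0 < ε) :
    ∀ᶠ q : ℝ in atTop, ∀ t, q ^ α 1 < t → α 1 - ε ≤ Real.logb q (arcticExpX α q t) := by
  obtain ⟨δ, hδ0, hδ1, hδ⟩ : ∃ δ : ℝ, 0 < δ ∧ δ ≤ 1 ∧ α 1 - ε / 2 ≤ α (1 - δ) := by
    have h1 : Tendsto (fun δ : ℝ => α (1 - δ)) (𝓝[>] 0) (𝓝 (α 1)) := by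
      have : Tendsto (fun δ : ℝ => α (1 - δ)) (𝓝 0) (𝓝 (α (1 - 0))) :=
        (hα.continuous.comp (continuous_const.sub continuous_id)).tendsto 0
      rw [sub_zero] at this
      exact this.mono_left nhdsWithin_le_nhds
    have h2 : ∀ᶠ δ : ℝ in 𝓝[>] 0, δ < 1 :=
      (eventually_lt_nhds one_pos).filter_mono nhdsWithin_le_nhds
    obtain ⟨δ, k1, k2, k3⟩ := ((h1.eventually_const_lt (by linarith : α 1 - ε / 2 < α 1)).and
      (h2.and self_mem_nhdsWithin)).exists
    exact ⟨δ, k3, k2.le, k1.le⟩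
  filter_upwards [eventually_const_mul_rpow_le (C := 2 / δ) (a := α 1 - ε) (b := α 1 - ε / 2)
    (by linarith), Real.tendsto_log_atTop.eventually_ge_atTop 1, eventually_gt_atTop 1]
    with q hC hL hq t ht
  have h : IsOff α q t := Or.inr ht
  have ht0 : t ≠ 0 := (lt_trans (by positivity) ht).ne'
  rw [Real.le_logb_iff_rpow_le hq (h.arcticExpX_pos hα hq ht0)]
  refine le_trans ?_ (le_arcticExpX_of_gt hα hq ht)
  have h1 := mul_le_integral_of_le (hα.continuous_rpow hq) (fun u _ => by positivity)
    (sub_nonneg.2 hδ1) (by linarith) le_rfl (m := q ^ (α 1 - ε / 2)) (fun u hu =>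
      Real.rpow_le_rpow_of_exponent_le hq.le (hδ.trans (hα.increasing.monotoneOn
        ⟨sub_nonneg.2 hδ1, by linarith⟩ ⟨(sub_nonneg.2 hδ1).trans hu.1, hu.2⟩ hu.1)))
  rw [sub_sub_cancel] at h1
  have h2 : 0 ≤ ∫ u in (0 : ℝ)..1, q ^ α u := le_trans (by positivity) h1
  have h3 : 2 / δ * q ^ (α 1 - ε) * (δ / 2) = q ^ (α 1 - ε) := by
    field_simp
  have h4 := mul_le_mul_of_nonneg_right hC (by positivity : 0 ≤ δ / 2)
  nlinarith

/-- All points of the right part are close to the vertical segment. -/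
theorem eventually_right_mem (hα : IsGlobalProfile α) {ε : ℝ} (hε : 0 < ε) :
    ∀ᶠ q : ℝ in atTop, ∀ t, q ^ α 1 < t → |(arcticPoint α q t).1 - α 1| ≤ ε ∧
      0 ≤ (arcticPoint α q t).2 ∧ (arcticPoint α q t).2 ≤ 1 + ε := by
  filter_upwards [eventually_sub_le_logb_arcticExpX hα hε, eventually_logb_le_one_add hε,
    eventually_ge_atTop 2] with q h1 h2 hq2 t ht
  have hq : 1 < q := by linarith
  have h : IsOff α q t := Or.inr ht
  have ht0 : t ≠ 0 := (lt_trans (by positivity) ht).ne'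
  simp only [arcticPoint]
  refine ⟨?_, Real.logb_nonneg hq (h.one_le_arcticExpY hα hq ht0),
    h2 _ (h.arcticExpY_pos hα hq ht0) (arcticExpY_le_of_gt hα hq2 ht)⟩
  have h3 : Real.logb q (arcticExpX α q t) ≤ α 1 := by
    rw [Real.logb_le_iff_le_rpow hq (h.arcticExpX_pos hα hq ht0)]
    exact arcticExpX_le_of_gt hα hq ht
  have h4 := h1 t ht
  rw [abs_le]
  constructor <;> linarith

/-! ### Asymptotics at a right end of given slope -/

theorem one_sub_le_sub (hα : IsStartingProfile α) {u : ℝ} (hu : u ∈ Icc (0 : ℝ) 1) :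
    1 - u ≤ α 1 - α u := by
  have := hα.monotoneOn_sub hu (right_mem_Icc.2 zero_le_one) hu.2
  simp only at this
  linarith

theorem exists_slope_bounds {a η : ℝ} (ha : HasDerivWithinAt α a (Icc 0 1) 1) (hη : 0 < η) :
    ∃ δ : ℝ, 0 < δ ∧ δ ≤ 1 ∧ ∀ u ∈ Icc (1 - δ) 1,
      (a - η) * (1 - u) ≤ α 1 - α u ∧ α 1 - α u ≤ (a + η) * (1 - u) := by
  have h1 := (hasDerivWithinAt_iff_isLittleO.1 ha).bound hη
  obtain ⟨δ, hδ, hsub⟩ := Metric.mem_nhdsWithin_iff.1 h1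
  refine ⟨min (δ / 2) 1, by positivity, min_le_right _ _, fun u hu => ?_⟩
  have h2 := hu.1
  have h3 : min (δ / 2) 1 ≤ δ / 2 := min_le_left _ _
  have h4 : min (δ / 2) 1 ≤ 1 := min_le_right _ _
  have h5 := hsub ⟨by
    rw [Metric.mem_ball, Real.dist_eq, abs_lt]
    constructor <;> linarith [hu.2], ⟨by linarith, hu.2⟩⟩
  simp only [mem_ofPred_eq, smul_eq_mul, Real.norm_eq_abs] at h5
  rw [abs_of_nonpos (by linarith [hu.2] : u - 1 ≤ 0)] at h5
  have h6 := abs_le.1 h5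
  constructor <;> linarith [h6.1, h6.2]

theorem one_le_of_hasDerivWithinAt (hα : IsStartingProfile α) {a : ℝ}
    (ha : HasDerivWithinAt α a (Icc 0 1) 1) : 1 ≤ a := by
  refine le_of_forall_pos_le_add fun η hη => ?_
  obtain ⟨δ, hδ, hδ1, h⟩ := exists_slope_bounds ha hη
  have h1 := (h (1 - δ) ⟨le_rfl, by linarith⟩).2
  have h2 := one_sub_le_sub hα (u := 1 - δ) ⟨by linarith, by linarith⟩
  have h3 : δ * 1 ≤ δ * (a + η) := by linarith
  exact le_of_mul_le_mul_left h3 hδ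

/-- An exact primitive: this is the integral of the weight when the profile is linear of slope b
near 1. -/
theorem integral_inv_one_sub_mul_rpow (hq : 1 < q) {b c δ : ℝ} (hb : 0 < b) (hδ : 0 ≤ δ)
    (hc : c < 1) :
    ∫ u in (1 - δ)..1, (1 - c * q ^ (-(b * (1 - u))))⁻¹ =
      (Real.log (q ^ (b * δ) - c) - Real.log (1 - c)) / (b * Real.log q) := by
  have hq0 : 0 < q := by linarith
  have hL := Real.log_pos hq
  have hcont : Continuous fun u : ℝ => q ^ (b * (1 - u)) :=
    continuous_const.rpow (by fun_prop) fun _ => Or.inl hq0.ne'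
  have hcont' : Continuous fun u : ℝ => q ^ (-(b * (1 - u))) :=
    continuous_const.rpow (by fun_prop) fun _ => Or.inl hq0.ne'
  have hu1 : ∀ u ∈ uIcc (1 - δ) 1, 1 ≤ q ^ (b * (1 - u)) := by
    intro u hu
    rw [uIcc_of_le (by linarith)] at hu
    exact Real.one_le_rpow hq.le (mul_nonneg hb.le (by linarith [hu.2]))
  have hinv : ∀ u : ℝ, q ^ (-(b * (1 - u))) = (q ^ (b * (1 - u)))⁻¹ := fun u => Real.rpow_neg hq0.le _
  have hne : ∀ u ∈ uIcc (1 - δ) 1, 1 - c * q ^ (-(b * (1 - u))) ≠ 0 := by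
    intro u hu h0
    have h1 := hu1 u hu
    have h2 : 0 < q ^ (b * (1 - u)) := by positivity
    rw [hinv] at h0
    field_simp at h0
    linarith
  rw [intervalIntegral.integral_eq_sub_of_hasDerivAt
    (f := fun u => -(Real.log (q ^ (b * (1 - u)) - c) / (b * Real.log q)))]
  · simp only [sub_self, mul_zero, Real.rpow_zero, sub_sub_cancel]
    ring
  · intro u hu
    have h0 := hu1 u hu
    have h1 : HasDerivAt (fun u => b * (1 - u)) (b * (-1)) u :=
      ((hasDerivAt_id u).const_sub 1).const_mul b
    have h2 := (((h1.const_rpow hq0).sub_const c).log (by linarith)).div_const (b * Real.log q)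
    refine h2.neg.congr_deriv ?_
    have h3 := hne u hu
    have h4 : q ^ (b * (1 - u)) - c ≠ 0 := by linarith
    rw [hinv] at h3 ⊢
    have h5 : q ^ (b * (1 - u)) ≠ 0 := by linarith
    field_simp
  · refine ContinuousOn.intervalIntegrable ?_
    exact (continuous_const.sub (continuous_const.mul hcont')).continuousOn.inv₀ hne

/-- The parameter is chosen so that the weight at u = 1 equals q^ρ. -/
theorem weight_right (hq : 1 < q) {ρ : ℝ} (hρ : 0 < ρ) (α : ℝ → ℝ) (u : ℝ) :
    weight α q (q ^ α 1 / (1 - q ^ (-ρ))) u = (1 - (1 - q ^ (-ρ)) * q ^ (-(α 1 - α u)))⁻¹ := by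
  have hq0 : 0 < q := by linarith
  have h1 : q ^ (-ρ) < 1 := Real.rpow_lt_one_of_one_lt_of_neg hq (by linarith)
  have h2 : q ^ α u = q ^ (-(α 1 - α u)) * q ^ α 1 := by
    rw [← Real.rpow_add hq0]; ring_nf
  have h3 : 0 < q ^ α 1 := by positivity
  have h4 : 1 - q ^ (-ρ) ≠ 0 := by linarith
  rw [weight, h2, div_sub' h4, div_div_div_cancel_right₀ h4, ← one_div, ← mul_assoc,
    show q ^ α 1 - (1 - q ^ (-ρ)) * q ^ (-(α 1 - α u)) * q ^ α 1 =
      (1 - (1 - q ^ (-ρ)) * q ^ (-(α 1 - α u))) * q ^ α 1 by ring,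
    div_mul_cancel_right₀ h3.ne', one_div]

theorem lt_right (hq : 1 < q) {ρ : ℝ} (hρ : 0 < ρ) (α : ℝ → ℝ) :
    q ^ α 1 < q ^ α 1 / (1 - q ^ (-ρ)) := by
  have hq0 : 0 < q := by linarith
  have h1 : q ^ (-ρ) < 1 := Real.rpow_lt_one_of_one_lt_of_neg hq (by linarith)
  have h2 : 0 < q ^ (-ρ) := by positivity
  have h3 : 0 < q ^ α 1 := by positivity
  rw [lt_div_iff₀ (by linarith)]
  nlinarith

/-- Away from u = 1 the weight tends to 1, giving total mass 1. The excess ρ/a concentrates at u =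
1: there α is trapped between lines of slopes a ± η, for which the integral over [1 - δ, 1] is
explicit and close to δ + ρ/(a ± η). -/
theorem tendsto_integral_weight_right (hα : IsGlobalProfile α) {a ρ : ℝ}
    (ha : HasDerivWithinAt α a (Icc 0 1) 1) (hρ : 0 < ρ) :
    Tendsto (fun q => ∫ u in (0 : ℝ)..1, weight α q (q ^ α 1 / (1 - q ^ (-ρ))) u) atTop
      (𝓝 (1 + ρ / a)) := by
  have ha1 := one_le_of_hasDerivWithinAt hα.toIsStartingProfile ha
  have key : ∀ η : ℝ, 0 < η → η < 1 → ∀ᶠ q in atTop,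
      1 + ρ / (a + η) - η ≤ ∫ u in (0 : ℝ)..1, weight α q (q ^ α 1 / (1 - q ^ (-ρ))) u ∧
      ∫ u in (0 : ℝ)..1, weight α q (q ^ α 1 / (1 - q ^ (-ρ))) u ≤ 1 + ρ / (a - η) + η := by
    intro η hη hη1
    obtain ⟨δ, hδ, hδ1, hsl⟩ := exists_slope_bounds ha hη
    have hlog : Tendsto (fun q : ℝ => Real.log 2 / ((a + η) * Real.log q)) atTop (𝓝 0) :=
      tendsto_const_nhds.div_atTop (Real.tendsto_log_atTop.const_mul_atTop (by linarith))
    have hinv : Tendsto (fun q : ℝ => (1 - q ^ (-δ))⁻¹) atTop (𝓝 1) := by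
      have := ((tendsto_rpow_neg_atTop hδ).const_sub 1).inv₀ (by norm_num)
      simpa using this
    have hap : 0 < a + η := by linarith
    filter_upwards [hlog.eventually_lt_const hη, hinv.eventually_lt_const (by linarith : 1 < 1 + η),
      (tendsto_rpow_atTop (mul_pos hap hδ)).eventually_ge_atTop 2,
      eventually_gt_atTop 1] with q k1 k2 k3 hq
    have hq0 : 0 < q := by linarith
    have hL := Real.log_pos hq
    have hκ1 : q ^ (-ρ) < 1 := Real.rpow_lt_one_of_one_lt_of_neg hq (by linarith)
    have hκ0 : 0 < q ^ (-ρ) := by positivity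
    have hgt := lt_right hq hρ α
    have h : IsOff α q (q ^ α 1 / (1 - q ^ (-ρ))) := Or.inr hgt
    have hcw := h.continuous_weight hα hq
    have hlogκ : Real.log (1 - (1 - q ^ (-ρ))) = -(ρ * Real.log q) := by
      rw [sub_sub_cancel, Real.log_rpow hq0]; ring
    have hsplit := intervalIntegral.integral_add_adjacent_intervals (μ := MeasureTheory.volume)
      (hcw.intervalIntegrable 0 (1 - δ)) (hcw.intervalIntegrable (1 - δ) 1)
    have hw := one_lt_weight hα hq hgt
    have hint : ∀ b : ℝ, 0 ≤ b → IntervalIntegrable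
        (fun u : ℝ => (1 - (1 - q ^ (-ρ)) * q ^ (-(b * (1 - u))))⁻¹) MeasureTheory.volume (1 - δ) 1 := by
      intro b hb
      have hcont' : Continuous fun u : ℝ => q ^ (-(b * (1 - u))) :=
        continuous_const.rpow (by fun_prop) fun _ => Or.inl hq0.ne'
      refine ContinuousOn.intervalIntegrable ?_
      refine (continuous_const.sub (continuous_const.mul hcont')).continuousOn.inv₀ fun u hu h0 => ?_
      change 1 - (1 - q ^ (-ρ)) * q ^ (-(b * (1 - u))) = 0 at h0
      rw [uIcc_of_le (by linarith)] at hu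
      have h1 : q ^ (-(b * (1 - u))) ≤ 1 := Real.rpow_le_one_of_one_le_of_nonpos hq.le
        (by have := mul_nonneg hb (sub_nonneg.2 hu.2); linarith)
      have h2 : 0 < q ^ (-(b * (1 - u))) := by positivity
      nlinarith
    have hcmp : ∀ x y : ℝ, 0 ≤ x → x ≤ y → (1 - (1 - q ^ (-ρ)) * q ^ (-y))⁻¹ ≤
        (1 - (1 - q ^ (-ρ)) * q ^ (-x))⁻¹ := by
      intro x y hx hxy
      have h1 : q ^ (-y) ≤ q ^ (-x) := Real.rpow_le_rpow_of_exponent_le hq.le (by linarith)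
      have h2 : q ^ (-x) ≤ 1 := Real.rpow_le_one_of_one_le_of_nonpos hq.le (by linarith)
      exact inv_anti₀ (by nlinarith) (by nlinarith)
    have hsl0 : ∀ u ∈ Icc (1 - δ) 1, 0 ≤ α 1 - α u := fun u hu =>
      le_trans (by linarith [hu.2]) (one_sub_le_sub hα.toIsStartingProfile ⟨by linarith [hu.1], hu.2⟩)
    constructor
    · have i1 : (1 - δ) * 1 ≤ ∫ u in (0 : ℝ)..(1 - δ), weight α q (q ^ α 1 / (1 - q ^ (-ρ))) u := by
        have : ∫ _ in (0 : ℝ)..(1 - δ), (1 : ℝ) ≤ _ := intervalIntegral.integral_mono_on (by linarith)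
          intervalIntegrable_const (hcw.intervalIntegrable 0 (1 - δ)) fun u _ => (hw u).le
        simpa using this
      have i2 : (Real.log (q ^ ((a + η) * δ) - (1 - q ^ (-ρ))) + ρ * Real.log q) /
          ((a + η) * Real.log q) ≤
          ∫ u in (1 - δ)..1, weight α q (q ^ α 1 / (1 - q ^ (-ρ))) u := by
        have := integral_inv_one_sub_mul_rpow hq hap hδ.le (by linarith : 1 - q ^ (-ρ) < 1)
        rw [hlogκ, sub_neg_eq_add] at this
        rw [← this]
        refine intervalIntegral.integral_mono_on (by linarith) (hint _ hap.le)
          (hcw.intervalIntegrable _ _) fun u hu => ?_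
        rw [weight_right hq hρ]
        exact hcmp _ _ (hsl0 u hu) (hsl u hu).2
      have i3 : (a + η) * δ * Real.log q - Real.log 2 ≤
          Real.log (q ^ ((a + η) * δ) - (1 - q ^ (-ρ))) := by
        rw [← Real.log_rpow hq0, ← Real.log_div (by positivity) (by norm_num)]
        exact Real.log_le_log (by positivity) (by linarith)
      have i4 : δ + ρ / (a + η) - Real.log 2 / ((a + η) * Real.log q) ≤
          (Real.log (q ^ ((a + η) * δ) - (1 - q ^ (-ρ))) + ρ * Real.log q) /
          ((a + η) * Real.log q) := by
        have : δ + ρ / (a + η) - Real.log 2 / ((a + η) * Real.log q) =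
            ((a + η) * δ * Real.log q - Real.log 2 + ρ * Real.log q) / ((a + η) * Real.log q) := by
          field_simp
          ring
        rw [this]
        gcongr
      linarith
    · have i1 : ∫ u in (0 : ℝ)..(1 - δ), weight α q (q ^ α 1 / (1 - q ^ (-ρ))) u ≤
          (1 - δ) * (1 + η) := by
        have : _ ≤ ∫ _ in (0 : ℝ)..(1 - δ), (1 + η) := intervalIntegral.integral_mono_on (by linarith)
          (hcw.intervalIntegrable 0 (1 - δ)) intervalIntegrable_const fun u hu => by
            refine le_trans ?_ k2.le
            rw [weight_right hq hρ]
            have h1 := one_sub_le_sub hα.toIsStartingProfile (u := u) ⟨hu.1, by linarith [hu.2]⟩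
            have h2 : q ^ (-(α 1 - α u)) ≤ q ^ (-δ) :=
              Real.rpow_le_rpow_of_exponent_le hq.le (by linarith [hu.2])
            have h3 : q ^ (-δ) < 1 := Real.rpow_lt_one_of_one_lt_of_neg hq (by linarith)
            have h4 : 0 < q ^ (-(α 1 - α u)) := by positivity
            exact inv_anti₀ (by linarith) (by nlinarith)
        simp only [intervalIntegral.integral_const, sub_zero, smul_eq_mul] at this
        exact this
      have ham : 0 < a - η := by linarith
      have i2 : ∫ u in (1 - δ)..1, weight α q (q ^ α 1 / (1 - q ^ (-ρ))) u ≤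
          (Real.log (q ^ ((a - η) * δ) - (1 - q ^ (-ρ))) + ρ * Real.log q) /
          ((a - η) * Real.log q) := by
        have := integral_inv_one_sub_mul_rpow hq ham hδ.le (by linarith : 1 - q ^ (-ρ) < 1)
        rw [hlogκ, sub_neg_eq_add] at this
        rw [← this]
        refine intervalIntegral.integral_mono_on (by linarith)
          (hcw.intervalIntegrable _ _) (hint _ ham.le) fun u hu => ?_
        rw [weight_right hq hρ]
        exact hcmp _ _ (mul_nonneg ham.le (by linarith [hu.2])) (hsl u hu).1
      have i3 : Real.log (q ^ ((a - η) * δ) - (1 - q ^ (-ρ))) ≤ (a - η) * δ * Real.log q := by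
        rw [← Real.log_rpow hq0]
        have : 1 ≤ q ^ ((a - η) * δ) := Real.one_le_rpow hq.le (by positivity)
        exact Real.log_le_log (by linarith) (by linarith)
      have i4 : (Real.log (q ^ ((a - η) * δ) - (1 - q ^ (-ρ))) + ρ * Real.log q) /
          ((a - η) * Real.log q) ≤ δ + ρ / (a - η) := by
        have : δ + ρ / (a - η) =
            ((a - η) * δ * Real.log q + ρ * Real.log q) / ((a - η) * Real.log q) := by
          field_simp
        rw [this]
        gcongr
      nlinarith
  have hη1 : ∀ᶠ η : ℝ in 𝓝[>] 0, η < 1 :=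
    (eventually_lt_nhds one_pos).filter_mono nhdsWithin_le_nhds
  rw [tendsto_order]
  constructor
  · intro c hc
    have hl : Tendsto (fun η : ℝ => 1 + ρ / (a + η) - η) (𝓝[>] 0) (𝓝 (1 + ρ / a)) := by
      have : ContinuousAt (fun η : ℝ => 1 + ρ / (a + η) - η) 0 := by
        have : a + 0 ≠ 0 := by linarith
        fun_prop (disch := assumption)
      have h := this.tendsto
      simp only [add_zero, sub_zero] at h
      exact h.mono_left nhdsWithin_le_nhds
    obtain ⟨η, h1, h2, h3⟩ := ((hl.eventually_const_lt hc).and (hη1.and self_mem_nhdsWithin)).exists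
    exact (key η h3 h2).mono fun q hq => h1.trans_le hq.1
  · intro c hc
    have hl : Tendsto (fun η : ℝ => 1 + ρ / (a - η) + η) (𝓝[>] 0) (𝓝 (1 + ρ / a)) := by
      have : ContinuousAt (fun η : ℝ => 1 + ρ / (a - η) + η) 0 := by
        have : a - 0 ≠ 0 := by linarith
        fun_prop (disch := assumption)
      have h := this.tendsto
      simp only [add_zero, sub_zero] at h
      exact h.mono_left nhdsWithin_le_nhds
    obtain ⟨η, h1, h2, h3⟩ := ((hl.eventually_lt_const hc).and (hη1.and self_mem_nhdsWithin)).exists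
    exact (key η h3 h2).mono fun q hq => hq.2.trans_lt h1

/-- On a window of width q^(-ρ) at the right end the weight is at least of order q^ρ / log q, so p(p
- 1) integrates to at least q^ρ / (log q)² up to constants. The logarithms are absorbed by q^(-ε);
the crude slope bound a + 1 suffices. -/
theorem eventually_le_neg_firstVar_right (hα : IsGlobalProfile α) {a ρ : ℝ}
    (ha : HasDerivWithinAt α a (Icc 0 1) 1) (hρ : 0 < ρ) {ε : ℝ} (hε : 0 < ε) :
    ∀ᶠ q in atTop, 1 / (8 * (a + 1) ^ 2) * q ^ (ρ - ε) ≤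
      -firstVar α q (q ^ α 1 / (1 - q ^ (-ρ))) := by
  have ha1 := one_le_of_hasDerivWithinAt hα.toIsStartingProfile ha
  obtain ⟨δ, hδ, hδ1, hsl⟩ := exists_slope_bounds ha one_pos
  have hlogo : ∀ η : ℝ, 0 < η → ∀ᶠ q : ℝ in atTop, Real.log q ≤ q ^ η := by
    intro η hη
    filter_upwards [(isLittleO_log_rpow_atTop hη).bound one_pos, eventually_ge_atTop 1] with q h hq
    rw [one_mul, Real.norm_eq_abs, Real.norm_eq_abs, abs_of_nonneg (Real.log_nonneg hq),
      abs_of_nonneg (by positivity)] at h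
    exact h
  filter_upwards [hlogo ε hε, hlogo (ρ / 2) (half_pos hρ),
    eventually_const_mul_rpow_le (C := 4 * (a + 1)) (half_lt_self hρ),
    (tendsto_rpow_neg_atTop hρ).eventually_lt_const (by positivity : 0 < min δ (1 / 2)),
    Real.tendsto_log_atTop.eventually_ge_atTop 1, eventually_gt_atTop 1] with q k1 k2 k3 k4 hL hq
  have hq0 : 0 < q := by linarith
  have hgt := lt_right hq hρ α
  have h : IsOff α q (q ^ α 1 / (1 - q ^ (-ρ))) := Or.inr hgt
  have hcw := h.continuous_weight hα hq
  have hw := one_lt_weight hα hq hgt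
  have hκδ := k4.trans_le (min_le_left _ _)
  have hκ2 := k4.trans_le (min_le_right _ _)
  have hκ : q ^ (-ρ) = (q ^ ρ)⁻¹ := Real.rpow_neg hq0.le ρ
  set L := Real.log q
  set R := q ^ ρ with hR
  have hR0 : 0 < R := by positivity
  have hRL : 4 * (a + 1) * L ≤ R :=
    (mul_le_mul_of_nonneg_left k2 (by linarith)).trans k3
  have hp : ∀ u ∈ Icc (1 - q ^ (-ρ)) 1,
      R / (2 * (a + 1) * L) ≤ weight α q (q ^ α 1 / (1 - q ^ (-ρ))) u := by
    intro u hu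
    have h1 := (hsl u ⟨by linarith [hu.1], hu.2⟩).2
    have h2 : α 1 - α u ≤ (a + 1) * q ^ (-ρ) :=
      h1.trans (mul_le_mul_of_nonneg_left (by linarith [hu.1]) (by linarith))
    have h3 : 1 - L * ((a + 1) * q ^ (-ρ)) ≤ q ^ (-(α 1 - α u)) := by
      rw [Real.rpow_def_of_pos hq0 (-(α 1 - α u))]
      have h4 := Real.add_one_le_exp (Real.log q * (-(α 1 - α u)))
      have h5 := mul_le_mul_of_nonneg_left h2 (by linarith : 0 ≤ L)
      change Real.log q * _ ≤ Real.log q * _ at h5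
      linarith
    have h0 : 0 ≤ α 1 - α u := sub_nonneg.2 (hα.mem_Icc u).2
    have h6 : q ^ (-(α 1 - α u)) ≤ 1 := Real.rpow_le_one_of_one_le_of_nonpos hq.le (by linarith)
    have hκ0 : 0 < q ^ (-ρ) := by positivity
    rw [weight_right hq hρ, ← inv_div]
    refine inv_anti₀ (by nlinarith) ?_
    rw [div_eq_mul_inv, ← hκ]
    have h7 : (1 : ℝ) ≤ (a + 1) * L := by nlinarith
    nlinarith [mul_le_mul_of_nonneg_right h7 hκ0.le,
      mul_le_mul_of_nonneg_left h6 hκ0.le]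
  have h2 : (2 : ℝ) ≤ R / (2 * (a + 1) * L) := by
    rw [le_div_iff₀ (by positivity)]
    linarith
  have h1 := mul_le_integral_of_le (f := fun u => -(weight α q (q ^ α 1 / (1 - q ^ (-ρ))) u *
    (1 - weight α q (q ^ α 1 / (1 - q ^ (-ρ))) u))) (by fun_prop)
    (fun u _ => by nlinarith [hw u]) (a := 1 - q ^ (-ρ)) (b := 1)
    (m := R ^ 2 / (8 * (a + 1) ^ 2 * L ^ 2)) (by linarith)
    (by have : 0 < q ^ (-ρ) := by positivity
        linarith) le_rfl (fun u hu => by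
      have h3 := hp u hu
      have h4 : R ^ 2 / (8 * (a + 1) ^ 2 * L ^ 2) =
        (R / (2 * (a + 1) * L)) * (R / (2 * (a + 1) * L)) / 2 := by
          field_simp
          norm_num
      rw [h4]
      nlinarith)
  rw [intervalIntegral.integral_neg, sub_sub_cancel] at h1
  rw [firstVar, ← mul_neg]
  have h5 := mul_le_mul_of_nonneg_left h1 (by linarith : 0 ≤ L)
  refine le_trans ?_ h5
  have e1 : L * (q ^ (-ρ) * (R ^ 2 / (8 * (a + 1) ^ 2 * L ^ 2))) =
      1 / (8 * (a + 1) ^ 2) * (R / L) := by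
    rw [hκ]
    field_simp
  rw [e1]
  refine mul_le_mul_of_nonneg_left ?_ (by positivity)
  rw [le_div_iff₀ (by linarith), Real.rpow_sub hq0, div_mul_eq_mul_div, div_le_iff₀ (by positivity)]
  exact mul_le_mul_of_nonneg_left k1 hR0.le

theorem neg_firstVar_le_right (hα : IsGlobalProfile α) (hq : 1 < q) (ht : q ^ α 1 < t) :
    -firstVar α q t ≤ (weight α q t 1 - 1) * (1 - Real.exp (-logMoment α q t)) := by
  have := (weightSigns_of_gt hα hq ht).firstVar_le (Or.inr ht) hα hq
  linarith

/-- E has order q^ρ because -J lies between a multiple of q^(ρ - ε) and q^ρ. N is the sum of e^P, of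
order q^(1 + ρ/a), and of -J, up to a constant; the maximum in the limit records which of the two
wins. -/
theorem tendsto_logb_arcticExpY_right (hα : IsGlobalProfile α) {a ρ : ℝ}
    (ha : HasDerivWithinAt α a (Icc 0 1) 1) (hρ : 0 < ρ) :
    Tendsto (fun q => Real.logb q (arcticExpY α q (q ^ α 1 / (1 - q ^ (-ρ))))) atTop
      (𝓝 (max (1 - ρ * (1 - 1 / a)) 0)) := by
  have ha1 := one_le_of_hasDerivWithinAt hα.toIsStartingProfile ha
  have hc : 0 < 1 / (8 * (a + 1) ^ 2) := by positivity
  have limP := tendsto_integral_weight_right hα ha hρ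
  have hexp : ∀ᶠ q : ℝ in atTop, Real.exp (logMoment α q (q ^ α 1 / (1 - q ^ (-ρ)))) =
      q ^ (∫ u in (0 : ℝ)..1, weight α q (q ^ α 1 / (1 - q ^ (-ρ))) u) := by
    filter_upwards [eventually_gt_atTop 0] with q hq
    rw [Real.rpow_def_of_pos hq (∫ u in (0 : ℝ)..1, weight α q (q ^ α 1 / (1 - q ^ (-ρ))) u),
      logMoment, cumWeight]
  have hx : ∀ᶠ q : ℝ in atTop, Real.exp (-logMoment α q (q ^ α 1 / (1 - q ^ (-ρ)))) < 1 := by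
    filter_upwards [eventually_gt_atTop 1] with q hq
    exact exp_neg_logMoment_lt_one (weightSigns_of_gt hα hq (lt_right hq hρ α))
      (Or.inr (lt_right hq hρ α)) hα hq
  have hK : ∀ᶠ q : ℝ in atTop, -firstVar α q (q ^ α 1 / (1 - q ^ (-ρ))) ≤ q ^ ρ := by
    filter_upwards [eventually_gt_atTop 1, hx] with q hq hx
    refine (neg_firstVar_le_right hα hq (lt_right hq hρ α)).trans ?_
    have e : weight α q (q ^ α 1 / (1 - q ^ (-ρ))) 1 = q ^ ρ := by
      rw [weight_right hq hρ, sub_self, neg_zero, Real.rpow_zero, mul_one, sub_sub_cancel,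
        Real.rpow_neg (by linarith), inv_inv]
    rw [e]
    have h1 := Real.exp_pos (-logMoment α q (q ^ α 1 / (1 - q ^ (-ρ))))
    have h2 : 1 ≤ q ^ ρ := Real.one_le_rpow hq.le hρ.le
    nlinarith
  have limE : Tendsto (fun q => Real.logb q (denom α q (q ^ α 1 / (1 - q ^ (-ρ))))) atTop (𝓝 ρ) := by
    refine tendsto_logb_of_le_of_le (fun ε hε => ⟨_, hc, ?_⟩) fun ε hε => ⟨2, ?_⟩
    · filter_upwards [eventually_le_neg_firstVar_right hα ha hρ hε, hx] with q h1 h2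
      rw [denom]
      linarith
    · filter_upwards [hK, eventually_gt_atTop 1] with q h1 hq
      have h2 : q ^ ρ ≤ q ^ (ρ + ε) := Real.rpow_le_rpow_of_exponent_le hq.le (by linarith)
      have h3 : 1 ≤ q ^ ρ := Real.one_le_rpow hq.le hρ.le
      rw [denom]
      linarith [Real.exp_pos (-logMoment α q (q ^ α 1 / (1 - q ^ (-ρ))))]
  have limN : Tendsto (fun q => Real.logb q (numer α q (q ^ α 1 / (1 - q ^ (-ρ))))) atTop
      (𝓝 (max (1 + ρ / a) ρ)) := by
    have hP1 : 1 < 1 + ρ / a := by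
      have : 0 < ρ / a := by positivity
      linarith
    refine tendsto_logb_of_le_of_le (fun ε hε => ⟨min (1 / 2) (1 / (8 * (a + 1) ^ 2)),
      lt_min (by norm_num) hc, ?_⟩) fun ε hε => ⟨2, ?_⟩
    · filter_upwards [eventually_le_neg_firstVar_right hα ha hρ hε, hexp,
        limP.eventually_const_lt (by linarith : 1 + ρ / a - ε < 1 + ρ / a),
        limP.eventually_const_lt hP1, eventually_ge_atTop 2] with q h1 h2 h3 h4 hq2
      have hq : 1 < q := by linarith
      have m1 := Real.rpow_le_rpow_of_exponent_le hq.le h3.le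
      have m2 := Real.rpow_le_rpow_of_exponent_le hq.le h4.le
      have m3 : 0 < q ^ (ρ - ε) := by positivity
      have m4 : 0 < q ^ (1 + ρ / a - ε) := by positivity
      have m5 : 0 < 1 / (8 * (a + 1) ^ 2) * q ^ (ρ - ε) := by positivity
      rw [Real.rpow_one] at m2
      rw [numer, h2]
      rcases le_total (1 + ρ / a) ρ with hm | hm
      · rw [max_eq_right hm]
        have := mul_le_mul_of_nonneg_right
          (min_le_right (1 / 2) (1 / (8 * (a + 1) ^ 2))) m3.le
        linarith
      · rw [max_eq_left hm]
        have := mul_le_mul_of_nonneg_right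
          (min_le_left (1 / 2) (1 / (8 * (a + 1) ^ 2))) m4.le
        linarith
    · filter_upwards [hK, hexp, limP.eventually_lt_const (by linarith : 1 + ρ / a < 1 + ρ / a + ε),
        eventually_gt_atTop 1] with q h1 h2 h3 hq
      have m1 : q ^ (∫ u in (0 : ℝ)..1, weight α q (q ^ α 1 / (1 - q ^ (-ρ))) u) ≤
          q ^ (max (1 + ρ / a) ρ + ε) := Real.rpow_le_rpow_of_exponent_le hq.le
        (h3.le.trans (by linarith [le_max_left (1 + ρ / a) ρ]))
      have m2 : q ^ ρ ≤ q ^ (max (1 + ρ / a) ρ + ε) := Real.rpow_le_rpow_of_exponent_le hq.le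
        (by linarith [le_max_right (1 + ρ / a) ρ])
      rw [numer, h2]
      linarith
  have hlim := limN.sub limE
  have e : max (1 + ρ / a) ρ - ρ = max (1 - ρ * (1 - 1 / a)) 0 := by
    rw [← max_sub_sub_right, sub_self]
    congr 1
    ring
  rw [e] at hlim
  refine hlim.congr' ?_
  filter_upwards [eventually_gt_atTop 1] with q hq
  have hgt := lt_right hq hρ α
  have h : IsOff α q (q ^ α 1 / (1 - q ^ (-ρ))) := Or.inr hgt
  have h0 : q ^ α 1 / (1 - q ^ (-ρ)) ≠ 0 := (lt_trans (by positivity) hgt).ne'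
  rw [h.arcticExpY_eq hα hq h0, Real.logb_div (h.numer_pos hα hq h0).ne' (h.denom_pos hα hq h0).ne']

theorem tendsto_arcticPoint_right (hα : IsGlobalProfile α) {a ρ : ℝ}
    (ha : HasDerivWithinAt α a (Icc 0 1) 1) (hρ : 0 < ρ) :
    Tendsto (fun q => arcticPoint α q (q ^ α 1 / (1 - q ^ (-ρ)))) atTop
      (𝓝 (α 1, max (1 - ρ * (1 - 1 / a)) 0)) := by
  refine Tendsto.prodMk_nhds ?_ (tendsto_logb_arcticExpY_right hα ha hρ)
  rw [Metric.tendsto_nhds]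
  intro ε hε
  filter_upwards [eventually_right_mem hα (half_pos hε), eventually_gt_atTop 1] with q h hq
  have := (h _ (lt_right hq hρ α)).1
  simp only [arcticPoint] at this
  rw [Real.dist_eq]
  linarith

theorem hausdorffTendsto_rightPart_atTop (hα : IsGlobalProfile α) {a : ℝ}
    (ha : HasDerivWithinAt α a (Icc 0 1) 1) (ha1 : 1 < a) :
    HausdorffTendsto (rightPart α) atTop (segment ℝ (α 1, 0) (α 1, 1)) := by
  have hcont : Continuous fun y : ℝ => (α 1, y) := continuous_const.prodMk continuous_id
  rw [← Prod.image_mk_segment_right, segment_eq_Icc zero_le_one]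
  refine hausdorffTendsto_of_forall (isCompact_Icc.image hcont) (mem_closure_image_Ioo hcont) ?_ ?_
  · intro ε hε
    filter_upwards [eventually_right_mem hα hε, eventually_gt_atTop 1] with q h hq
    rintro _ ⟨t, ⟨ht, -⟩, rfl⟩
    rw [rightRange_of_one_lt hq] at ht
    obtain ⟨h1, h2, h3⟩ := h t ht
    refine ⟨_, ⟨min (arcticPoint α q t).2 1, ⟨le_min h2 zero_le_one, min_le_right _ _⟩, rfl⟩,
      dist_le_of_abs_le h1 ?_⟩
    rcases le_total (arcticPoint α q t).2 1 with h4 | h4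
    · simp only [min_eq_left h4, sub_self, abs_zero]
      exact hε.le
    · simp only [min_eq_right h4]
      rw [abs_le]; constructor <;> linarith
  · rintro _ ⟨y, hy, rfl⟩
    have h1a : 0 < 1 - 1 / a := by
      rw [sub_pos, div_lt_one (by linarith)]
      exact ha1
    -- This ρ solves 1 - ρ(1 - 1/a) = y, which is possible because a > 1.
    have hρ : 0 < (1 - y) / (1 - 1 / a) := div_pos (by linarith [hy.2]) h1a
    refine ⟨fun q => arcticPoint α q (q ^ α 1 / (1 - q ^ (-((1 - y) / (1 - 1 / a))))), ?_, ?_⟩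
    · filter_upwards [eventually_gt_atTop 1] with q hq
      have hgt := lt_right hq hρ α
      exact mem_image_of_mem _ ⟨(rightRange_of_one_lt hq).2 hgt, (lt_trans (by positivity) hgt).ne'⟩
    · have := tendsto_arcticPoint_right hα ha hρ
      rwa [div_mul_cancel₀ _ h1a.ne', sub_sub_cancel, max_eq_left hy.1.le] at this

/-! ### A filled right end -/

/-- Near 1 the local constant works; at distance at least δ from 1 the left side is at most α(1),
which α(1)/δ² compensates. -/
theorem exists_sub_le_mul_sq (hα : IsGlobalProfile α)
    (hO : (fun u => α 1 - α u - (1 - u)) =O[𝓝[<] 1] (fun u : ℝ => (1 - u) ^ 2)) :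
    ∃ C : ℝ, 0 ≤ C ∧ ∀ u ∈ Icc (0 : ℝ) 1, α 1 - α u - (1 - u) ≤ C * (1 - u) ^ 2 := by
  obtain ⟨C, hC, hb⟩ := hO.exists_pos
  obtain ⟨δ, hδ, hsub⟩ := Metric.mem_nhdsWithin_iff.1 hb.bound
  refine ⟨max C (α 1 / δ ^ 2), hC.le.trans (le_max_left _ _), fun u hu => ?_⟩
  have hα1 : 0 ≤ α 1 := (hα.mem_Icc 1).1
  rcases hu.2.eq_or_lt with rfl | hu1
  · simp
  rcases lt_or_ge (1 - δ) u with h | h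
  · have h5 := hsub ⟨by
      rw [Metric.mem_ball, Real.dist_eq, abs_lt]
      constructor <;> linarith, hu1⟩
    simp only [mem_ofPred_eq, Real.norm_eq_abs] at h5
    rw [abs_of_nonneg (sq_nonneg (1 - u))] at h5
    exact (le_abs_self _).trans (h5.trans (mul_le_mul_of_nonneg_right (le_max_left _ _) (sq_nonneg _)))
  · have h1 : δ ^ 2 ≤ (1 - u) ^ 2 := by
      apply pow_le_pow_left₀ hδ.le
      linarith
    calc α 1 - α u - (1 - u) ≤ α 1 := by linarith [(hα.mem_Icc u).1]
      _ = α 1 / δ ^ 2 * δ ^ 2 := by field_simp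
      _ ≤ α 1 / δ ^ 2 * (1 - u) ^ 2 := by gcongr
      _ ≤ _ := mul_le_mul_of_nonneg_right (le_max_right _ _) (sq_nonneg _)

/-- With t/s = e^(2z), (t - s)²/(ts) = (2 sinh z)² ≥ (2z)², and y ≤ 2z. -/
theorem mul_mul_log_sq_le {s t y : ℝ} (hs : 0 < s) (hy : 0 ≤ y) (hst : s * Real.exp y ≤ t) :
    t * s * y ^ 2 ≤ (t - s) ^ 2 := by
  have ht : 0 < t := (by positivity : 0 < s * Real.exp y).trans_le hst
  set z := Real.log (t / s) / 2 with hz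
  have h1 : y ≤ 2 * z := by
    rw [hz, mul_div_cancel₀ _ two_ne_zero, Real.le_log_iff_exp_le (by positivity), le_div_iff₀ hs]
    linarith
  have h2 : t = s * Real.exp z ^ 2 := by
    rw [← Real.exp_nat_mul, hz, Nat.cast_ofNat, mul_div_cancel₀ _ two_ne_zero,
      Real.exp_log (by positivity)]
    field_simp
  have h3 : z ≤ Real.sinh z := Real.self_le_sinh_iff.2 (by linarith)
  rw [Real.sinh_eq, Real.exp_neg] at h3
  set E := Real.exp z
  have hE : 0 < E := Real.exp_pos _
  have h4 : y ≤ E - E⁻¹ := by linarith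
  have h5 : y ^ 2 ≤ (E - E⁻¹) ^ 2 := pow_le_pow_left₀ hy h4 2
  calc t * s * y ^ 2 ≤ t * s * (E - E⁻¹) ^ 2 := mul_le_mul_of_nonneg_left h5 (by positivity)
    _ = (t - s) ^ 2 := by
      rw [h2]
      field_simp

theorem integral_div_sub_rpow (hq : 1 < q) {c : ℝ} (ht : q ^ c < t) :
    ∫ u in (0 : ℝ)..1, Real.log q * (t / (t - q ^ (c - (1 - u)))) =
      Real.log q + Real.log (t - q ^ (c - 1)) - Real.log (t - q ^ c) := by
  have hq0 : 0 < q := by linarith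
  have hcont : Continuous fun u : ℝ => q ^ (c - (1 - u)) :=
    continuous_const.rpow (by fun_prop) fun _ => Or.inl hq0.ne'
  have hlt : ∀ u ∈ uIcc (0 : ℝ) 1, 0 < t - q ^ (c - (1 - u)) := by
    intro u hu
    rw [uIcc_of_le zero_le_one] at hu
    have : q ^ (c - (1 - u)) ≤ q ^ c := Real.rpow_le_rpow_of_exponent_le hq.le (by linarith [hu.2])
    linarith
  rw [intervalIntegral.integral_eq_sub_of_hasDerivAt
    (f := fun u => Real.log q * u - Real.log (t - q ^ (c - (1 - u))))]
  · simp only [sub_self, sub_zero, mul_one, mul_zero]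
    ring
  · intro u hu
    have h0 := (hlt u hu).ne'
    have h1 : HasDerivAt (fun u : ℝ => c - (1 - u)) (-(-1)) u :=
      ((hasDerivAt_id u).const_sub 1).const_sub c
    have h2 := (((h1.const_rpow hq0).const_sub t).log h0)
    refine (((hasDerivAt_id u).const_mul (Real.log q)).sub h2).congr_deriv ?_
    field_simp
    ring
  · refine ContinuousOn.intervalIntegrable ?_
    exact continuousOn_const.mul (continuousOn_const.div
      (continuous_const.sub hcont).continuousOn fun u hu => (hlt u hu).ne')

/-- Replacing α by the line of slope 1 through its right end changes P by at most C, uniformly in q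
and t: the quadratic error, multiplied by (log q)², is controlled by `mul_mul_log_sq_le`. For the
line, e^P = q(t - Q/q)/(t - Q) with Q = q^α(1), and dividing by p(1) = t/(t - Q) leaves (qt - Q)/t ≥
q - 1. -/
theorem le_arcticExpY_of_gt (hα : IsGlobalProfile α) {C : ℝ} (hC : 0 ≤ C)
    (h : ∀ u ∈ Icc (0 : ℝ) 1, α 1 - α u - (1 - u) ≤ C * (1 - u) ^ 2) (hq : 1 < q)
    (ht : q ^ α 1 < t) : Real.exp (-C) * (q - 1) ≤ arcticExpY α q t := by
  have hq0 : 0 < q := by linarith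
  have hL := Real.log_pos hq
  have hoff : IsOff α q t := Or.inr ht
  have hQ : 0 < q ^ α 1 := by positivity
  have ht0 : 0 < t := hQ.trans ht
  have hcw := hoff.continuous_weight hα hq
  have hcont : Continuous fun u : ℝ => q ^ (α 1 - (1 - u)) :=
    continuous_const.rpow (by fun_prop) fun _ => Or.inl hq0.ne'
  have hlt : ∀ u ∈ uIcc (0 : ℝ) 1, 0 < t - q ^ (α 1 - (1 - u)) := by
    intro u hu
    rw [uIcc_of_le zero_le_one] at hu
    have : q ^ (α 1 - (1 - u)) ≤ q ^ α 1 := Real.rpow_le_rpow_of_exponent_le hq.le (by linarith [hu.2])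
    linarith
  have hi0 : IntervalIntegrable (fun u => Real.log q * (t / (t - q ^ (α 1 - (1 - u)))))
      MeasureTheory.volume 0 1 := by
    refine ContinuousOn.intervalIntegrable ?_
    exact continuousOn_const.mul (continuousOn_const.div
      (continuous_const.sub hcont).continuousOn fun u hu => (hlt u hu).ne')
  have hP : Real.log q + Real.log (t - q ^ (α 1 - 1)) - Real.log (t - q ^ α 1) - C ≤
      logMoment α q t := by
    rw [← integral_div_sub_rpow hq ht]
    have h1 : ∫ u in (0 : ℝ)..1, (Real.log q * (t / (t - q ^ (α 1 - (1 - u)))) - C) ≤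
        ∫ u in (0 : ℝ)..1, Real.log q * weight α q t u := by
      refine intervalIntegral.integral_mono_on zero_le_one (hi0.sub intervalIntegrable_const)
        (Continuous.intervalIntegrable (by fun_prop) _ _) fun u hu => ?_
      have hs0 : 0 < t - q ^ (α 1 - (1 - u)) := hlt u (by rwa [uIcc_of_le zero_le_one])
      have hs1 : 0 < t - q ^ α u := by linarith [hα.rpow_le hq u]
      have hu1 := h u hu
      have hu2 := one_sub_le_sub hα.toIsStartingProfile hu
      set s₀ := q ^ (α 1 - (1 - u)) with hs₀
      have hs0pos : 0 < s₀ := by positivity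
      set y := Real.log q * (1 - u) with hy
      have hy0 : 0 ≤ y := mul_nonneg hL.le (by linarith [hu.2])
      have hsle : q ^ α u ≤ s₀ := Real.rpow_le_rpow_of_exponent_le hq.le (by linarith)
      have hsge : s₀ - q ^ α u ≤ s₀ * (Real.log q * (C * (1 - u) ^ 2)) := by
        have e : q ^ α u = s₀ * Real.exp (-(Real.log q * (α 1 - α u - (1 - u)))) := by
          rw [hs₀, Real.rpow_def_of_pos hq0, Real.rpow_def_of_pos hq0, ← Real.exp_add]
          ring_nf
        have h2 := Real.add_one_le_exp (-(Real.log q * (α 1 - α u - (1 - u))))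
        have h3 := mul_le_mul_of_nonneg_left hu1 hL.le
        rw [e]
        nlinarith
      have hst : s₀ * Real.exp y ≤ t := by
        have : s₀ * Real.exp y = q ^ α 1 := by
          rw [hs₀, Real.rpow_def_of_pos hq0, Real.rpow_def_of_pos hq0, ← Real.exp_add, hy]
          ring_nf
        rw [this]
        exact ht.le
      have hkey := mul_mul_log_sq_le hs0pos hy0 hst
      have e2 : t / (t - s₀) - t / (t - q ^ α u) =
          t * (s₀ - q ^ α u) / ((t - s₀) * (t - q ^ α u)) := by
        field_simp
        ring
      have h4 : Real.log q * (t / (t - s₀) - t / (t - q ^ α u)) ≤ C := by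
        rw [e2, mul_div_assoc', div_le_iff₀ (mul_pos hs0 hs1)]
        calc Real.log q * (t * (s₀ - q ^ α u))
            ≤ Real.log q * (t * (s₀ * (Real.log q * (C * (1 - u) ^ 2)))) :=
              mul_le_mul_of_nonneg_left (mul_le_mul_of_nonneg_left hsge ht0.le) hL.le
          _ = C * (t * s₀ * y ^ 2) := by rw [hy]; ring
          _ ≤ C * (t - s₀) ^ 2 := mul_le_mul_of_nonneg_left hkey hC
          _ ≤ C * ((t - s₀) * (t - q ^ α u)) := by
              refine mul_le_mul_of_nonneg_left ?_ hC
              rw [pow_two]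
              exact mul_le_mul_of_nonneg_left (by linarith) hs0.le
      rw [weight]
      linarith
    rw [intervalIntegral.integral_sub hi0 intervalIntegrable_const,
      intervalIntegral.integral_const_mul _ (weight α q t)] at h1
    simpa [logMoment, cumWeight] using h1
  have hd1 : 0 < t - q ^ α 1 := by linarith
  have hQ1 : q ^ (α 1 - 1) = q ^ α 1 / q := by rw [Real.rpow_sub hq0, Real.rpow_one]
  have hQle : q ^ α 1 / q < q ^ α 1 := div_lt_self hQ hq
  have hd0 : 0 < t - q ^ (α 1 - 1) := by rw [hQ1]; linarith
  have hexpP : Real.exp (-C) * (q * (t - q ^ α 1 / q) / (t - q ^ α 1)) ≤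
      Real.exp (logMoment α q t) := by
    refine le_trans (le_of_eq ?_) (Real.exp_le_exp.2 hP)
    rw [sub_eq_add_neg _ C, Real.exp_add, Real.exp_sub, Real.exp_add, Real.exp_log hq0,
      Real.exp_log hd0, Real.exp_log hd1, hQ1]
    ring
  have hx1 := exp_neg_logMoment_lt_one (weightSigns_of_gt hα hq ht) hoff hα hq
  have hJ := neg_firstVar_le_right hα hq ht
  have hJ0 := firstVar_neg hoff hα hq ht0
  have hexp : Real.exp (logMoment α q t) * Real.exp (-logMoment α q t) = 1 := by
    rw [← Real.exp_add]; simp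
  have hY0 := Real.exp_pos (logMoment α q t)
  have hE0 := hoff.denom_pos hα hq ht0.ne'
  have hp1 := one_lt_weight hα hq ht 1
  -- Since -J ≤ (p(1) - 1)(1 - x), `denom` is at most p(1)(1 - x), while `numer` is at least e^P - 1
  -- = e^P(1 - x).
  have hB : Real.exp (logMoment α q t) / weight α q t 1 ≤ arcticExpY α q t := by
    rw [hoff.arcticExpY_eq hα hq ht0.ne', div_le_div_iff₀ (by linarith) hE0]
    have h1 : denom α q t ≤ weight α q t 1 * (1 - Real.exp (-logMoment α q t)) := by
      rw [denom]; linarith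
    have h2 : Real.exp (logMoment α q t) - 1 ≤ numer α q t := by rw [numer]; linarith
    calc Real.exp (logMoment α q t) * denom α q t
        ≤ Real.exp (logMoment α q t) * (weight α q t 1 * (1 - Real.exp (-logMoment α q t))) :=
          mul_le_mul_of_nonneg_left h1 hY0.le
      _ = (Real.exp (logMoment α q t) - 1) * weight α q t 1 := by
          linear_combination -weight α q t 1 * hexp
      _ ≤ numer α q t * weight α q t 1 := mul_le_mul_of_nonneg_right h2 (by linarith)
  refine le_trans ?_ hB
  rw [weight, div_div_eq_mul_div, le_div_iff₀ ht0]
  have h3 := mul_le_mul_of_nonneg_right hexpP hd1.le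
  refine le_trans ?_ h3
  rw [mul_assoc, mul_assoc, div_mul_cancel₀ _ hd1.ne']
  refine mul_le_mul_of_nonneg_left ?_ (Real.exp_pos _).le
  rw [mul_sub, mul_div_cancel₀ _ hq0.ne']
  linarith

theorem hausdorffTendsto_rightPart_atTop_singleton (hα : IsGlobalProfile α)
    (hO : (fun u => α 1 - α u - (1 - u)) =O[𝓝[<] 1] (fun u : ℝ => (1 - u) ^ 2)) :
    HausdorffTendsto (rightPart α) atTop {(α 1, 1)} := by
  obtain ⟨C, hC, hb⟩ := exists_sub_le_mul_sq hα hO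
  have key : ∀ ε : ℝ, 0 < ε → ∀ᶠ q : ℝ in atTop, ∀ t, q ^ α 1 < t →
      dist (arcticPoint α q t) (α 1, 1) ≤ ε := by
    intro ε hε
    filter_upwards [eventually_right_mem hα hε,
      eventually_const_mul_rpow_le (C := 2 * Real.exp C) (a := 1 - ε) (b := 1) (by linarith),
      eventually_ge_atTop 2] with q h1 h2 hq2 t ht
    have hq : 1 < q := by linarith
    obtain ⟨k1, k2, k3⟩ := h1 t ht
    refine dist_le_of_abs_le k1 ?_
    have hoff : IsOff α q t := Or.inr ht
    have ht0 : t ≠ 0 := (lt_trans (by positivity) ht).ne'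
    have k4 : 1 - ε ≤ (arcticPoint α q t).2 := by
      simp only [arcticPoint]
      rw [Real.le_logb_iff_rpow_le hq (hoff.arcticExpY_pos hα hq ht0)]
      refine le_trans ?_ (le_arcticExpY_of_gt hα hC hb hq ht)
      rw [Real.rpow_one] at h2
      rw [Real.exp_neg, le_inv_mul_iff₀ (Real.exp_pos C)]
      linarith
    rw [abs_le]
    constructor <;> linarith
  refine hausdorffTendsto_of_forall isCompact_singleton subset_closure ?_ ?_
  · intro ε hε
    filter_upwards [key ε hε, eventually_gt_atTop 1] with q h hq
    rintro _ ⟨t, ⟨ht, -⟩, rfl⟩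
    exact ⟨_, rfl, h t ((rightRange_of_one_lt hq).1 ht)⟩
  · rintro _ rfl
    refine ⟨fun q => arcticPoint α q (q ^ α 1 + 1), ?_, ?_⟩
    · filter_upwards [eventually_gt_atTop 1] with q hq
      have : 0 < q ^ α 1 := by positivity
      exact mem_image_of_mem _ ⟨(rightRange_of_one_lt hq).2 (by linarith),
        (by positivity : q ^ α 1 + 1 ≠ 0)⟩
    · rw [Metric.tendsto_nhds]
      intro ε hε
      filter_upwards [key _ (half_pos hε)] with q h
      exact (h _ (by linarith)).trans_lt (half_lt_self hε)

/-! ### Duality between `q` and `1 / q` -/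

/-- The profile read from its right end. -/
def dualProfile (α : ℝ → ℝ) (u : ℝ) : ℝ := α 1 - α (1 - u)

/-- The map of the plane that exchanges the arctic curves of a profile and of its dual. -/
def dualMap (α : ℝ → ℝ) (z : ℝ × ℝ) : ℝ × ℝ := (α 1 - z.1 + z.2, z.2)

theorem dualProfile_one (hα : IsStartingProfile α) : dualProfile α 1 = α 1 := by
  rw [dualProfile, sub_self, hα.zero, sub_zero]

theorem IsGlobalProfile.dual (hα : IsGlobalProfile α) : IsGlobalProfile (dualProfile α) where
  zero := by simp [dualProfile]
  increasing := by
    intro a ha b hb hab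
    have := hα.increasing (a := 1 - b) (b := 1 - a) ⟨by linarith [hb.2], by linarith [hb.1]⟩
      ⟨by linarith [ha.2], by linarith [ha.1]⟩ (by linarith)
    simp only [dualProfile]
    linarith
  continuousOn := (continuous_const.sub (hα.continuous.comp
    (continuous_const.sub continuous_id))).continuousOn
  continuous := continuous_const.sub (hα.continuous.comp (continuous_const.sub continuous_id))
  mem_Icc := by
    intro u
    rw [dualProfile_one hα.toIsStartingProfile, dualProfile]
    have := hα.mem_Icc (1 - u)
    constructor <;> linarith [this.1, this.2]
  piecewise := by
    obtain ⟨S, hS, hd⟩ := hα.piecewise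
    refine ⟨(fun u => 1 - u) '' S, hS.image _, fun u hu => ?_⟩
    obtain ⟨h1, h2⟩ := hd (1 - u) ⟨⟨by linarith [hu.1.2], by linarith [hu.1.1]⟩, fun h =>
      hu.2 ⟨1 - u, h, by ring⟩⟩
    have h3 : HasDerivAt (dualProfile α) (deriv α (1 - u)) u := by
      have h4 : HasDerivAt (fun u : ℝ => 1 - u) (-1) u := (hasDerivAt_id u).const_sub 1
      exact ((h1.hasDerivAt.comp u h4).const_sub (α 1)).congr_deriv (by ring)
    exact ⟨h3.differentiableAt, by rw [h3.deriv]; exact h2⟩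

theorem NoFilledInterval.dual (hN : NoFilledInterval α) : NoFilledInterval (dualProfile α) := by
  intro c d hc hcd hd
  obtain ⟨v, hv, hnd⟩ := hN (1 - d) (1 - c) (by linarith) (by linarith) (by linarith)
  refine ⟨1 - v, ⟨by linarith [hv.2], by linarith [hv.1]⟩, fun h => hnd ?_⟩
  have h4 : HasDerivAt (fun u : ℝ => 1 - u) (-1) v := (hasDerivAt_id v).const_sub 1
  have h5 := ((h.comp v h4).const_sub (α 1)).congr_deriv (by ring : -(1 * -1) = (1 : ℝ))
  refine h5.congr_of_eventuallyEq (Eventually.of_forall fun u => ?_)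
  simp [dualProfile]

theorem HasDerivWithinAt.dualProfile {a : ℝ} (h : HasDerivWithinAt α a (Icc 0 1) 0) :
    HasDerivWithinAt (dualProfile α) a (Icc 0 1) 1 := by
  have h4 : HasDerivWithinAt (fun u : ℝ => 1 - u) (-1) (Icc 0 1) 1 :=
    ((hasDerivAt_id (1 : ℝ)).const_sub 1).hasDerivWithinAt
  have h' : HasDerivWithinAt α a (Icc 0 1) (1 - 1) := by rwa [sub_self]
  have h5 := (h'.comp 1 h4 fun u hu => ⟨by linarith [hu.2], by linarith [hu.1]⟩).const_sub (α 1)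
  exact h5.congr_deriv (by ring)

theorem isBigO_dualProfile (hα : IsStartingProfile α)
    (h : (fun u => α u - u) =O[𝓝[>] 0] (fun u : ℝ => u ^ 2)) :
    (fun u => dualProfile α 1 - dualProfile α u - (1 - u)) =O[𝓝[<] 1]
      (fun u : ℝ => (1 - u) ^ 2) := by
  have ht : Tendsto (fun u : ℝ => 1 - u) (𝓝[<] 1) (𝓝[>] 0) := by
    refine tendsto_nhdsWithin_iff.2 ⟨?_, ?_⟩
    · have : Tendsto (fun u : ℝ => 1 - u) (𝓝 1) (𝓝 (1 - 1)) :=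
        (continuous_const.sub continuous_id).tendsto 1
      rw [sub_self] at this
      exact this.mono_left nhdsWithin_le_nhds
    · filter_upwards [self_mem_nhdsWithin] with u hu
      exact sub_pos.2 (mem_Iio.1 hu)
  refine (h.comp_tendsto ht).congr_left fun u => ?_
  rw [dualProfile_one hα, dualProfile]
  simp only [Function.comp]
  ring

/-- Substitute 1 - u for u and multiply numerator and denominator of the integrand by q^(-α(1)). The
integral is unchanged, and only the base q is inverted. -/
theorem momentGen_dual (hq : 0 < q) (α : ℝ → ℝ) (t : ℝ) :
    momentGen α q t = (momentGen (dualProfile α) q⁻¹ (t * q ^ (-α 1)))⁻¹ := by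
  rw [momentGen, momentGen, Real.inv_rpow hq.le, inv_inv]
  congr 1
  rw [neg_mul, neg_mul, neg_inj, ← intervalIntegral.integral_const_mul,
    ← intervalIntegral.integral_const_mul]
  have h1 := intervalIntegral.integral_comp_sub_left (a := 0) (b := 1)
    (fun u => t * (1 / (t - q ^ α u))) 1
  rw [sub_self, sub_zero] at h1
  rw [← h1]
  congr 1
  funext u
  have h2 : q⁻¹ ^ dualProfile α u = q ^ α (1 - u) * q ^ (-α 1) := by
    rw [Real.inv_rpow hq.le, ← Real.rpow_neg hq.le, dualProfile, ← Real.rpow_add hq]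
    ring_nf
  have h3 : q ^ (-α 1) ≠ 0 := by positivity
  rw [h2, ← sub_mul, mul_one_div, mul_one_div, mul_div_mul_right _ _ h3]

section

variable (hα : IsGlobalProfile α) (hq0 : 0 < q) (hq1 : q < 1)
  (h : IsOff (dualProfile α) q⁻¹ (t * q ^ (-α 1)))

include hα hq0 hq1 h

theorem differentiableAt_momentGen_dual : DifferentiableAt ℝ (momentGen α q) t := by
  have hq : 1 < q⁻¹ := (one_lt_inv₀ hq0).2 hq1
  have h1 := (h.hasDerivAt_momentGen hα.dual hq).1
  rw [show momentGen α q = fun t => (momentGen (dualProfile α) q⁻¹ (t * q ^ (-α 1)))⁻¹ from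
    funext (momentGen_dual hq0 α)]
  have h2 : DifferentiableAt ℝ (fun t : ℝ => t * q ^ (-α 1)) t := by fun_prop
  have h3 : DifferentiableAt ℝ (fun t => momentGen (dualProfile α) q⁻¹ (t * q ^ (-α 1))) t :=
    DifferentiableAt.comp (f := fun t : ℝ => t * q ^ (-α 1)) t h1 h2
  refine h3.inv ?_
  rw [momentGen_eq_exp (by linarith)]
  exact (Real.exp_pos _).ne'

/-- Passing from x to 1/x sends t x' to -t x'/x². Up to the common factor -1/x² this exchanges the
numerator of the equation for q^Y with the common denominator, so q^Y is inverted and q^X is divided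
by q^Y, up to the scaling of t. -/
theorem arcticExp_dual (ht : t ≠ 0) :
    arcticExpX α q t = q ^ α 1 * (arcticExpX (dualProfile α) q⁻¹ (t * q ^ (-α 1)) /
      arcticExpY (dualProfile α) q⁻¹ (t * q ^ (-α 1))) ∧
    arcticExpY α q t = (arcticExpY (dualProfile α) q⁻¹ (t * q ^ (-α 1)))⁻¹ := by
  have hq : 1 < q⁻¹ := (one_lt_inv₀ hq0).2 hq1
  have hc : q ^ (-α 1) ≠ 0 := by positivity
  have hY := h.arcticExpY_pos hα.dual hq (mul_ne_zero ht hc)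
  have hdiff := (h.hasDerivAt_momentGen hα.dual hq).1
  have hx : momentGen (dualProfile α) q⁻¹ (t * q ^ (-α 1)) ≠ 0 := by
    rw [momentGen_eq_exp (by linarith)]
    exact (Real.exp_pos _).ne'
  have hder : t * deriv (momentGen α q) t = -(t * q ^ (-α 1) *
      deriv (momentGen (dualProfile α) q⁻¹) (t * q ^ (-α 1))) /
      momentGen (dualProfile α) q⁻¹ (t * q ^ (-α 1)) ^ 2 := by
    have h1 : HasDerivAt (fun t : ℝ => t * q ^ (-α 1)) (1 * q ^ (-α 1)) t :=
      (hasDerivAt_id t).mul_const _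
    have h2 := (HasDerivAt.comp (h := fun t : ℝ => t * q ^ (-α 1)) t hdiff.hasDerivAt h1).inv
      (show (momentGen (dualProfile α) q⁻¹ ∘ fun t => t * q ^ (-α 1)) t ≠ 0 from hx)
    have h3 : momentGen α q = (momentGen (dualProfile α) q⁻¹ ∘ fun t => t * q ^ (-α 1))⁻¹ :=
      funext (momentGen_dual hq0 α)
    rw [h3, h2.deriv]
    simp only [Function.comp]
    ring
  have e : q ^ α 1 * q ^ (-α 1) = 1 := by rw [← Real.rpow_add hq0]; simp
  rw [arcticExpX.eq_1 α q t, arcticExpY.eq_1 α q t, pow_two t, mul_assoc t t, hder,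
    momentGen_dual hq0 α t]
  rw [arcticExpY] at hY ⊢
  rw [arcticExpX]
  set x := momentGen (dualProfile α) q⁻¹ (t * q ^ (-α 1))
  set s := t * q ^ (-α 1) with hs
  rw [pow_two s, mul_assoc s s]
  set y := s * deriv (momentGen (dualProfile α) q⁻¹) s
  have hD : y + x * (1 - x) ≠ 0 := fun h0 => by rw [h0, div_zero] at hY; exact lt_irrefl _ hY
  have hN : y + 1 - x ≠ 0 := fun h0 => by rw [h0, zero_div] at hY; exact lt_irrefl _ hY
  have d1 : -y / x ^ 2 + x⁻¹ * (1 - x⁻¹) = -(y + 1 - x) / x ^ 2 := by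
    field_simp
    ring
  have d2 : -y / x ^ 2 + 1 - x⁻¹ = -(y + x * (1 - x)) / x ^ 2 := by
    field_simp
    ring
  have hx2 : x ^ 2 ≠ 0 := pow_ne_zero 2 hx
  rw [d1, d2]
  constructor
  · rw [div_div_div_cancel_right₀ hD, mul_div_assoc', div_div_div_cancel_right₀ hx2, mul_neg,
      neg_div_neg_eq, mul_div_assoc', hs]
    congr 1
    linear_combination (-t * y) * e
  · rw [div_div_div_cancel_right₀ hx2, neg_div_neg_eq, inv_div]

theorem arcticExp_pos_dual (ht : t ≠ 0) : 0 < arcticExpX α q t ∧ 0 < arcticExpY α q t := by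
  have hq : 1 < q⁻¹ := (one_lt_inv₀ hq0).2 hq1
  have hc : q ^ (-α 1) ≠ 0 := by positivity
  have hX := h.arcticExpX_pos hα.dual hq (mul_ne_zero ht hc)
  have hY := h.arcticExpY_pos hα.dual hq (mul_ne_zero ht hc)
  rw [(arcticExp_dual hα hq0 hq1 h ht).1, (arcticExp_dual hα hq0 hq1 h ht).2]
  constructor <;> positivity

theorem arcticPoint_dual (ht : t ≠ 0) :
    arcticPoint α q t = dualMap α (arcticPoint (dualProfile α) q⁻¹ (t * q ^ (-α 1))) := by
  have hq : 1 < q⁻¹ := (one_lt_inv₀ hq0).2 hq1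
  have hc : q ^ (-α 1) ≠ 0 := by positivity
  have hX := h.arcticExpX_pos hα.dual hq (mul_ne_zero ht hc)
  have hY := h.arcticExpY_pos hα.dual hq (mul_ne_zero ht hc)
  obtain ⟨h1, h2⟩ := arcticExp_dual hα hq0 hq1 h ht
  rw [arcticPoint, h1, h2, dualMap, arcticPoint, Real.logb_inv, Real.logb_mul (by positivity)
    (by positivity), Real.logb_div hX.ne' hY.ne', Real.logb_rpow hq0 hq1.ne]
  simp only [Real.logb_inv_base]
  congr 1
  ring

end

theorem isOff_dual_of_one_lt (hα : IsStartingProfile α) (hq0 : 0 < q) (ht : 1 < t) :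
    (q⁻¹) ^ dualProfile α 1 < t * q ^ (-α 1) := by
  rw [dualProfile_one hα, Real.inv_rpow hq0.le, ← Real.rpow_neg hq0.le]
  exact lt_mul_of_one_lt_left (by positivity) ht

theorem isOff_dual_of_lt (hq0 : 0 < q) (ht : t < q ^ α 1) : t * q ^ (-α 1) < 1 := by
  rw [Real.rpow_neg hq0.le, ← div_eq_mul_inv, div_lt_one (by positivity)]
  exact ht

theorem leftRange_of_lt_one (hq : q < 1) : t ∈ leftRange q ↔ 1 < t := by
  simp [leftRange, hq, hq.not_gt]

theorem rightRange_of_lt_one (hq : q < 1) : t ∈ rightRange α q ↔ t < q ^ α 1 := by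
  simp [rightRange, hq, hq.not_gt]

theorem leftPart_dual (hα : IsGlobalProfile α) (hq0 : 0 < q) (hq1 : q < 1) :
    leftPart α q = dualMap α '' rightPart (dualProfile α) q⁻¹ := by
  have hq : 1 < q⁻¹ := (one_lt_inv₀ hq0).2 hq1
  have hc : 0 < q ^ (-α 1) := by positivity
  rw [leftPart, rightPart, image_image]
  ext z
  constructor
  · rintro ⟨t, ⟨ht, ht0⟩, rfl⟩
    have h1 := isOff_dual_of_one_lt hα.toIsStartingProfile hq0 ((leftRange_of_lt_one hq1).1 ht)
    exact ⟨t * q ^ (-α 1), ⟨(rightRange_of_one_lt hq).2 h1, mul_ne_zero ht0 hc.ne'⟩,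
      (arcticPoint_dual hα hq0 hq1 (Or.inr h1) ht0).symm⟩
  · rintro ⟨s, ⟨hs, hs0⟩, rfl⟩
    have e : s / q ^ (-α 1) * q ^ (-α 1) = s := div_mul_cancel₀ _ hc.ne'
    have h1 := (rightRange_of_one_lt hq).1 hs
    have ht0 : s / q ^ (-α 1) ≠ 0 := div_ne_zero hs0 hc.ne'
    have := arcticPoint_dual hα hq0 hq1 (t := s / q ^ (-α 1)) (by rw [e]; exact Or.inr h1) ht0
    rw [e] at this
    refine ⟨s / q ^ (-α 1), ⟨(leftRange_of_lt_one hq1).2 ?_, ht0⟩, this⟩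
    rw [dualProfile_one hα.toIsStartingProfile, Real.inv_rpow hq0.le, ← Real.rpow_neg hq0.le] at h1
    exact (one_lt_div hc).2 h1

theorem rightPart_dual (hα : IsGlobalProfile α) (hq0 : 0 < q) (hq1 : q < 1) :
    rightPart α q = dualMap α '' leftPart (dualProfile α) q⁻¹ := by
  have hq : 1 < q⁻¹ := (one_lt_inv₀ hq0).2 hq1
  have hc : 0 < q ^ (-α 1) := by positivity
  rw [leftPart, rightPart, image_image]
  ext z
  constructor
  · rintro ⟨t, ⟨ht, ht0⟩, rfl⟩
    have h1 := isOff_dual_of_lt hq0 ((rightRange_of_lt_one hq1).1 ht)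
    exact ⟨t * q ^ (-α 1), ⟨(leftRange_of_one_lt hq).2 h1, mul_ne_zero ht0 hc.ne'⟩,
      (arcticPoint_dual hα hq0 hq1 (Or.inl h1) ht0).symm⟩
  · rintro ⟨s, ⟨hs, hs0⟩, rfl⟩
    have e : s / q ^ (-α 1) * q ^ (-α 1) = s := div_mul_cancel₀ _ hc.ne'
    have h1 := (leftRange_of_one_lt hq).1 hs
    have ht0 : s / q ^ (-α 1) ≠ 0 := div_ne_zero hs0 hc.ne'
    have := arcticPoint_dual hα hq0 hq1 (t := s / q ^ (-α 1)) (by rw [e]; exact Or.inl h1) ht0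
    rw [e] at this
    refine ⟨s / q ^ (-α 1), ⟨(rightRange_of_lt_one hq1).2 ?_, ht0⟩, this⟩
    rw [Real.rpow_neg hq0.le, div_inv_eq_mul]
    exact mul_lt_of_lt_one_left (by positivity) h1

theorem lipschitzWith_dualMap (α : ℝ → ℝ) : LipschitzWith 2 (dualMap α) := by
  refine LipschitzWith.of_dist_le_mul fun x y => ?_
  have h1 : |x.1 - y.1| ≤ dist x y := by
    rw [← Real.dist_eq]; exact le_max_left _ _
  have h2 : |x.2 - y.2| ≤ dist x y := by
    rw [← Real.dist_eq]; exact le_max_right _ _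
  refine dist_le_of_abs_le ?_ ?_
  · simp only [dualMap]
    rw [show α 1 - x.1 + x.2 - (α 1 - y.1 + y.2) = (x.2 - y.2) - (x.1 - y.1) by ring]
    have := abs_sub (x.2 - y.2) (x.1 - y.1)
    push_cast
    linarith
  · simp only [dualMap]
    push_cast
    linarith [abs_nonneg (x.2 - y.2)]

theorem eventually_Ioo_nhdsGT_zero : ∀ᶠ q : ℝ in 𝓝[>] 0, 0 < q ∧ q < 1 := by
  filter_upwards [Ioo_mem_nhdsGT one_pos] with q hq using hq

/-- Inversion carries q → 0⁺ to q → ∞, and `dualMap` is Lipschitz, so convergence is transported. -/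
theorem HausdorffTendsto.dual {C D : ℝ → Set (ℝ × ℝ)} {K : Set (ℝ × ℝ)}
    (h : HausdorffTendsto C atTop K)
    (hD : ∀ q : ℝ, 0 < q → q < 1 → D q = dualMap α '' C q⁻¹) :
    HausdorffTendsto D (𝓝[>] 0) (dualMap α '' K) := by
  have h1 := h.image two_ne_zero (lipschitzWith_dualMap α)
  unfold HausdorffTendsto at h1 ⊢
  refine (h1.comp tendsto_inv_nhdsGT_zero).congr' ?_
  filter_upwards [eventually_Ioo_nhdsGT_zero] with q hq
  rw [hD q hq.1 hq.2]
  rfl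

theorem continuous_dualMap (α : ℝ → ℝ) : Continuous (dualMap α) :=
  (lipschitzWith_dualMap α).continuous

/-! ### The limit `q → 0` -/

theorem tendsto_arcticPoint_nhdsGT_zero {f : ℝ → ℝ} {g : ℝ → ℝ} {z : ℝ × ℝ}
    (hα : IsGlobalProfile α)
    (h : Tendsto (fun q => arcticPoint (dualProfile α) q (g q)) atTop (𝓝 z))
    (hf : ∀ q : ℝ, 0 < q → q < 1 → f q ≠ 0 ∧ f q * q ^ (-α 1) = g q⁻¹ ∧
      IsOff (dualProfile α) q⁻¹ (g q⁻¹)) :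
    Tendsto (fun q => arcticPoint α q (f q)) (𝓝[>] 0) (𝓝 (dualMap α z)) := by
  refine (((continuous_dualMap α).tendsto z).comp (h.comp tendsto_inv_nhdsGT_zero)).congr' ?_
  filter_upwards [eventually_Ioo_nhdsGT_zero] with q hq
  obtain ⟨h1, h2, h3⟩ := hf q hq.1 hq.2
  rw [arcticPoint_dual hα hq.1 hq.2 (by rw [h2]; exact h3) h1, h2]
  rfl

theorem tendsto_arcticPoint_neg_rpow_zero (hα : IsGlobalProfile α) (hN : NoFilledInterval α)
    {τ : ℝ} (hτ : τ ∈ Ioo (0 : ℝ) 1) :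
    Tendsto (fun q => arcticPoint α q (-q ^ α τ)) (𝓝[>] 0) (𝓝 (α τ + 1 - τ, 1 - τ)) := by
  have h := tendsto_arcticPoint_nhdsGT_zero (f := fun q => -q ^ α τ) hα
    -- After rescaling by q^(-α(1)), the parameter -q^α(τ) becomes the one attached to 1 - τ for the
    -- dual profile and base 1/q.
    (tendsto_arcticPoint_neg_rpow hα.dual hN.dual (τ := 1 - τ)
      ⟨by linarith [hτ.2], by linarith [hτ.1]⟩) fun q hq0 hq1 => by
        have h1 : 0 < q ^ α τ := by positivity
        refine ⟨by linarith, ?_, Or.inl ?_⟩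
        · rw [Real.inv_rpow hq0.le, ← Real.rpow_neg hq0.le, neg_mul, ← Real.rpow_add hq0, dualProfile,
            sub_sub_cancel]
          ring_nf
        · have : 0 < q⁻¹ ^ dualProfile α (1 - τ) := by positivity
          linarith
  have e : dualMap α (dualProfile α (1 - τ), 1 - τ) = (α τ + 1 - τ, 1 - τ) := by
    simp only [dualMap, dualProfile, sub_sub_cancel]
    congr 1
    ring
  rwa [e] at h

theorem hausdorffTendsto_rightPart_zero (hα : IsGlobalProfile α) (hN : NoFilledInterval α) :
    HausdorffTendsto (rightPart α) (𝓝[>] 0)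
      ((fun τ : ℝ => (α τ + 1 - τ, 1 - τ)) '' Icc 0 1) := by
  have h := (hausdorffTendsto_leftPart_atTop hα.dual hN.dual).dual (α := α) (D := rightPart α)
    fun q hq0 hq1 => rightPart_dual hα hq0 hq1
  have e : dualMap α '' ((fun τ : ℝ => (dualProfile α τ, τ)) '' Icc 0 1) =
      (fun τ : ℝ => (α τ + 1 - τ, 1 - τ)) '' Icc 0 1 := by
    have e1 : Icc (0 : ℝ) 1 = (fun τ => 1 - τ) '' Icc 0 1 := by simp
    rw [image_image]
    conv_lhs => rw [e1]
    rw [image_image]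
    refine image_congr fun τ _ => ?_
    simp only [dualMap, dualProfile, sub_sub_cancel]
    congr 1
    ring
  rwa [e] at h

theorem tendsto_arcticPoint_left_zero (hα : IsGlobalProfile α) {a ρ : ℝ}
    (ha : HasDerivWithinAt α a (Icc 0 1) 0) (hρ : 0 < ρ) :
    Tendsto (fun q : ℝ => arcticPoint α q (1 / (1 - q ^ ρ))) (𝓝[>] 0)
      (𝓝 (max (1 - ρ * (1 - 1 / a)) 0, max (1 - ρ * (1 - 1 / a)) 0)) := by
  have h := tendsto_arcticPoint_nhdsGT_zero (f := fun q => 1 / (1 - q ^ ρ)) hα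
    (tendsto_arcticPoint_right hα.dual ha.dualProfile hρ) fun q hq0 hq1 => by
        have h1 : q ^ ρ < 1 := Real.rpow_lt_one hq0.le hq1 hρ
        refine ⟨(one_div_pos.2 (by linarith)).ne', ?_,
          Or.inr (lt_right ((one_lt_inv₀ hq0).2 hq1) hρ _)⟩
        rw [dualProfile_one hα.toIsStartingProfile, Real.inv_rpow hq0.le, Real.inv_rpow hq0.le,
          Real.rpow_neg hq0.le, Real.rpow_neg hq0.le, inv_inv, one_div_mul_eq_div]
  have e : dualMap α (dualProfile α 1, max (1 - ρ * (1 - 1 / a)) 0) =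
      (max (1 - ρ * (1 - 1 / a)) 0, max (1 - ρ * (1 - 1 / a)) 0) := by
    simp [dualMap, dualProfile_one hα.toIsStartingProfile]
  rwa [e] at h

/-- The dual right part tends to a vertical segment at abscissa α(1), on which `dualMap` reads
(α(1), y) ↦ (y, y). -/
theorem hausdorffTendsto_leftPart_zero (hα : IsGlobalProfile α) {a : ℝ}
    (ha : HasDerivWithinAt α a (Icc 0 1) 0) (ha1 : 1 < a) :
    HausdorffTendsto (leftPart α) (𝓝[>] 0) (segment ℝ (0, 0) (1, 1)) := by
  have h := (hausdorffTendsto_rightPart_atTop hα.dual ha.dualProfile ha1).dual (α := α)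
    (D := leftPart α) fun q hq0 hq1 => leftPart_dual hα hq0 hq1
  have e : dualMap α '' segment ℝ (dualProfile α 1, 0) (dualProfile α 1, 1) =
      segment ℝ (0, 0) (1, 1) := by
    rw [← Prod.image_mk_segment_right, segment_eq_Icc zero_le_one, segment_eq_image, image_image]
    refine image_congr fun y _ => ?_
    simp [dualMap, dualProfile_one hα.toIsStartingProfile]
  rwa [e] at h

theorem hausdorffTendsto_leftPart_zero_singleton (hα : IsGlobalProfile α)
    (hO : (fun u => α u - u) =O[𝓝[>] 0] (fun u : ℝ => u ^ 2)) :
    HausdorffTendsto (leftPart α) (𝓝[>] 0) {(1, 1)} := by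
  have h := (hausdorffTendsto_rightPart_atTop_singleton hα.dual
    (isBigO_dualProfile hα.toIsStartingProfile hO)).dual (α := α)
    (D := leftPart α) fun q hq0 hq1 => leftPart_dual hα hq0 hq1
  rw [image_singleton] at h
  have e : dualMap α (dualProfile α 1, 1) = (1, 1) := by
    simp [dualMap, dualProfile_one hα.toIsStartingProfile]
  rwa [e] at h

/-! ### The parametrization -/

theorem parametrization_wellDefined (hα : IsGlobalProfile α) (hq0 : 0 < q) (hq1 : q ≠ 1)
    (ht : t ∈ leftRange q ∪ rightRange α q) :
    IntervalIntegrable (fun u => 1 / (t - q ^ α u)) MeasureTheory.volume 0 1 ∧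
      DifferentiableAt ℝ (momentGen α q) t ∧
      (t ≠ 0 → q ^ (arcticPoint α q t).1 = arcticExpX α q t ∧
        q ^ (arcticPoint α q t).2 = arcticExpY α q t) := by
  have hcont : Continuous fun u => q ^ α u :=
    continuous_const.rpow hα.continuous fun _ => Or.inl hq0.ne'
  have hint : (∀ u, t - q ^ α u ≠ 0) →
      IntervalIntegrable (fun u => 1 / (t - q ^ α u)) MeasureTheory.volume 0 1 := fun hne =>
    (continuous_const.div (continuous_const.sub hcont) hne).intervalIntegrable _ _
  rcases lt_or_gt_of_ne hq1 with hlt | hgt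
  · rw [mem_union, leftRange_of_lt_one hlt, rightRange_of_lt_one hlt] at ht
    have h : IsOff (dualProfile α) q⁻¹ (t * q ^ (-α 1)) := ht.elim
      (fun h => Or.inr (isOff_dual_of_one_lt hα.toIsStartingProfile hq0 h))
      (fun h => Or.inl (isOff_dual_of_lt hq0 h))
    refine ⟨hint fun u => ?_, differentiableAt_momentGen_dual hα hq0 hlt h, fun ht0 => ?_⟩
    · have h1 : q ^ α u ≤ 1 := Real.rpow_le_one hq0.le hlt.le (hα.mem_Icc u).1
      have h2 : q ^ α 1 ≤ q ^ α u := Real.rpow_le_rpow_of_exponent_ge hq0 hlt.le (hα.mem_Icc u).2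
      rcases ht with ht | ht
      · exact (by linarith : 0 < t - q ^ α u).ne'
      · exact (by linarith : t - q ^ α u < 0).ne
    · obtain ⟨h1, h2⟩ := arcticExp_pos_dual hα hq0 hlt h ht0
      exact ⟨Real.rpow_logb hq0 hq1 h1, Real.rpow_logb hq0 hq1 h2⟩
  · rw [mem_union, leftRange_of_one_lt hgt, rightRange_of_one_lt hgt] at ht
    have h : IsOff α q t := ht
    exact ⟨hint (h.sub_ne_zero hα hgt), (h.hasDerivAt_momentGen hα hgt).1, fun ht0 =>
      ⟨Real.rpow_logb hq0 hq1 (h.arcticExpX_pos hα hgt ht0),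
        Real.rpow_logb hq0 hq1 (h.arcticExpY_pos hα hgt ht0)⟩⟩

/-! ### Extension of a profile to the line -/

/-- The profile, extended by its end values. -/
def clampProfile (α : ℝ → ℝ) (u : ℝ) : ℝ := α (max 0 (min u 1))

theorem clampProfile_of_mem {u : ℝ} (hu : u ∈ Icc (0 : ℝ) 1) : clampProfile α u = α u := by
  rw [clampProfile, min_eq_left hu.2, max_eq_right hu.1]

theorem clampProfile_eventuallyEq {u : ℝ} (hu : u ∈ Ioo (0 : ℝ) 1) :
    clampProfile α =ᶠ[𝓝 u] α := by
  filter_upwards [Ioo_mem_nhds hu.1 hu.2] with v hv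
  exact clampProfile_of_mem (Ioo_subset_Icc_self hv)

/-- Derivative conditions are imposed only inside (0, 1), where clamping changes nothing locally;
continuity on the whole line then spares all boundary considerations for the integrands. -/
theorem IsStartingProfile.clamp (hα : IsStartingProfile α) : IsGlobalProfile (clampProfile α) := by
  have h0 : (0 : ℝ) ∈ Icc (0 : ℝ) 1 := left_mem_Icc.2 zero_le_one
  have h1 : (1 : ℝ) ∈ Icc (0 : ℝ) 1 := right_mem_Icc.2 zero_le_one
  have hm : ∀ u : ℝ, max 0 (min u 1) ∈ Icc (0 : ℝ) 1 := fun u =>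
    ⟨le_max_left _ _, max_le zero_le_one (min_le_right _ _)⟩
  have hc : Continuous (clampProfile α) :=
    hα.continuousOn.comp_continuous (by fun_prop) hm
  refine ⟨⟨?_, ?_, hc.continuousOn, ?_⟩, hc, fun u => ⟨?_, ?_⟩⟩
  · rw [clampProfile_of_mem h0, hα.zero]
  · exact hα.increasing.congr fun u hu => (clampProfile_of_mem hu).symm
  · obtain ⟨S, hS, hd⟩ := hα.piecewise
    refine ⟨S, hS, fun u hu => ?_⟩
    have he := clampProfile_eventuallyEq (α := α) hu.1
    rw [he.deriv_eq]
    exact ⟨(hd u hu).1.congr_of_eventuallyEq he, (hd u hu).2⟩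
  · rw [← hα.zero]
    exact hα.increasing.monotoneOn h0 (hm u) (hm u).1
  · rw [clampProfile_of_mem h1]
    exact hα.increasing.monotoneOn (hm u) h1 (hm u).2

theorem momentGen_clampProfile (α : ℝ → ℝ) : momentGen (clampProfile α) = momentGen α := by
  funext q t
  rw [momentGen, momentGen]
  congr 2
  refine intervalIntegral.integral_congr fun u hu => ?_
  rw [uIcc_of_le zero_le_one] at hu
  simp only [clampProfile_of_mem hu]

theorem arcticPoint_clampProfile (α : ℝ → ℝ) : arcticPoint (clampProfile α) = arcticPoint α := by
  funext q t
  simp only [arcticPoint, arcticExpX, arcticExpY, momentGen_clampProfile]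

theorem clampProfile_one (α : ℝ → ℝ) : clampProfile α 1 = α 1 :=
  clampProfile_of_mem (right_mem_Icc.2 zero_le_one)

theorem rightRange_clampProfile (α : ℝ → ℝ) : rightRange (clampProfile α) = rightRange α := by
  funext q
  simp only [rightRange, clampProfile_one]

theorem leftPart_clampProfile (α : ℝ → ℝ) : leftPart (clampProfile α) = leftPart α := by
  funext q
  simp only [leftPart, arcticPoint_clampProfile]

theorem rightPart_clampProfile (α : ℝ → ℝ) : rightPart (clampProfile α) = rightPart α := by
  funext q
  simp only [rightPart, arcticPoint_clampProfile, rightRange_clampProfile]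

theorem NoFilledInterval.clamp (hN : NoFilledInterval α) : NoFilledInterval (clampProfile α) := by
  intro c d hc hcd hd
  obtain ⟨u, hu, hnd⟩ := hN c d hc hcd hd
  refine ⟨u, hu, fun h => hnd (h.congr_of_eventuallyEq ?_)⟩
  exact (clampProfile_eventuallyEq ⟨hc.trans_lt hu.1, hu.2.trans_le hd⟩).symm

theorem HasDerivWithinAt.clampProfile {a u : ℝ} (h : HasDerivWithinAt α a (Icc 0 1) u)
    (hu : u ∈ Icc (0 : ℝ) 1) : HasDerivWithinAt (clampProfile α) a (Icc 0 1) u :=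
  h.congr (fun _ hv => clampProfile_of_mem hv) (clampProfile_of_mem hu)

end

theorem mainTheorem5 (α : ℝ → ℝ) (hα : IsStartingProfile α) :
    -- the parametrization makes sense on the whole ranges of `t`
    (∀ q : ℝ, 0 < q → q ≠ 1 → ∀ t ∈ leftRange q ∪ rightRange α q,
      IntervalIntegrable (fun u => 1 / (t - q ^ α u)) MeasureTheory.volume 0 1 ∧
      DifferentiableAt ℝ (momentGen α q) t ∧
      (t ≠ 0 → q ^ (arcticPoint α q t).1 = arcticExpX α q t ∧
        q ^ (arcticPoint α q t).2 = arcticExpY α q t)) ∧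
    -- `q → ∞`, left part
    (NoFilledInterval α →
      (∀ τ ∈ Ioo (0 : ℝ) 1,
        Tendsto (fun q : ℝ => arcticPoint α q (-q ^ α τ)) atTop (𝓝 (α τ, τ))) ∧
      HausdorffTendsto (leftPart α) atTop ((fun τ : ℝ => (α τ, τ)) '' Icc 0 1)) ∧
    -- `q → ∞`, right part
    (∀ a : ℝ, HasDerivWithinAt α a (Icc 0 1) 1 →
      (∀ ρ : ℝ, 0 < ρ →
        Tendsto (fun q : ℝ => arcticPoint α q (q ^ α 1 / (1 - q ^ (-ρ)))) atTop
          (𝓝 (α 1, max (1 - ρ * (1 - 1 / a)) 0))) ∧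
      (1 < a → HausdorffTendsto (rightPart α) atTop (segment ℝ (α 1, 0) (α 1, 1)))) ∧
    ((fun u => α 1 - α u - (1 - u)) =O[𝓝[<] 1] (fun u : ℝ => (1 - u) ^ 2) →
      HausdorffTendsto (rightPart α) atTop {(α 1, 1)}) ∧
    -- `q → 0`, right part
    (NoFilledInterval α →
      (∀ τ ∈ Ioo (0 : ℝ) 1,
        Tendsto (fun q : ℝ => arcticPoint α q (-q ^ α τ)) (𝓝[>] 0)
          (𝓝 (α τ + 1 - τ, 1 - τ))) ∧
      HausdorffTendsto (rightPart α) (𝓝[>] 0)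
        ((fun τ : ℝ => (α τ + 1 - τ, 1 - τ)) '' Icc 0 1)) ∧
    -- `q → 0`, left part
    (∀ a : ℝ, HasDerivWithinAt α a (Icc 0 1) 0 →
      (∀ ρ : ℝ, 0 < ρ →
        Tendsto (fun q : ℝ => arcticPoint α q (1 / (1 - q ^ ρ))) (𝓝[>] 0)
          (𝓝 (max (1 - ρ * (1 - 1 / a)) 0, max (1 - ρ * (1 - 1 / a)) 0))) ∧
      (1 < a → HausdorffTendsto (leftPart α) (𝓝[>] 0) (segment ℝ (0, 0) (1, 1)))) ∧
    ((fun u => α u - u) =O[𝓝[>] 0] (fun u : ℝ => u ^ 2) →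
      HausdorffTendsto (leftPart α) (𝓝[>] 0) {(1, 1)}) := by
  -- The curves depend on α only through its values on [0, 1], so each claim is proved for the
  -- clamped profile and carried back.
  have hA := hα.clamp
  have h0 : (0 : ℝ) ∈ Icc (0 : ℝ) 1 := left_mem_Icc.2 zero_le_one
  have h1 : (1 : ℝ) ∈ Icc (0 : ℝ) 1 := right_mem_Icc.2 zero_le_one
  refine ⟨fun q hq0 hq1 t ht => ?_, fun hN => ⟨fun τ hτ => ?_, ?_⟩, fun a ha => ⟨fun ρ hρ => ?_,
    fun ha1 => ?_⟩, fun hO => ?_, fun hN => ⟨fun τ hτ => ?_, ?_⟩, fun a ha => ⟨fun ρ hρ => ?_,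
    fun ha1 => ?_⟩, fun hO => ?_⟩
  · rw [← rightRange_clampProfile] at ht
    obtain ⟨k1, k2, k3⟩ := parametrization_wellDefined hA hq0 hq1 ht
    refine ⟨k1.congr fun u hu => ?_, by rwa [momentGen_clampProfile] at k2, ?_⟩
    · rw [uIoc_of_le zero_le_one] at hu
      simp only [clampProfile_of_mem (Ioc_subset_Icc_self hu)]
    · simpa only [arcticPoint_clampProfile, arcticExpX, arcticExpY, momentGen_clampProfile] using k3
  · have := tendsto_arcticPoint_neg_rpow hA hN.clamp hτ
    rwa [arcticPoint_clampProfile, clampProfile_of_mem (Ioo_subset_Icc_self hτ)] at this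
  · have := hausdorffTendsto_leftPart_atTop hA hN.clamp
    rw [leftPart_clampProfile] at this
    rwa [image_congr fun τ hτ => by rw [clampProfile_of_mem hτ]] at this
  · have := tendsto_arcticPoint_right hA (ha.clampProfile h1) hρ
    rwa [arcticPoint_clampProfile, clampProfile_one] at this
  · have := hausdorffTendsto_rightPart_atTop hA (ha.clampProfile h1) ha1
    rwa [rightPart_clampProfile, clampProfile_one] at this
  · have := hausdorffTendsto_rightPart_atTop_singleton hA (hO.congr' (by
      filter_upwards [Ioo_mem_nhdsLT (zero_lt_one' ℝ)] with u hu
      rw [clampProfile_one, clampProfile_of_mem (Ioo_subset_Icc_self hu)]) EventuallyEq.rfl)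
    rwa [rightPart_clampProfile, clampProfile_one] at this
  · have := tendsto_arcticPoint_neg_rpow_zero hA hN.clamp hτ
    rwa [arcticPoint_clampProfile, clampProfile_of_mem (Ioo_subset_Icc_self hτ)] at this
  · have := hausdorffTendsto_rightPart_zero hA hN.clamp
    rw [rightPart_clampProfile] at this
    rwa [image_congr fun τ hτ => by rw [clampProfile_of_mem hτ]] at this
  · have := tendsto_arcticPoint_left_zero hA (ha.clampProfile h0) hρ
    rwa [arcticPoint_clampProfile] at this
  · have := hausdorffTendsto_leftPart_zero hA (ha.clampProfile h0) ha1
    rwa [leftPart_clampProfile] at this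
  · have := hausdorffTendsto_leftPart_zero_singleton hA (hO.congr' (by
      filter_upwards [Ioo_mem_nhdsGT (zero_lt_one' ℝ)] with u hu
      rw [clampProfile_of_mem (Ioo_subset_Icc_self hu)]) EventuallyEq.rfl)
    rwa [leftPart_clampProfile] at this
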